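/- **Setting.** A *link* is a sequence of functions $L=(L_n)_{n\ge1}$, $L_n:\{1,\dots,n\}^2\to I$ (with $I=\mathbb Z_+$ or $\mathbb Z_+^2$, say); it is symmetric if $L_n(i,j)=L_n(j,i)$. Put $\Delta_L=\sup_n\sup_{t}\sup_{1\le k\le n}\#\{l\le n: L_n(k,l)=t\}$; $L$ has *Property B* if $\Delta_L<\infty$. Put $k_n=\#\{L_n(i,j):1\le i,j\le n\}$ and $\alpha_n=\max_v\#\{(i,j):L_n(i,j)=v\}$; the *growth conditions* are $k_n\to\infty$ and $k_n\alpha_n=O(n^2)$. An input family $(x_i)_{i\in I}$ of independent real random variables with mean $0$ and variance $1$ satisfies (A1) if it is uniformly bounded, (A2) if it is identically distributed, (A3) if $\sup_i\mathbb E|x_i|^m<\infty$ for every $m$. The patterned matrix is $X_n=(x_{L_n(i,j)})_{i,j\le n}$. A *circuit* of length $h$ is a map $\pi:\{0,\dots,h\}\to\{1,\dots,n\}$ with $\pi(0)=\pi(h)$. A *word* of length $h$ is a sequence $w[1]\cdots w[h]$ of letters whose first occurrences are in alphabetical order; it is *pair-matched* if each of its letters occurs exactly twice, and $\mathcal W_{2k}$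 is the set of pair-matched words of length $2k$. Let $\Pi_L(w)$ be the set of circuits $\pi$ with $w[i]=w[j]\Leftrightarrow L_n(\pi(i-1),\pi(i))=L_n(\pi(j-1),\pi(j))$ for all $i,j$. **Theorem.** Let $L_X,L_Y$ be symmetric links with Property B, and suppose that for all $k$ and all $w,w'\in\mathcal W_{2k}$ the limit $$p_Z(w,w')=\lim_{n\to\infty}n^{-(1+k)}\,\#\bigl(\Pi_{L_X}(w)\cap\Pi_{L_Y}(w')\bigr)$$ exists. Put $\beta_h=0$ for odd $h$ and $\beta_{2k}=\sum_{w,w'\in\mathcal W_{2k}}p_Z(w,w')$. Then $$\beta_{2k}\le\frac{(2k)!}{2^kk!}\,\Delta^k\quad(k\ge0),\qquad \Delta=\min\{\Delta_{L_X},\Delta_{L_Y}\},$$ the sequence $(\beta_h)$ satisfies Carleman's condition $\sum_{h\ge1}\beta_{2h}^{-1/(2h)}=\infty$, and there is a sub-Gaussian probability measure $\mu$ on $\mathbb R$, depending only on the two links, whose $h$-th moment is $\beta_h$ for every $h$, such that the following holds for all independent input families $(x_i)$, $(y_j)$ with patterned matrices $X_n$, $Y_n$ (links $L_X$, $L_Y$).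 Write $A_n=n^{-1/2}\,X_n\odot Y_n$ (entrywise product) and let $\beta_h(A_n)$ be the $h$-th moment of the empirical spectral distribution (ESD) of $A_n$. 1. If both input families satisfy (A1), then $\mathbb E\,\beta_h(A_n)\to\beta_h$ and $\sum_n\mathbb E[\beta_h(A_n)-\mathbb E\beta_h(A_n)]^4<\infty$ for every $h$, and almost surely the ESD of $A_n$ converges weakly to $\mu$. 2. If both links satisfy the growth conditions and both input families satisfy (A3), then almost surely the ESD of $A_n$ converges weakly to $\mu$. 3. If both links satisfy the growth conditions and each input family satisfies (A2) or (A3), then the ESD of $A_n$ converges weakly to $\mu$ in probability. -/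

import Mathlib

open MeasureTheory ProbabilityTheory Filter Topology

noncomputable section

namespace SchurHadamard

/-! ### Link functions -/

/-- A link function: a sequence `L_n : {1, …, n}² → ι`. The index set `ι` of the input variables
is arbitrary, in particular it may be `ℕ` or `ℕ × ℕ`. The index set `{1, …, n}` is `Fin n`. -/
abbrev Link (ι : Type*) := (n : ℕ) → Fin n → Fin n → ι

/-- `L(i,j) = L(j,i)` for all `i, j`. -/
def Link.IsSymm {ι : Type*} (L : Link ι) : Prop :=
  ∀ (n : ℕ) (i j : Fin n), L n i j = L n j i

/-- `Δ_L`, the supremum over `n`, over the values `t` and over the rows `k`, of the number of times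
that the value `t` appears in row `k` (values outside the range of `L` contribute `0`). -/
def Link.Delta {ι : Type*} (L : Link ι) : ℕ∞ :=
  ⨆ (n : ℕ) (t : ι) (k : Fin n), {l : Fin n | L n k l = t}.encard

/-- Property B: `Δ_L < ∞`. -/
def Link.PropertyB {ι : Type*} (L : Link ι) : Prop := L.Delta < ⊤

/-- `k_n`, the number of distinct values of `L_n`. -/
def Link.numValues {ι : Type*} (L : Link ι) (n : ℕ) : ℕ :=
  {v : ι | ∃ i j : Fin n, L n i j = v}.ncard

/-- `α_n`, the maximal number of positions at which `L_n` takes one and the same value. -/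
def Link.maxMult {ι : Type*} (L : Link ι) (n : ℕ) : ℕ :=
  ⨆ v : ι, {q : Fin n × Fin n | L n q.1 q.2 = v}.ncard

/-- The conditions `k_n → ∞` and `k_n α_n = O(n²)`. -/
def Link.GrowthCond {ι : Type*} (L : Link ι) : Prop :=
  Tendsto L.numValues atTop atTop ∧
    (fun n : ℕ => (L.numValues n : ℝ) * (L.maxMult n : ℝ)) =O[atTop] fun n : ℕ => (n : ℝ) ^ 2

/-! ### Words and circuits -/

/-- Words of length `h`: the first occurrences of the letters are in alphabetical order (each
letter that precedes the letter at position `i` in the alphabet already occurs before `i`). A word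
of length `h` has at most `h` letters, so that `Fin h` is a large enough alphabet. -/
abbrev Word (h : ℕ) := {w : Fin h → Fin h // ∀ i c, c < w i → ∃ j, j < i ∧ w j = c}

/-- Every letter of the word appears exactly twice. -/
def Word.PairMatched {h : ℕ} (w : Word h) : Prop :=
  ∀ i : Fin h, (Finset.univ.filter fun j => w.1 j = w.1 i).card = 2

instance {h : ℕ} : DecidablePred (Word.PairMatched (h := h)) := fun w => by
  unfold Word.PairMatched; infer_instance

/-- The pair-matched words of length `h`. -/
def pairMatchedWords (h : ℕ) : Finset (Word h) := Finset.univ.filter Word.PairMatched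

/-- Circuits of length `h` on `n` points: functions `π : {0, …, h} → {1, …, n}` with
`π 0 = π h`. -/
def IsCircuit {h n : ℕ} (π : Fin (h + 1) → Fin n) : Prop := π 0 = π (Fin.last h)

/-- The `L`-value of the `i`-th edge `(π (i-1), π i)`; edges are numbered from `0` here. -/
def Link.edgeValue {ι : Type*} (L : Link ι) {h n : ℕ} (π : Fin (h + 1) → Fin n) (i : Fin h) : ι :=
  L n (π i.castSucc) (π i.succ)

/-- `Π_L(w)`: the circuits whose `L`-values match exactly where the letters of `w` match. -/
def circuits {ι : Type*} (L : Link ι) {h : ℕ} (n : ℕ) (w : Word h) : Set (Fin (h + 1) → Fin n) :=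
  {π | IsCircuit π ∧ ∀ i j, w.1 i = w.1 j ↔ L.edgeValue π i = L.edgeValue π j}

/-- `Π_Z(w, w') = Π_X(w) ∩ Π_Y(w')`. -/
def jointCircuits {ι κ : Type*} (LX : Link ι) (LY : Link κ) {h : ℕ} (n : ℕ) (w w' : Word h) :
    Set (Fin (h + 1) → Fin n) :=
  circuits LX n w ∩ circuits LY n w'

/-- `p` is the family of limits `p_Z(w, w') = lim n^{-(1+k)} #Π_Z(w, w')`, for all pairs of
pair-matched words of the same length `2k`. -/
def IsWordLimit {ι κ : Type*} (LX : Link ι) (LY : Link κ) (p : (h : ℕ) → Word h → Word h → ℝ) :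
    Prop :=
  ∀ (k : ℕ) (w w' : Word (2 * k)), w.PairMatched → w'.PairMatched →
    Tendsto (fun n : ℕ => ((jointCircuits LX LY n w w').ncard : ℝ) / (n : ℝ) ^ (1 + k)) atTop
      (𝓝 (p (2 * k) w w'))

/-- `β_h`: zero for odd `h`, and the sum of `p(w, w')` over all pairs of pair-matched words of
length `h` for even `h`. -/
def limitMoment (p : (h : ℕ) → Word h → Word h → ℝ) (h : ℕ) : ℝ :=
  if Odd h then 0 else ∑ w ∈ pairMatchedWords h, ∑ w' ∈ pairMatchedWords h, p h w w'

/-- Carleman's condition `∑_{h ≥ 1} β_{2h}^{-1/(2h)} = ∞`. -/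
def Carleman (β : ℕ → ℝ) : Prop :=
  ¬ Summable fun h : ℕ => (β (2 * (h + 1))) ^ (-(1 : ℝ) / (2 * ((h : ℝ) + 1)))

/-! ### Input sequences -/

section Inputs

variable {Ω ι : Type*} [MeasurableSpace Ω]

/-- Common part of the assumptions: independent, square integrable, mean 0 and variance 1. -/
structure StandardInput (P : Measure Ω) (x : ι → Ω → ℝ) : Prop where
  measurable : ∀ i, Measurable (x i)
  indep : iIndepFun x P
  memLp : ∀ i, MemLp (x i) 2 P
  mean_zero : ∀ i, ∫ ω, x i ω ∂P = 0
  variance_one : ∀ i, variance (x i) P = 1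

/-- Independent, mean 0, variance 1, uniformly bounded. -/
def InputA1 (P : Measure Ω) (x : ι → Ω → ℝ) : Prop :=
  StandardInput P x ∧ ∃ C : ℝ, ∀ i, ∀ᵐ ω ∂P, |x i ω| ≤ C

/-- I.i.d., mean 0, variance 1. -/
def InputA2 (P : Measure Ω) (x : ι → Ω → ℝ) : Prop :=
  StandardInput P x ∧ ∀ i j, IdentDistrib (x i) (x j) P P

/-- Independent, mean 0, variance 1, with uniformly bounded moments of all orders. -/
def InputA3 (P : Measure Ω) (x : ι → Ω → ℝ) : Prop :=
  StandardInput P x ∧ ∀ m : ℕ, ∃ C : ℝ, ∀ i,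
    Integrable (fun ω => |x i ω| ^ m) P ∧ ∫ ω, |x i ω| ^ m ∂P ≤ C

end Inputs

/-! ### Matrices and spectral distributions -/

/-- The patterned matrix `((x_{L(i,j)}))`. -/
def patterned {Ω ι : Type*} (L : Link ι) (x : ι → Ω → ℝ) (n : ℕ) (ω : Ω) :
    Matrix (Fin n) (Fin n) ℝ :=
  Matrix.of fun i j => x (L n i j) ω

/-- The matrix `n^{-1/2} X_n ⊙ Y_n`. -/
def scaledProduct {Ω ι κ : Type*} (LX : Link ι) (LY : Link κ) (x : ι → Ω → ℝ) (y : κ → Ω → ℝ)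
    (n : ℕ) (ω : Ω) : Matrix (Fin n) (Fin n) ℝ :=
  (Real.sqrt n)⁻¹ • (patterned LX x n ω).hadamard (patterned LY y n ω)

/-- The empirical spectral measure of a matrix with real eigenvalues: mass `1/n` at each
eigenvalue, counted with multiplicity. -/
def esd {n : ℕ} (A : Matrix (Fin n) (Fin n) ℝ) : Measure ℝ :=
  (n : ENNReal)⁻¹ • (A.charpoly.roots.map Measure.dirac).sum

/-- `β_h(A)`, the `h`-th moment of the empirical spectral distribution. -/
def esdMoment (h : ℕ) {n : ℕ} (A : Matrix (Fin n) (Fin n) ℝ) : ℝ := ∫ t, t ^ h ∂(esd A)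

/-- The distribution function of the empirical spectral measure. -/
def esdCDF {n : ℕ} (A : Matrix (Fin n) (Fin n) ℝ) (t : ℝ) : ℝ := (esd A).real (Set.Iic t)

section Convergence

variable {Ω : Type*} [MeasurableSpace Ω]

/-- Outside a null set, the empirical spectral distribution functions of `A_n` converge to the
distribution function of `μ` at all continuity points of the latter. -/
def LSDAlmostSurely (P : Measure Ω) (A : (n : ℕ) → Ω → Matrix (Fin n) (Fin n) ℝ) (μ : Measure ℝ) :
    Prop :=
  ∀ᵐ ω ∂P, ∀ t : ℝ, ContinuousAt (cdf μ) t →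
    Tendsto (fun n => esdCDF (A n ω) t) atTop (𝓝 (cdf μ t))

/-- The same convergence, in probability. -/
def LSDInProbability (P : Measure Ω) (A : (n : ℕ) → Ω → Matrix (Fin n) (Fin n) ℝ) (μ : Measure ℝ) :
    Prop :=
  ∀ t : ℝ, ContinuousAt (cdf μ) t →
    TendstoInMeasure P (fun n ω => esdCDF (A n ω) t) atTop (fun _ => cdf μ t)

/-- The expected moments of the empirical spectral distributions exist and converge to `β`. -/
def ExpectedMomentsTendsto (P : Measure Ω) (A : (n : ℕ) → Ω → Matrix (Fin n) (Fin n) ℝ)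
    (β : ℕ → ℝ) : Prop :=
  ∀ h : ℕ, (∀ n, Integrable (fun ω => esdMoment h (A n ω)) P) ∧
    Tendsto (fun n => ∫ ω, esdMoment h (A n ω) ∂P) atTop (𝓝 (β h))

/-- `∑_n E[β_h(A_n) - E β_h(A_n)]⁴ < ∞` for every `h`. -/
def FourthMomentSummable (P : Measure Ω) (A : (n : ℕ) → Ω → Matrix (Fin n) (Fin n) ℝ) : Prop :=
  ∀ h : ℕ, (∀ n, MemLp (fun ω => esdMoment h (A n ω)) 4 P) ∧
    Summable fun n => ∫ ω, (esdMoment h (A n ω) - ∫ ω', esdMoment h (A n ω') ∂P) ^ 4 ∂P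

end Convergence

end SchurHadamard

end

/-!
The `h`-th moment of the spectral distribution of `A_n` is a normalised sum over the closed paths
of length `h`, and its expectation is carried by the paths whose link values are matched. Property B
says that a matched step leaves at most `Δ` choices for its end point, so a path in which some link
value is taken three times is negligible in the limit, and the pair-matched paths, sorted by their
words for both links, contribute `β_h`. In the fourth centred moment a nonzero term comes from four
paths each of which shares link values with another one, for `X` or for `Y`; the sharing costs a
factor `n²`, so the fourth moments are summable and the moments converge almost surely.

The bound on `β_{2k}` is a Gaussian moment bound: it makes the laws with these moments sub-Gaussian
and hence at most one. One such law is a weak limit of the spectral distributions for Gaussian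
inputs, and then moment convergence implies weak convergence. Inputs with uniformly integrable
squares are truncated to bounded ones; this changes `A_n` by little in normalised Frobenius norm,
which controls the spectral distribution functions.
-/

namespace SchurHadamard

/-! ### Counting circuits with prescribed coincidences -/

section Counting

theorem card_image_restrict_insert_le {α β : Type*} [DecidableEq α] [DecidableEq β]
    (S : Finset (α → β)) (s : Finset α) (j : α) {b : ℕ}
    (hb : ∀ φ₀ ∈ S, ∀ T : Finset β,
      (∀ a ∈ T, ∃ φ ∈ S, (∀ i ∈ s, φ i = φ₀ i) ∧ φ j = a) → T.card ≤ b) :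
    (S.image (insert j s).restrict).card ≤ b * (S.image s.restrict).card := by
  let r := Finset.restrict₂ (π := fun _ : α => β) (Finset.subset_insert j s)
  have hr : (S.image (insert j s).restrict).image r = S.image s.restrict := Finset.image_image
  rw [← hr]
  refine Finset.card_le_mul_card_image _ _ fun c hc => ?_
  rw [hr] at hc
  obtain ⟨φ₀, hφ₀, rfl⟩ := Finset.mem_image.1 hc
  rw [← Finset.card_image_of_injOn (f := fun a => a ⟨j, Finset.mem_insert_self j s⟩)]
  · refine hb φ₀ hφ₀ _ fun b hb => ?_
    obtain ⟨a, ha, rfl⟩ := Finset.mem_image.1 hb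
    obtain ⟨ha, hac⟩ := Finset.mem_filter.1 ha
    obtain ⟨φ, hφ, rfl⟩ := Finset.mem_image.1 ha
    exact ⟨φ, hφ, fun i hi => congrFun hac ⟨i, hi⟩, rfl⟩
  · intro a ha b hb hab
    have hrab : r a = r b := (Finset.mem_filter.1 ha).2.trans (Finset.mem_filter.1 hb).2.symm
    funext ⟨i, hi⟩
    rcases Finset.mem_insert.1 hi with rfl | hi'
    · exact hab
    · exact congrFun hrab ⟨i, hi'⟩

theorem card_le_prod_of_card_continuations_le {α β : Type*} [Fintype α] [LinearOrder α]
    (S : Finset (α → β)) (B : α → ℕ)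
    (hB : ∀ j, ∀ φ₀ ∈ S, ∀ T : Finset β,
      (∀ a ∈ T, ∃ φ ∈ S, (∀ i < j, φ i = φ₀ i) ∧ φ j = a) → T.card ≤ B j) :
    S.card ≤ ∏ j, B j := by
  classical
  suffices H : ∀ s : Finset α, IsLowerSet (s : Set α) →
      (S.image s.restrict).card ≤ ∏ j ∈ s, B j by
    have hinj : Function.Injective (Finset.restrict (π := fun _ : α => β) Finset.univ) :=
      fun φ ψ hφψ => funext fun i => congrFun hφψ ⟨i, Finset.mem_univ i⟩
    simpa only [Finset.card_image_of_injective S hinj] using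
      H Finset.univ (by simpa using isLowerSet_univ)
  intro s
  induction s using Finset.induction_on_max with
  | empty => exact fun _ => by simpa using Finset.card_le_one_of_subsingleton (S.image _)
  | insert j s hj ih =>
    intro hs
    have hsj : ∀ i < j, i ∈ s := fun i hij =>
      (Finset.mem_insert.1 (hs hij.le (Finset.mem_insert_self j s))).resolve_left hij.ne
    have hs' : IsLowerSet (s : Set α) := fun a b hba ha => hsj b (hba.trans_lt (hj a ha))
    rw [Finset.prod_insert fun h => (hj j h).false]
    refine (card_image_restrict_insert_le S s j fun φ₀ hφ₀ T hT =>
      hB j φ₀ hφ₀ T fun a ha => ?_).trans (Nat.mul_le_mul_left _ (ih hs'))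
    obtain ⟨φ, hφ, hpre, rfl⟩ := hT a ha
    exact ⟨φ, hφ, fun i hi => hpre i (hsj i hi), rfl⟩

/-- Every row of `L` contains every value at most `D` times, that is, `Δ_L ≤ D`. -/
def RowBound {ι : Type*} (L : Link ι) (D : ℕ) : Prop :=
  ∀ (n : ℕ) (t : ι) (k : Fin n), {l : Fin n | L n k l = t}.ncard ≤ D

variable {ι Λ : Type*} {L : Link ι} {D n h : ℕ}

theorem Link.PropertyB.rowBound (hL : L.PropertyB) : RowBound L L.Delta.toNat := by
  intro n t k
  have hle : {l : Fin n | L n k l = t}.encard ≤ L.Delta :=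
    le_iSup_of_le n (le_iSup_of_le t (le_iSup (fun k => {l : Fin n | L n k l = t}.encard) k))
  exact ENat.toNat_le_toNat hle hL.ne

theorem RowBound.one_le (hD : RowBound L D) : 1 ≤ D :=
  (Nat.succ_le_of_lt ((Set.ncard_pos (Set.toFinite {l : Fin 1 | L 1 0 l = L 1 0 0})).2
    ⟨0, rfl⟩)).trans (hD 1 (L 1 0 0) 0)

/-- Each step whose link value is determined by the preceding vertices leaves only `D` choices. -/
theorem card_paths_le (hD : RowBound L D) (S : Finset (Fin (h + 1) → Fin n)) (F : Finset (Fin h))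
    (hF : ∀ k ∉ F, ∀ φ₀ ∈ S, ∃ t, ∀ φ ∈ S, (∀ i ≤ k.castSucc, φ i = φ₀ i) →
      L.edgeValue φ k = t) :
    S.card ≤ n ^ (1 + F.card) * D ^ (h - F.card) := by
  classical
  calc S.card ≤ ∏ j, (Fin.cons n fun k => if k ∈ F then n else D : Fin (h + 1) → ℕ) j := by
        refine card_le_prod_of_card_continuations_le S _ fun j φ₀ hφ₀ T hT => ?_
        cases j using Fin.cases with
        | zero => simpa using Finset.card_le_univ T
        | succ k =>
          simp only [Fin.cons_succ]
          split_ifs with hk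
          · simpa using Finset.card_le_univ T
          obtain ⟨t, ht⟩ := hF k hk φ₀ hφ₀
          refine le_trans ?_ (hD n t (φ₀ k.castSucc))
          rw [← Set.ncard_coe_finset]
          refine Set.ncard_le_ncard (fun a ha => ?_) (Set.toFinite _)
          obtain ⟨φ, hφ, hpre, rfl⟩ := hT a ha
          have hpre' : ∀ i ≤ k.castSucc, φ i = φ₀ i := fun i hi =>
            hpre i (hi.trans_lt Fin.castSucc_lt_succ)
          rw [Set.mem_ofPred_eq, ← hpre' _ le_rfl]
          exact ht φ hφ hpre'
    _ = n ^ (1 + F.card) * D ^ (h - F.card) := by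
        have hcompl : (Finset.univ.filter (· ∉ F)).card = h - F.card := by
          rw [Finset.filter_not, Finset.filter_mem_eq_inter, Finset.univ_inter,
            ← Finset.compl_eq_univ_sdiff, Finset.card_compl, Fintype.card_fin]
        simp only [Fin.prod_univ_succ, Fin.cons_zero, Fin.cons_succ, Finset.prod_ite,
          Finset.prod_const, Finset.filter_mem_eq_inter, Finset.univ_inter, hcompl, pow_add,
          pow_one, mul_assoc]

/-- The positions at which a letter of `A` appears in `w` for the first time. -/
def firstOccurrences [DecidableEq Λ] (w : Fin h → Λ) (A : Finset Λ) : Finset (Fin h) :=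
  Finset.univ.filter fun k => w k ∈ A ∧ ∀ j < k, w j ≠ w k

theorem injOn_firstOccurrences [DecidableEq Λ] (w : Fin h → Λ) (A : Finset Λ) :
    Set.InjOn w (firstOccurrences w A) := by
  intro i hi j hj hij
  have hi' := (Finset.mem_filter.1 hi).2.2
  have hj' := (Finset.mem_filter.1 hj).2.2
  exact le_antisymm (not_lt.1 fun hlt => hi' j hlt hij.symm) (not_lt.1 fun hlt => hj' i hlt hij)

theorem card_firstOccurrences_le [DecidableEq Λ] (w : Fin h → Λ) (A : Finset Λ) :
    (firstOccurrences w A).card ≤ A.card :=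
  Finset.card_le_card_of_injOn w (fun _ hk => (Finset.mem_filter.1 hk).2.1)
    (injOn_firstOccurrences w A)

theorem exists_le_mem_firstOccurrences [DecidableEq Λ] (w : Fin h → Λ) {A : Finset Λ} {k : Fin h}
    (hk : w k ∈ A) : ∃ j ≤ k, j ∈ firstOccurrences w A ∧ w j = w k := by
  induction k using WellFoundedLT.induction with
  | ind k ih =>
    by_cases hfirst : ∀ j < k, w j ≠ w k
    · exact ⟨k, le_rfl, Finset.mem_filter.2 ⟨Finset.mem_univ k, hk, hfirst⟩, rfl⟩
    · push Not at hfirst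
      obtain ⟨j, hjk, hj⟩ := hfirst
      obtain ⟨i, hij, hi, hwi⟩ := ih j hjk (hj ▸ hk)
      exact ⟨i, hij.trans hjk.le, hi, hwi.trans hj⟩

theorem card_paths_le_of_firstOccurrences [DecidableEq Λ] (hD : RowBound L D)
    (S : Finset (Fin (h + 1) → Fin n)) (w : Fin h → Λ) (A : Finset Λ)
    (hw : ∀ φ ∈ S, ∀ i j, w i = w j → L.edgeValue φ i = L.edgeValue φ j)
    (hA : ∀ φ ∈ S, ∀ ψ ∈ S, ∀ i, w i ∉ A → L.edgeValue φ i = L.edgeValue ψ i) :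
    S.card ≤ n ^ (1 + (firstOccurrences w A).card) * D ^ (h - (firstOccurrences w A).card) := by
  refine card_paths_le hD S _ fun k hk φ₀ hφ₀ => ⟨L.edgeValue φ₀ k, fun φ hφ hpre => ?_⟩
  by_cases hkA : w k ∈ A
  · obtain ⟨j, hjk, hj, hwj⟩ := exists_le_mem_firstOccurrences w hkA
    have hlt : j < k := lt_of_le_of_ne hjk fun h => hk (h ▸ hj)
    rw [← hw φ hφ j k hwj, ← hw φ₀ hφ₀ j k hwj, Link.edgeValue, Link.edgeValue,
      hpre _ (Fin.castSucc_le_castSucc_iff.2 hlt.le),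
      hpre _ (Fin.le_castSucc_iff.2 (by simpa using hlt))]
  · exact hA φ hφ φ₀ hφ₀ k hkA

theorem card_paths_le_of_labels (hD : RowBound L D) (S : Finset (Fin (h + 1) → Fin n))
    (w : Fin h → Λ) (A : Finset Λ)
    (hw : ∀ φ ∈ S, ∀ i j, w i = w j → L.edgeValue φ i = L.edgeValue φ j)
    (hA : ∀ φ ∈ S, ∀ ψ ∈ S, ∀ i, w i ∉ A → L.edgeValue φ i = L.edgeValue ψ i) :
    S.card ≤ n ^ (1 + A.card) * D ^ h := by
  classical
  rcases S.eq_empty_or_nonempty with rfl | ⟨φ, _⟩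
  · simp
  exact (card_paths_le_of_firstOccurrences hD S w A hw hA).trans (Nat.mul_le_mul
    (Nat.pow_le_pow_right (φ 0).pos (Nat.add_le_add_left (card_firstOccurrences_le w A) 1))
    (Nat.pow_le_pow_right hD.one_le (Nat.sub_le _ _)))

theorem IsCircuit.edgeValue_eq {φ : Fin (h + 2) → Fin n} (hφ : IsCircuit φ) (k : Fin (h + 1)) :
    L.edgeValue φ k = L n (φ k.castSucc) (φ (k + 1).castSucc) := by
  rw [Link.edgeValue]
  congr 1
  induction k using Fin.lastCases with
  | last => rw [Fin.last_add_one, Fin.castSucc_zero, Fin.succ_last]; exact hφ.symm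
  | cast k => rw [Fin.coeSucc_eq_succ, Fin.succ_castSucc]

theorem IsCircuit.ext {φ ψ : Fin (h + 2) → Fin n} (hφ : IsCircuit φ) (hψ : IsCircuit ψ)
    (heq : ∀ k : Fin (h + 1), φ k.castSucc = ψ k.castSucc) : φ = ψ := by
  funext i
  induction i using Fin.lastCases with
  | last => rw [← hφ, ← hψ]; exact heq 0
  | cast k => exact heq k

/-- The link value of the step `e` is not counted, because a circuit closes: rotating the circuit
makes `e` its last step, which is determined by the others. -/
theorem card_circuits_le_of_labels (hD : RowBound L D) (S : Finset (Fin (h + 1) → Fin n))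
    (hS : ∀ φ ∈ S, IsCircuit φ) (w : Fin h → Λ) (A : Finset Λ) (e : Fin h)
    (hw : ∀ φ ∈ S, ∀ i j, w i = w j → L.edgeValue φ i = L.edgeValue φ j)
    (hA : ∀ φ ∈ S, ∀ ψ ∈ S, ∀ i ≠ e, w i ∉ A → L.edgeValue φ i = L.edgeValue ψ i) :
    S.card ≤ n ^ (1 + A.card) * D ^ h := by
  classical
  obtain _ | N := h
  · exact e.elim0
  let rotate : (Fin (N + 2) → Fin n) → Fin (N + 1) → Fin n := fun φ k => φ (k + (e + 1)).castSucc
  let edge : Fin N → Fin (N + 1) := fun k => k.castSucc + (e + 1)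
  have hedge : ∀ k, edge k ≠ e := fun k hk => by
    have hk' : k.castSucc + 1 = 0 := by
      have : e + (k.castSucc + 1) = e + 0 := by rw [add_zero, ← hk]; simp only [edge]; grind
      exact add_left_cancel this
    rw [Fin.coeSucc_eq_succ] at hk'
    exact Fin.succ_ne_zero k hk'
  have hval : ∀ φ ∈ S, ∀ k, L.edgeValue (rotate φ) k = L.edgeValue φ (edge k) := fun φ hφ k => by
    rw [(hS φ hφ).edgeValue_eq, Link.edgeValue, ← Fin.coeSucc_eq_succ, add_right_comm]
  have hinj : Set.InjOn rotate S := fun φ hφ ψ hψ hφψ =>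
    (hS φ hφ).ext (hS ψ hψ) fun k => by simpa [rotate] using congrFun hφψ (k - (e + 1))
  calc S.card = (S.image rotate).card := (Finset.card_image_of_injOn hinj).symm
    _ ≤ n ^ (1 + A.card) * D ^ N := by
        refine card_paths_le_of_labels hD _ (w ∘ edge) A ?_ ?_
        · simp only [Finset.forall_mem_image]
          intro φ hφ i j hij
          rw [hval φ hφ, hval φ hφ]
          exact hw φ hφ _ _ hij
        · simp only [Finset.forall_mem_image]
          intro φ hφ ψ hψ i hi
          rw [hval φ hφ, hval ψ hψ]
          exact hA φ hφ ψ hψ _ (hedge i) hi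
    _ ≤ _ := Nat.mul_le_mul_left _ (Nat.pow_le_pow_right hD.one_le (Nat.le_succ N))

end Counting

/-! ### Families of circuits with common link values -/

section Families

variable {α β ι Λ : Type*} {L : Link ι} {D n h : ℕ}

/-- Every value of `v` is taken at least twice. -/
def Matched (v : β → Λ) : Prop := ∀ i, ∃ j ≠ i, v j = v i

/-- Every value of `v` is taken exactly twice. -/
def PairMatched (v : β → Λ) : Prop := ∀ i, {j | v j = v i}.ncard = 2

/-- Every row of the array `v` has an entry in common with another row. -/
def CrossMatched (v : α × β → Λ) : Prop := ∀ j, ∃ j' ≠ j, ∃ i i', v (j', i') = v (j, i)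

/-- The array of link values of a family of paths, one row for each path. -/
def Link.familyValue (L : Link ι) (φ : α → Fin (h + 1) → Fin n) (q : α × Fin h) : ι :=
  L.edgeValue (φ q.1) q.2

theorem Matched.two_le_card_fiber [Fintype β] [DecidableEq Λ] {v : β → Λ} (hm : Matched v) (i : β) :
    2 ≤ (Finset.univ.filter fun j => v j = v i).card := by
  obtain ⟨j, hne, hj⟩ := hm i
  exact Finset.one_lt_card.2 ⟨j, by simpa using hj, i, by simp, hne⟩

open Classical in
/-- The rows `j` of `w` with an entry that occurs once in row `j` and not at all in the rows `j'`
with `r j' j`: if the rows are filled in the order `r`, a step with a new link value closes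
circuit `j`. -/
noncomputable def closingRows [Fintype α] (w : α × β → Λ) (r : α → α → Prop) : Finset α :=
  Finset.univ.filter fun j =>
    ∃ e, (∀ i ≠ e, w (j, i) ≠ w (j, e)) ∧ ∀ j', r j' j → ∀ i, w (j', i) ≠ w (j, e)

theorem mem_closingRows [Fintype α] {w : α × β → Λ} {r : α → α → Prop} {j : α} :
    j ∈ closingRows w r ↔
      ∃ e, (∀ i ≠ e, w (j, i) ≠ w (j, e)) ∧ ∀ j', r j' j → ∀ i, w (j', i) ≠ w (j, e) := by
  simp only [closingRows, Finset.mem_filter, Finset.mem_univ, true_and]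

section Order

variable [Fintype α] [LinearOrder α]

open Classical in
/-- The entries of row `j` of the array `w` that do not occur in the preceding rows. -/
noncomputable def newEntries [Fintype β] (w : α × β → Λ) (j : α) : Finset Λ :=
  (Finset.univ.image fun i => w (j, i)).filter fun l => ∀ j' < j, ∀ i, w (j', i) ≠ l

theorem mem_newEntries [Fintype β] {w : α × β → Λ} {j : α} {l : Λ} :
    l ∈ newEntries w j ↔ (∃ i, w (j, i) = l) ∧ ∀ j' < j, ∀ i, w (j', i) ≠ l := by
  simp only [newEntries, Finset.mem_filter, Finset.mem_image, Finset.mem_univ, true_and]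

theorem sum_card_newEntries_le [Fintype β] [DecidableEq Λ] (w : α × β → Λ) :
    ∑ j, (newEntries w j).card ≤ (Finset.univ.image w).card := by
  have hdisj : ∀ a b, a < b → Disjoint (newEntries w a) (newEntries w b) := fun a b hab =>
    Finset.disjoint_left.2 fun l hla hlb => by
      obtain ⟨i, hi⟩ := (mem_newEntries.1 hla).1
      exact (mem_newEntries.1 hlb).2 a hab i hi
  rw [← Finset.card_biUnion fun a _ b _ hab =>
    hab.lt_or_gt.elim (hdisj a b) fun h => (hdisj b a h).symm]
  refine Finset.card_le_card (Finset.biUnion_subset.2 fun j _ l hl => ?_)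
  obtain ⟨i, hi⟩ := (mem_newEntries.1 hl).1
  exact Finset.mem_image.2 ⟨(j, i), Finset.mem_univ _, hi⟩

open Classical in
theorem card_continuations_mul_le (hD : RowBound L D) (S : Finset (α → Fin (h + 1) → Fin n))
    (hS : ∀ φ ∈ S, ∀ j, IsCircuit (φ j)) (w : α × Fin h → Λ)
    (hw : ∀ φ ∈ S, ∀ a b, w a = w b → L.familyValue φ a = L.familyValue φ b)
    (j : α) (φ₀ : α → Fin (h + 1) → Fin n) (T : Finset (Fin (h + 1) → Fin n))
    (hT : ∀ ψ ∈ T, ∃ φ ∈ S, (∀ i < j, φ i = φ₀ i) ∧ φ j = ψ) :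
    T.card * n ^ (if j ∈ closingRows w (· < ·) then 1 else 0) ≤
      n ^ (1 + (newEntries w j).card) * D ^ h := by
  have hcirc : ∀ ψ ∈ T, IsCircuit ψ := fun ψ hψ => by
    obtain ⟨φ, hφ, -, rfl⟩ := hT ψ hψ
    exact hS φ hφ j
  have hlabel : ∀ ψ ∈ T, ∀ i i', w (j, i) = w (j, i') → L.edgeValue ψ i = L.edgeValue ψ i' :=
    fun ψ hψ i i' hi => by
      obtain ⟨φ, hφ, -, rfl⟩ := hT ψ hψ
      exact hw φ hφ (j, i) (j, i') hi
  have hold : ∀ ψ ∈ T, ∀ ψ' ∈ T, ∀ i, w (j, i) ∉ newEntries w j →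
      L.edgeValue ψ i = L.edgeValue ψ' i := fun ψ hψ ψ' hψ' i hi => by
    obtain ⟨φ, hφ, hpre, rfl⟩ := hT ψ hψ
    obtain ⟨φ', hφ', hpre', rfl⟩ := hT ψ' hψ'
    obtain ⟨j', hj', i', hi'⟩ : ∃ j' < j, ∃ i', w (j', i') = w (j, i) := by
      by_contra! hne
      exact hi (mem_newEntries.2 ⟨⟨i, rfl⟩, hne⟩)
    calc L.edgeValue (φ j) i = L.edgeValue (φ j') i' := (hw φ hφ (j', i') (j, i) hi').symm
      _ = L.edgeValue (φ' j') i' := by rw [hpre j' hj', hpre' j' hj']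
      _ = L.edgeValue (φ' j) i := hw φ' hφ' (j', i') (j, i) hi'
  split_ifs with hj
  · obtain ⟨e, honce, hnew⟩ := mem_closingRows.1 hj
    have hcard := Finset.card_erase_add_one (mem_newEntries.2 ⟨⟨e, rfl⟩, hnew⟩)
    have hle := card_circuits_le_of_labels hD T hcirc (fun i => w (j, i))
      ((newEntries w j).erase (w (j, e))) e hlabel fun ψ hψ ψ' hψ' i hie hi =>
        hold ψ hψ ψ' hψ' i fun hmem => hi (Finset.mem_erase.2 ⟨honce i hie, hmem⟩)
    calc T.card * n ^ 1
        ≤ n ^ (1 + ((newEntries w j).erase (w (j, e))).card) * D ^ h * n ^ 1 :=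
          Nat.mul_le_mul_right _ hle
      _ = n ^ (1 + (newEntries w j).card) * D ^ h := by rw [← hcard]; ring
  · rw [pow_zero, mul_one]
    exact card_paths_le_of_labels hD T (fun i => w (j, i)) _ hlabel hold

theorem card_families_mul_le [DecidableEq Λ] (hD : RowBound L D)
    (S : Finset (α → Fin (h + 1) → Fin n))
    (hS : ∀ φ ∈ S, ∀ j, IsCircuit (φ j)) (w : α × Fin h → Λ)
    (hw : ∀ φ ∈ S, ∀ a b, w a = w b → L.familyValue φ a = L.familyValue φ b) :
    S.card * n ^ (closingRows w (· < ·)).card ≤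
      n ^ (Fintype.card α + (Finset.univ.image w).card) * D ^ (Fintype.card α * h) := by
  classical
  rcases n.eq_zero_or_pos with rfl | hn
  · rcases isEmpty_or_nonempty α with hα | ⟨⟨j⟩⟩
    · simpa [closingRows] using Finset.card_le_one_of_subsingleton S
    · have : IsEmpty (α → Fin (h + 1) → Fin 0) := ⟨fun φ => (φ j 0).elim0⟩
      simp [S.eq_empty_of_isEmpty]
  have hS' := card_le_prod_of_card_continuations_le S
    (fun j => n ^ (1 + (newEntries w j).card) * D ^ h /
      n ^ (if j ∈ closingRows w (· < ·) then 1 else 0)) fun j φ₀ _ T hT =>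
    (Nat.le_div_iff_mul_le (pow_pos hn _)).2 (card_continuations_mul_le hD S hS w hw j φ₀ T hT)
  have hclosing : (closingRows w (· < ·)).card =
      ∑ j, if j ∈ closingRows w (· < ·) then 1 else 0 := by
    rw [← Finset.card_filter, Finset.filter_univ_mem]
  calc S.card * n ^ (closingRows w (· < ·)).card
      ≤ ∏ j, n ^ (1 + (newEntries w j).card) * D ^ h := by
        rw [hclosing, ← Finset.prod_pow_eq_pow_sum]
        refine (Nat.mul_le_mul_right _ hS').trans ?_
        rw [← Finset.prod_mul_distrib]
        exact Finset.prod_le_prod' fun j _ => Nat.div_mul_le_self _ _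
    _ = n ^ (Fintype.card α + ∑ j, (newEntries w j).card) * D ^ (Fintype.card α * h) := by
        rw [Finset.prod_mul_distrib, Finset.prod_pow_eq_pow_sum, Finset.prod_const,
          Finset.sum_add_distrib, ← pow_mul, mul_comm h]
        simp
    _ ≤ _ := Nat.mul_le_mul_right _ (Nat.pow_le_pow_right hn
        (Nat.add_le_add_left (sum_card_newEntries_le w) _))

/-- Compare `[j ∈ J] + [j is the first row] + [j is the last row]` with `[j ∈ J] cl j + mult j`,
where only rows with `mult j ≠ 0` are considered. -/
theorem card_add_two_le_sum_mult (J : Finset α) (mult cl : α → ℕ) (hJ : ∀ j ∈ J, mult j ≠ 0)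
    (hcl : ∀ j ∈ J, mult j = 1 → (∀ i < j, mult i = 0) ∨ (∀ i > j, mult i = 0) → 1 ≤ cl j)
    {i j : α} (hij : i ≠ j) (hi : mult i ≠ 0) (hj : mult j ≠ 0) :
    J.card + 2 ≤ ∑ j ∈ J, cl j + ∑ j, mult j := by
  obtain ⟨a, ha, hamin⟩ := (Finset.univ.filter (mult · ≠ 0)).exists_minimal ⟨i, by simpa using hi⟩
  obtain ⟨b, hb, hbmax⟩ := (Finset.univ.filter (mult · ≠ 0)).exists_maximal ⟨i, by simpa using hi⟩
  simp only [Finset.mem_filter, Finset.mem_univ, true_and] at ha hb hamin hbmax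
  have hfirst : ∀ k < a, mult k = 0 := fun k hk => by
    by_contra hne
    exact hk.not_ge (hamin hne hk.le)
  have hlast : ∀ k > b, mult k = 0 := fun k hk => by
    by_contra hne
    exact hk.not_ge (hbmax hne hk.le)
  have hab : a ≠ b := by
    rintro rfl
    grind
  have hpoint : ∀ k, (if k ∈ J then 1 else 0) + ((if k = a then 1 else 0) +
      if k = b then 1 else 0) ≤ (if k ∈ J then cl k else 0) + mult k := by
    intro k
    have := hJ k
    have := hcl k
    grind
  have hsum := Finset.sum_le_sum fun k (_ : k ∈ Finset.univ) => hpoint k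
  simpa [Finset.sum_add_distrib] using hsum

/-- The part of `closing_savings` that is due to the value `l`; every row `j` is charged to its
entry at `e j`, which row `f j` contains as well. -/
theorem closing_savings_of_value [Fintype β] [DecidableEq Λ] (w : α × β → Λ) {f : α → α}
    (hf : ∀ j, f j ≠ j) {e e' : α → β} (hfe : ∀ j, w (f j, e' j) = w (j, e j)) {l : Λ}
    (hl : 2 ≤ (Finset.univ.filter fun q => w q = l).card) :
    (Finset.univ.filter fun j => w (j, e j) = l).card + 2 ≤
      ∑ j ∈ Finset.univ.filter (fun j => w (j, e j) = l),
        ((if j ∈ closingRows w (· < ·) then 1 else 0) +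
          if j ∈ closingRows w (· > ·) then 1 else 0) +
      (Finset.univ.filter fun q => w q = l).card := by
  rcases (Finset.univ.filter fun j => w (j, e j) = l).eq_empty_or_nonempty with hJ | ⟨j, hj⟩
  · simpa [hJ] using hl
  let mult : α → ℕ := fun j => (Finset.univ.filter fun i => w (j, i) = l).card
  have hmult : ∀ {j}, mult j ≠ 0 ↔ ∃ i, w (j, i) = l := by
    simp [mult, Finset.filter_eq_empty_iff]
  have hsum : (Finset.univ.filter fun q => w q = l).card = ∑ j, mult j := by
    simp only [mult, Finset.card_filter, Fintype.sum_prod_type]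
  rw [Finset.mem_filter_univ] at hj
  rw [hsum]
  refine card_add_two_le_sum_mult _ mult _ (fun k hk => ?_) (fun k hk hk1 hext => ?_)
    (hf j) (hmult.2 ⟨_, (hfe j).trans hj⟩) (hmult.2 ⟨_, hj⟩)
  · exact hmult.2 ⟨_, Finset.mem_filter_univ k |>.1 hk⟩
  · obtain rfl := Finset.mem_filter_univ k |>.1 hk
    have honce : ∀ i ≠ e k, w (k, i) ≠ w (k, e k) := fun i hi hik =>
      hi (Finset.card_le_one.1 hk1.le i (by simpa using hik) (e k) (by simp))
    have hfree : ∀ k', mult k' = 0 → ∀ i, w (k', i) ≠ w (k, e k) :=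
      fun k' hk' i hi => hmult.2 ⟨i, hi⟩ hk'
    rcases hext with hlt | hgt
    · simp [mem_closingRows.2 ⟨e k, honce, fun k' hk' => hfree k' (hlt k' hk')⟩]
    · simp [mem_closingRows.2 ⟨e k, honce, fun k' hk' => hfree k' (hgt k' hk')⟩]

/-- The savings from closing circuits, counted for both orders of the circuits, and from entries
that occur more than twice add up to at least one for each circuit. -/
theorem closing_savings [Fintype β] [DecidableEq Λ] (w : α × β → Λ) (hm : Matched w)
    (hc : CrossMatched w) :
    Fintype.card α + 2 * (Finset.univ.image w).card ≤ (closingRows w (· < ·)).card +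
      (closingRows w (· > ·)).card + Fintype.card α * Fintype.card β := by
  choose f hf e e' hfe using hc
  have hu : ∀ j ∈ Finset.univ, w (j, e j) ∈ Finset.univ.image w := fun j _ =>
    Finset.mem_image_of_mem w (Finset.mem_univ _)
  have htwo : ∀ l ∈ Finset.univ.image w, 2 ≤ (Finset.univ.filter fun q => w q = l).card :=
    Finset.forall_mem_image.2 fun q _ => hm.two_le_card_fiber q
  have hsum := Finset.sum_le_sum fun l hl => closing_savings_of_value w hf hfe (htwo l hl)
  rw [Finset.sum_add_distrib, Finset.sum_add_distrib, Finset.sum_fiberwise_of_maps_to hu,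
    ← Finset.card_eq_sum_card_fiberwise hu, ← Finset.card_eq_sum_card_image] at hsum
  simp only [Finset.sum_add_distrib, Finset.sum_const, smul_eq_mul, ← Finset.card_filter,
    Finset.filter_univ_mem, Finset.card_univ, Fintype.card_prod] at hsum
  lia

/-- Both orders of the circuits are used, since a circuit saves at one of its two ends only. -/
theorem sq_card_families_le (hD : RowBound L D) (S : Finset (α → Fin (h + 1) → Fin n))
    (hS : ∀ φ ∈ S, ∀ j, IsCircuit (φ j)) (w : α × Fin h → Λ)
    (hw : ∀ φ ∈ S, ∀ a b, w a = w b → L.familyValue φ a = L.familyValue φ b)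
    (hm : Matched w) (hc : CrossMatched w) :
    S.card ^ 2 ≤ D ^ (2 * (Fintype.card α * h)) * n ^ (Fintype.card α * (h + 1)) := by
  classical
  rcases n.eq_zero_or_pos with rfl | hn
  · rcases isEmpty_or_nonempty α with hα | ⟨⟨j⟩⟩
    · simpa using Finset.card_le_one_of_subsingleton S
    · have : IsEmpty (α → Fin (h + 1) → Fin 0) := ⟨fun φ => (φ j 0).elim0⟩
      simp [S.eq_empty_of_isEmpty]
  have hlt := card_families_mul_le hD S hS w hw
  have hgt : S.card * n ^ (closingRows w (· > ·)).card ≤ _ :=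
    card_families_mul_le (α := αᵒᵈ) hD S hS w hw
  have hsavings := closing_savings w hm hc
  rw [Fintype.card_fin] at hsavings
  set c := (closingRows w (· < ·)).card + (closingRows w (· > ·)).card with hcdef
  refine Nat.le_of_mul_le_mul_right (c := n ^ c) ?_ (pow_pos hn c)
  calc S.card ^ 2 * n ^ c = (S.card * n ^ (closingRows w (· < ·)).card) *
        (S.card * n ^ (closingRows w (· > ·)).card) := by rw [hcdef]; ring
    _ ≤ (n ^ (Fintype.card α + (Finset.univ.image w).card) * D ^ (Fintype.card α * h)) *
        (n ^ (Fintype.card α + (Finset.univ.image w).card) * D ^ (Fintype.card α * h)) :=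
      Nat.mul_le_mul hlt hgt
    _ = D ^ (2 * (Fintype.card α * h)) *
        n ^ (2 * Fintype.card α + 2 * (Finset.univ.image w).card) := by ring
    _ ≤ D ^ (2 * (Fintype.card α * h)) * n ^ (Fintype.card α * (h + 1) + c) := by
        refine Nat.mul_le_mul_left _ (Nat.pow_le_pow_right hn ?_)
        rw [mul_add, mul_one]
        lia
    _ = _ := by rw [pow_add, mul_assoc]

end Order

theorem exists_same_kernel (v : β → Λ) : ∃ w : β → β, ∀ a b, w a = w b ↔ v a = v b := by
  have hrep : ∀ a, v (Quotient.mk (Setoid.ker v) a).out = v a :=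
    Quotient.mk_out (s := Setoid.ker v)
  refine ⟨fun a => (Quotient.mk (Setoid.ker v) a).out, fun a b => ⟨fun hab => ?_, fun hab => ?_⟩⟩
  · exact (hrep a).symm.trans ((congrArg v hab).trans (hrep b))
  · simp only [Quotient.sound (s := Setoid.ker v) hab]

theorem sq_card_le_of_same_kernel {X : Type*} [Fintype β] (S : Finset X) (v : X → β → Λ) (b : ℕ)
    (hb : ∀ w : β → β, ∀ T ⊆ S, (∀ φ ∈ T, ∀ i j, w i = w j ↔ v φ i = v φ j) → T.card ^ 2 ≤ b) :
    S.card ^ 2 ≤ (Fintype.card β ^ Fintype.card β) ^ 2 * b := by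
  classical
  choose w hw using fun φ => exists_same_kernel (v φ)
  have hcard : S.card ≤ Fintype.card β ^ Fintype.card β * Nat.sqrt b := by
    rw [← Fintype.card_fun, mul_comm, ← Finset.card_univ]
    refine Finset.card_le_mul_card_image_of_maps_to (f := w) (fun φ _ => Finset.mem_univ _) _
      fun u _ => Nat.le_sqrt'.2 (hb u _ (Finset.filter_subset _ _) fun φ hφ => ?_)
    obtain ⟨-, rfl⟩ := Finset.mem_filter.1 hφ
    exact hw φ
  calc S.card ^ 2 ≤ (Fintype.card β ^ Fintype.card β * Nat.sqrt b) ^ 2 :=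
        Nat.pow_le_pow_left hcard 2
    _ = (Fintype.card β ^ Fintype.card β) ^ 2 * Nat.sqrt b ^ 2 := mul_pow _ _ _
    _ ≤ _ := Nat.mul_le_mul_left _ (Nat.sqrt_le' b)

theorem exists_sq_card_crossMatched_le [Fintype α] (hD : RowBound L D) (h : ℕ) :
    ∃ K : ℕ, ∀ (n : ℕ) (S : Finset (α → Fin (h + 1) → Fin n)),
      (∀ φ ∈ S, (∀ j, IsCircuit (φ j)) ∧ Matched (L.familyValue φ) ∧
        CrossMatched (L.familyValue φ)) →
      S.card ^ 2 ≤ K * n ^ (Fintype.card α * (h + 1)) := by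
  let : LinearOrder α := LinearOrder.lift' _ (Fintype.equivFin α).injective
  refine ⟨(Fintype.card (α × Fin h) ^ Fintype.card (α × Fin h)) ^ 2 *
    D ^ (2 * (Fintype.card α * h)), fun n S hS => ?_⟩
  rw [mul_assoc]
  refine sq_card_le_of_same_kernel S L.familyValue _ fun w T hTS hT => ?_
  rcases T.eq_empty_or_nonempty with rfl | ⟨φ, hφ⟩
  · simp
  obtain ⟨-, hm, hc⟩ := hS φ (hTS hφ)
  refine sq_card_families_le hD T (fun ψ hψ => (hS ψ (hTS hψ)).1) w
    (fun ψ hψ a b => (hT ψ hψ a b).1) (fun a => ?_) fun j => ?_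
  · obtain ⟨b, hne, hb⟩ := hm a
    exact ⟨b, hne, (hT φ hφ b a).2 hb⟩
  · obtain ⟨j', hne, i, i', hi⟩ := hc j
    exact ⟨j', hne, i, i', (hT φ hφ _ _).2 hi⟩

theorem two_mul_card_image_lt [Fintype β] [DecidableEq Λ] (v : β → Λ) (hm : Matched v)
    (hp : ¬ PairMatched v) : 2 * (Finset.univ.image v).card < Fintype.card β := by
  obtain ⟨i, hi⟩ : ∃ i, {j | v j = v i}.ncard ≠ 2 := by simpa [PairMatched] using hp
  have hmem := Finset.mem_image_of_mem v (Finset.mem_univ i)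
  have hthree : 2 < (Finset.univ.filter fun j => v j = v i).card := by
    refine (hm.two_le_card_fiber i).lt_of_ne fun heq => hi ?_
    rw [heq, ← Set.ncard_coe_finset, Finset.coe_filter_univ]
  calc 2 * (Finset.univ.image v).card = ∑ _l ∈ Finset.univ.image v, 2 := by
        rw [Finset.sum_const, smul_eq_mul, mul_comm]
    _ < ∑ l ∈ Finset.univ.image v, (Finset.univ.filter fun i => v i = l).card :=
        Finset.sum_lt_sum (Finset.forall_mem_image.2 fun j _ => hm.two_le_card_fiber j)
          ⟨v i, hmem, hthree⟩
    _ = Fintype.card β := (Finset.card_eq_sum_card_image v Finset.univ).symm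

theorem exists_sq_card_matched_le (hD : RowBound L D) (h : ℕ) :
    ∃ K : ℕ, ∀ (n : ℕ) (S : Finset (Fin (h + 1) → Fin n)),
      (∀ φ ∈ S, Matched (L.edgeValue φ) ∧ ¬ PairMatched (L.edgeValue φ)) →
      S.card ^ 2 ≤ K * n ^ (h + 1) := by
  classical
  refine ⟨(h ^ h) ^ 2 * D ^ (2 * h), fun n S hS => ?_⟩
  have hpattern := sq_card_le_of_same_kernel S (L.edgeValue (h := h)) (D ^ (2 * h) * n ^ (h + 1))
    fun w T hTS hT => ?_
  · simpa only [Fintype.card_fin, mul_assoc] using hpattern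
  rcases T.eq_empty_or_nonempty with rfl | ⟨φ, hφ⟩
  · simp
  obtain ⟨hm, hp⟩ := hS φ (hTS hφ)
  have hlt : 2 * (Finset.univ.image w).card < h := by
    simpa only [Fintype.card_fin] using two_mul_card_image_lt w
      (fun i => (hm i).imp fun j hj => ⟨hj.1, (hT φ hφ j i).2 hj.2⟩)
      fun hw => hp fun i => by simpa only [hT φ hφ] using hw i
  have hcard := card_paths_le_of_labels hD T w (Finset.univ.image w)
    (fun ψ hψ i j => (hT ψ hψ i j).1)
    fun _ _ _ _ i hi => (hi (Finset.mem_image_of_mem w (Finset.mem_univ i))).elim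
  calc T.card ^ 2 ≤ (n ^ (1 + (Finset.univ.image w).card) * D ^ h) ^ 2 :=
        Nat.pow_le_pow_left hcard 2
    _ = D ^ (2 * h) * n ^ (2 + 2 * (Finset.univ.image w).card) := by ring
    _ ≤ D ^ (2 * h) * n ^ (h + 1) :=
        Nat.mul_le_mul_left _ (Nat.pow_le_pow_right (φ 0).pos (by lia))

end Families

/-! ### Words and limit moments -/

section Words

variable {Λ : Type*} {h : ℕ}

theorem Word.le_of_forall_lt_eq {w w' : Word h} (hk : ∀ i j, w'.1 i = w'.1 j → w.1 i = w.1 j)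
    {i : Fin h} (hlt : ∀ j < i, w.1 j = w'.1 j) (hnew : ∀ j < i, w.1 j ≠ w.1 i) :
    w.1 i ≤ w'.1 i := by
  by_contra! hgt
  obtain ⟨j, hj, hj'⟩ := w.2 i (w'.1 i) hgt
  exact hnew j hj (hk j i ((hlt j hj).symm.trans hj'))

theorem Word.ext_of_eq_iff_eq {w w' : Word h} (hk : ∀ i j, w.1 i = w.1 j ↔ w'.1 i = w'.1 j) :
    w = w' := by
  refine Subtype.ext (funext fun i => ?_)
  induction i using WellFoundedLT.induction with
  | ind i ih =>
    by_cases hold : ∃ j < i, w.1 j = w.1 i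
    · obtain ⟨j, hj, hji⟩ := hold
      rw [← hji, ih j hj, (hk j i).1 hji]
    · push Not at hold
      exact le_antisymm (le_of_forall_lt_eq (fun a b => (hk a b).2) ih hold)
        (le_of_forall_lt_eq (fun a b => (hk a b).1) (fun j hj => (ih j hj).symm)
          fun j hj => mt (hk j i).2 (hold j hj))

theorem exists_word (v : Fin h → Λ) : ∃ w : Word h, ∀ i j, w.1 i = w.1 j ↔ v i = v j := by
  classical
  let F := firstOccurrences v (Finset.univ.image v)
  choose f hfle hfF hfv using fun k => exists_le_mem_firstOccurrences v
    (Finset.mem_image_of_mem v (Finset.mem_univ k))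
  have hf : ∀ {j i}, j ∈ F → v j = v i → f i = j := fun hj hji =>
    injOn_firstOccurrences v _ (hfF _) hj ((hfv _).trans hji.symm)
  let rank : F ≃o Fin F.card := (F.orderIsoOfFin rfl).symm
  have hF : F.card ≤ h := by simpa using F.card_le_univ
  refine ⟨⟨fun i => (rank ⟨f i, hfF i⟩).castLE hF, fun i c hc => ?_⟩, fun i j => ?_⟩
  · have hcF : c.val < F.card := lt_trans hc (rank ⟨f i, hfF i⟩).2
    have hlt : rank.symm ⟨c, hcF⟩ < ⟨f i, hfF i⟩ := by
      rw [← rank.lt_iff_lt, OrderIso.apply_symm_apply]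
      exact hc
    refine ⟨rank.symm ⟨c, hcF⟩, lt_of_lt_of_le hlt (hfle i), ?_⟩
    simp only [hf (rank.symm ⟨c, hcF⟩).2 rfl, Subtype.coe_eta, OrderIso.apply_symm_apply,
      Fin.castLE_mk, Fin.eta]
  · rw [Fin.castLE_inj, rank.apply_eq_iff_eq, Subtype.mk.injEq]
    exact ⟨fun hij => by rw [← hfv i, hij, hfv j], fun hij => hf (hfF j) ((hfv j).trans hij.symm)⟩

theorem Word.pairMatched_iff {w : Word h} {v : Fin h → Λ}
    (hk : ∀ i j, w.1 i = w.1 j ↔ v i = v j) : w.PairMatched ↔ SchurHadamard.PairMatched v := by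
  refine forall_congr' fun i => ?_
  rw [← Set.ncard_coe_finset, Finset.coe_filter_univ]
  simp only [hk]

theorem mem_pairMatchedWords {w : Word h} : w ∈ pairMatchedWords h ↔ w.PairMatched :=
  Finset.mem_filter_univ w

theorem Word.PairMatched.exists_partner {w : Word h} (hw : w.PairMatched) (i : Fin h) :
    ∃ j ≠ i, ∀ k, w.1 k = w.1 i ↔ k = i ∨ k = j := by
  obtain ⟨a, b, hab, hs⟩ := Finset.card_eq_two.1 (hw i)
  have hmem : ∀ k, w.1 k = w.1 i ↔ k = a ∨ k = b := by simpa [Finset.ext_iff] using hs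
  rcases (hmem i).1 rfl with rfl | rfl
  · exact ⟨b, hab.symm, hmem⟩
  · exact ⟨a, hab, fun k => (hmem k).trans or_comm⟩

theorem Word.PairMatched.exists_involution {w : Word h} (hw : w.PairMatched) :
    ∃ s : Equiv.Perm (Fin h), s ^ 2 = 1 ∧ (∀ i, s i ≠ i) ∧
      ∀ i j, w.1 j = w.1 i ↔ j = i ∨ j = s i := by
  choose f hf hfw using hw.exists_partner
  have hinv : Function.Involutive f := fun i =>
    (((hfw (f i) i).1 ((hfw i (f i)).2 (Or.inr rfl)).symm).resolve_left (hf i).symm).symm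
  exact ⟨hinv.toPerm f, Equiv.ext fun i => hinv i, hf, hfw⟩

theorem cycleType_of_sq_eq_one_of_forall_ne {α : Type*} [Fintype α] [DecidableEq α]
    {s : Equiv.Perm α} (hs : s ^ 2 = 1) (hne : ∀ i, s i ≠ i) :
    s.cycleType = Multiset.replicate (Fintype.card α / 2) 2 := by
  have hrep := Equiv.Perm.cycleType_of_pow_prime_eq_one hs
  have hsupp : s.support = Finset.univ := Finset.eq_univ_of_forall fun i => by simp [hne i]
  have hsum := s.sum_cycleType
  rw [hsupp, Finset.card_univ, hrep, Multiset.sum_replicate, smul_eq_mul] at hsum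
  rwa [← hsum, Nat.mul_div_cancel _ two_pos]

theorem card_cycleType_replicate_two (k : ℕ) :
    (Finset.univ.filter fun s : Equiv.Perm (Fin (2 * k)) =>
      s.cycleType = Multiset.replicate k 2).card * (2 ^ k * k.factorial) = (2 * k).factorial := by
  have hprod : ∏ n ∈ (Multiset.replicate k 2).toFinset,
      ((Multiset.replicate k 2).count n).factorial = k.factorial := by
    rcases Nat.eq_zero_or_pos k with rfl | hk
    · simp
    · rw [Multiset.toFinset_replicate, if_neg hk.ne', Finset.prod_singleton,
        Multiset.count_replicate_self]
  have hmul := Equiv.Perm.card_of_cycleType_mul_eq (Fin (2 * k)) (Multiset.replicate k 2)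
  rwa [hprod, Multiset.sum_replicate, Multiset.prod_replicate, Fintype.card_fin, smul_eq_mul,
    mul_comm k 2, Nat.sub_self, Nat.factorial_zero, one_mul, if_pos
      ⟨le_rfl, fun a ha => (Multiset.eq_of_mem_replicate ha).ge⟩] at hmul

theorem card_pairMatchedWords_mul_le (k : ℕ) :
    (pairMatchedWords (2 * k)).card * (2 ^ k * k.factorial) ≤ (2 * k).factorial := by
  rw [← card_cycleType_replicate_two]
  refine Nat.mul_le_mul_right _ (Finset.card_le_card_of_forall_subsingleton
    (fun w s => ∀ i j, w.1 j = w.1 i ↔ j = i ∨ j = s i) (fun w hw => ?_) fun s _ w hw w' hw' => ?_)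
  · obtain ⟨s, hsq, hne, hs⟩ := (mem_pairMatchedWords.1 hw).exists_involution
    refine ⟨s, Finset.mem_filter.2 ⟨Finset.mem_univ s, ?_⟩, hs⟩
    rw [cycleType_of_sq_eq_one_of_forall_ne hsq hne, Fintype.card_fin,
      Nat.mul_div_cancel_left _ two_pos]
  · exact Word.ext_of_eq_iff_eq fun i j => (hw.2 j i).trans (hw'.2 j i).symm

theorem Word.PairMatched.two_mul_card_firstOccurrences {w : Word h} (hw : w.PairMatched) :
    2 * (firstOccurrences w.1 (Finset.univ.image w.1)).card = h := by
  have himage : (firstOccurrences w.1 (Finset.univ.image w.1)).image w.1 =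
      Finset.univ.image w.1 := by
    refine (Finset.image_subset_image (Finset.subset_univ _)).antisymm fun l hl => ?_
    obtain ⟨i, -, rfl⟩ := Finset.mem_image.1 hl
    obtain ⟨j, -, hj, hji⟩ := exists_le_mem_firstOccurrences w.1 hl
    exact Finset.mem_image.2 ⟨j, hj, hji⟩
  have htwo : ∀ l ∈ Finset.univ.image w.1, (Finset.univ.filter fun i => w.1 i = l).card = 2 :=
    Finset.forall_mem_image.2 fun i _ => hw i
  have hcard := Finset.card_eq_sum_card_image w.1 Finset.univ
  rw [Finset.sum_congr rfl htwo, Finset.card_univ,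
    Fintype.card_fin, Finset.sum_const, smul_eq_mul, ← himage,
    Finset.card_image_of_injOn (injOn_firstOccurrences _ _)] at hcard
  rw [mul_comm, ← hcard]

end Words

section LimitMoment

variable {ι κ : Type*} {LX : Link ι} {LY : Link κ} {p : (h : ℕ) → Word h → Word h → ℝ}

theorem ncard_circuits_le {D n k : ℕ} (hD : RowBound LX D) {w : Word (2 * k)}
    (hw : w.PairMatched) : (circuits LX n w).ncard ≤ n ^ (1 + k) * D ^ k := by
  classical
  have hcard := card_paths_le_of_firstOccurrences hD (circuits LX n w).toFinset w.1
    (Finset.univ.image w.1) (fun φ hφ i j => ((Set.mem_toFinset.1 hφ).2 i j).1)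
    fun _ _ _ _ i hi => (hi (Finset.mem_image_of_mem _ (Finset.mem_univ i))).elim
  have hfirst := hw.two_mul_card_firstOccurrences
  have hbounded : 2 * k - k = k := by lia
  rwa [← Set.ncard_eq_toFinset_card', (by lia : (firstOccurrences _ _).card = k), hbounded]
    at hcard

variable (LX LY) in
/-- The circuits that are pair-matched for both links; they make up the limit moments. -/
def pairMatchedCircuits (h n : ℕ) : Set (Fin (h + 1) → Fin n) :=
  {φ | IsCircuit φ ∧ PairMatched (LX.edgeValue φ) ∧ PairMatched (LY.edgeValue φ)}

theorem pairMatchedCircuits_comm (h n : ℕ) :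
    pairMatchedCircuits LX LY h n = pairMatchedCircuits LY LX h n :=
  Set.ext fun _ => and_congr_right fun _ => and_comm

theorem sum_ncard_jointCircuits (LX : Link ι) (LY : Link κ) (h n : ℕ) :
    ∑ w ∈ pairMatchedWords h, ∑ w' ∈ pairMatchedWords h, (jointCircuits LX LY n w w').ncard =
      (pairMatchedCircuits LX LY h n).ncard := by
  classical
  rw [← Finset.sum_product', Set.ncard_eq_toFinset_card']
  simp only [Set.ncard_eq_toFinset_card']
  rw [← Finset.card_biUnion]
  · congr 1
    ext φ
    simp only [Finset.mem_biUnion, Finset.mem_product, mem_pairMatchedWords, Set.mem_toFinset]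
    constructor
    · rintro ⟨⟨w, w'⟩, ⟨hw, hw'⟩, hφ, hφ'⟩
      exact ⟨hφ.1, (Word.pairMatched_iff hφ.2).1 hw, (Word.pairMatched_iff hφ'.2).1 hw'⟩
    · rintro ⟨hc, hX, hY⟩
      obtain ⟨w, hw⟩ := exists_word (LX.edgeValue φ)
      obtain ⟨w', hw'⟩ := exists_word (LY.edgeValue φ)
      exact ⟨(w, w'), ⟨(Word.pairMatched_iff hw).2 hX, (Word.pairMatched_iff hw').2 hY⟩,
        ⟨hc, hw⟩, hc, hw'⟩
  · rintro ⟨a, a'⟩ _ ⟨b, b'⟩ _ hne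
    refine Finset.disjoint_left.2 fun φ ha hb => hne ?_
    rw [Set.mem_toFinset] at ha hb
    exact Prod.ext (Word.ext_of_eq_iff_eq fun i j => (ha.1.2 i j).trans (hb.1.2 i j).symm)
      (Word.ext_of_eq_iff_eq fun i j => (ha.2.2 i j).trans (hb.2.2 i j).symm)

theorem IsWordLimit.tendsto_ncard (hp : IsWordLimit LX LY p) (k : ℕ) :
    Tendsto (fun n : ℕ => ((pairMatchedCircuits LX LY (2 * k) n).ncard : ℝ) / (n : ℝ) ^ (1 + k))
      atTop (𝓝 (limitMoment p (2 * k))) := by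
  rw [limitMoment, if_neg (Nat.not_odd_iff_even.2 (even_two_mul k))]
  simp only [← sum_ncard_jointCircuits, Nat.cast_sum, Finset.sum_div]
  exact tendsto_finsetSum _ fun w hw => tendsto_finsetSum _ fun w' hw' =>
    hp k w w' (mem_pairMatchedWords.1 hw) (mem_pairMatchedWords.1 hw')

theorem ncard_pairMatchedCircuits_le {D : ℕ} (LY : Link κ) (hD : RowBound LX D) (k n : ℕ) :
    (pairMatchedCircuits LX LY (2 * k) n).ncard ≤
      (pairMatchedWords (2 * k)).card * (n ^ (1 + k) * D ^ k) := by
  classical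
  have hsub : pairMatchedCircuits LX LY (2 * k) n ⊆
      ⋃ w ∈ pairMatchedWords (2 * k), circuits LX n w := by
    rintro φ ⟨hc, hX, -⟩
    obtain ⟨w, hw⟩ := exists_word (LX.edgeValue φ)
    exact Set.mem_biUnion (mem_pairMatchedWords.2 ((Word.pairMatched_iff hw).2 hX)) ⟨hc, hw⟩
  calc (pairMatchedCircuits LX LY (2 * k) n).ncard
      ≤ (⋃ w ∈ pairMatchedWords (2 * k), circuits LX n w).ncard :=
        Set.ncard_le_ncard hsub (Set.toFinite _)
    _ ≤ ∑ w ∈ pairMatchedWords (2 * k), (circuits LX n w).ncard :=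
        Finset.set_ncard_biUnion_le _ _
    _ ≤ (pairMatchedWords (2 * k)).card * (n ^ (1 + k) * D ^ k) :=
        Finset.sum_le_card_nsmul _ _ _ fun w hw =>
          ncard_circuits_le hD (mem_pairMatchedWords.1 hw)

theorem IsWordLimit.limitMoment_le (hp : IsWordLimit LX LY p) {D : ℕ}
    (hD : RowBound LX D ∨ RowBound LY D) (k : ℕ) :
    limitMoment p (2 * k) ≤
      ((2 * k).factorial : ℝ) / (2 ^ k * (k.factorial : ℝ)) * (D : ℝ) ^ k := by
  refine le_of_tendsto (hp.tendsto_ncard k) ?_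
  filter_upwards [eventually_gt_atTop 0] with n hn
  have hcount : ((pairMatchedCircuits LX LY (2 * k) n).ncard : ℝ) ≤
      (pairMatchedWords (2 * k)).card * ((n : ℝ) ^ (1 + k) * (D : ℝ) ^ k) := by
    rcases hD with hD | hD
    · exact_mod_cast ncard_pairMatchedCircuits_le LY hD k n
    · rw [pairMatchedCircuits_comm]
      exact_mod_cast ncard_pairMatchedCircuits_le LX hD k n
  have hwords : ((pairMatchedWords (2 * k)).card : ℝ) ≤
      ((2 * k).factorial : ℝ) / (2 ^ k * (k.factorial : ℝ)) := by
    rw [le_div_iff₀ (by positivity)]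
    exact_mod_cast card_pairMatchedWords_mul_le k
  rw [div_le_iff₀ (by positivity)]
  calc ((pairMatchedCircuits LX LY (2 * k) n).ncard : ℝ) ≤ _ := hcount
    _ ≤ ((2 * k).factorial : ℝ) / (2 ^ k * (k.factorial : ℝ)) *
        ((n : ℝ) ^ (1 + k) * (D : ℝ) ^ k) := by gcongr
    _ = _ := by ring

theorem rowBound_toNat_min_Delta (hX : LX.PropertyB) (hY : LY.PropertyB) :
    RowBound LX (min LX.Delta LY.Delta).toNat ∨ RowBound LY (min LX.Delta LY.Delta).toNat := by
  rcases min_choice LX.Delta LY.Delta with h | h <;> rw [h]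
  exacts [Or.inl hX.rowBound, Or.inr hY.rowBound]

theorem pairMatched_of_zero_eq_one {Λ : Type*} {v : Fin 2 → Λ} (hv : v 0 = v 1) :
    PairMatched v := by
  have hconst : ∀ i, v i = v 0 := Fin.forall_fin_two.2 ⟨rfl, hv.symm⟩
  intro i
  simp [hconst, Set.ncard_univ]

theorem Link.IsSymm.pairMatched_edgeValue (hL : LX.IsSymm) {n : ℕ} {φ : Fin 3 → Fin n}
    (hφ : IsCircuit φ) : PairMatched (LX.edgeValue φ) :=
  pairMatched_of_zero_eq_one ((hL n _ _).trans (congrArg (LX n (φ 1)) hφ))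

theorem ncard_pairMatchedCircuits_two (hX : LX.IsSymm) (hY : LY.IsSymm) (n : ℕ) :
    (pairMatchedCircuits LX LY 2 n).ncard = n ^ 2 := by
  have himage : (fun q : Fin n × Fin n => (![q.1, q.2, q.1] : Fin 3 → Fin n)) '' Set.univ =
      pairMatchedCircuits LX LY 2 n := by
    refine Set.Subset.antisymm ?_ fun φ hφ => ⟨(φ 0, φ 1), trivial, ?_⟩
    · rintro _ ⟨q, -, rfl⟩
      exact ⟨rfl, hX.pairMatched_edgeValue rfl, hY.pairMatched_edgeValue rfl⟩
    · ext i
      fin_cases i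
      exacts [rfl, rfl, congrArg Fin.val hφ.1]
  rw [← himage, Set.ncard_image_of_injective _ fun q q' hq =>
    Prod.ext (congrFun hq 0) (congrFun hq 1)]
  simp [Set.ncard_univ, pow_two]

theorem IsWordLimit.limitMoment_two (hp : IsWordLimit LX LY p) (hX : LX.IsSymm) (hY : LY.IsSymm) :
    limitMoment p 2 = 1 := by
  refine tendsto_nhds_unique (hp.tendsto_ncard 1) (tendsto_const_nhds.congr' ?_)
  filter_upwards [eventually_ne_atTop 0] with n hn
  rw [ncard_pairMatchedCircuits_two hX hY, Nat.cast_pow, div_self (by positivity)]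

end LimitMoment

/-! ### Uniformly bounded moments -/

section UniformMoments

open scoped ENNReal

variable {Ω A B : Type*} [MeasurableSpace Ω] {P : Measure Ω} {f g : A → Ω → ℝ}

/-- The family `f` is bounded in `Lᵖ` for every finite `p`. -/
structure UniformMoments (P : Measure Ω) (f : A → Ω → ℝ) : Prop where
  aestronglyMeasurable (a : A) : AEStronglyMeasurable (f a) P
  exists_eLpNorm_le (p : ℝ≥0∞) (hp : p ≠ ∞) : ∃ C ≠ ∞, ∀ a, eLpNorm (f a) p P ≤ C

namespace UniformMoments

theorem comp (hf : UniformMoments P f) (u : B → A) : UniformMoments P fun b => f (u b) :=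
  ⟨fun b => hf.1 (u b), fun p hp =>
    let ⟨C, hC, hfC⟩ := hf.2 p hp
    ⟨C, hC, fun b => hfC (u b)⟩⟩

theorem of_bound [IsFiniteMeasure P] (hf : ∀ a, AEStronglyMeasurable (f a) P) {C : ℝ}
    (hC : ∀ a, ∀ᵐ ω ∂P, |f a ω| ≤ C) : UniformMoments P f :=
  ⟨hf, fun p _ => ⟨_, ENNReal.mul_ne_top (ENNReal.rpow_ne_top_of_nonneg
    (inv_nonneg.2 p.toReal_nonneg) (measure_ne_top _ _)) ENNReal.ofReal_ne_top,
    fun a => eLpNorm_le_of_ae_bound (hC a)⟩⟩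

theorem add (hf : UniformMoments P f) (hg : UniformMoments P g) :
    UniformMoments P fun a => f a + g a := by
  refine ⟨fun a => (hf.1 a).add (hg.1 a), fun p hp => ?_⟩
  obtain ⟨C, hC, hfC⟩ := hf.2 p hp
  obtain ⟨C', hC', hgC⟩ := hg.2 p hp
  exact ⟨ENNReal.LpAddConst p * (C + C'),
    ENNReal.mul_ne_top (ENNReal.LpAddConst_lt_top p).ne (ENNReal.add_ne_top.2 ⟨hC, hC'⟩), fun a =>
      (eLpNorm_add_le' (hf.1 a) (hg.1 a) p).trans (by gcongr; exacts [hfC a, hgC a])⟩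

theorem mul (hf : UniformMoments P f) (hg : UniformMoments P g) :
    UniformMoments P fun a => f a * g a := by
  refine ⟨fun a => (hf.1 a).mul (hg.1 a), fun p hp => ?_⟩
  have hp2 : 2 * p ≠ ∞ := ENNReal.mul_ne_top ENNReal.ofNat_ne_top hp
  have : ENNReal.HolderTriple (2 * p) (2 * p) p := ⟨by
    rw [ENNReal.mul_inv (.inl two_ne_zero) (.inl ENNReal.ofNat_ne_top), ← add_mul,
      ENNReal.inv_two_add_inv_two, one_mul]⟩
  obtain ⟨C, hC, hfC⟩ := hf.2 _ hp2
  obtain ⟨C', hC', hgC⟩ := hg.2 _ hp2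
  exact ⟨C * C', ENNReal.mul_ne_top hC hC', fun a =>
    (eLpNorm_smul_le_mul_eLpNorm (hg.1 a) (hf.1 a)).trans (mul_le_mul' (hfC a) (hgC a))⟩

theorem prod [IsFiniteMeasure P] {α : Type*} (hf : UniformMoments P f) (s : Finset α) :
    UniformMoments P fun (v : α → A) ω => ∏ i ∈ s, f (v i) ω := by
  classical
  induction s using Finset.induction_on with
  | empty =>
    simp only [Finset.prod_empty]
    exact of_bound (C := 1) (fun _ => aestronglyMeasurable_const) fun _ => by simp
  | insert i s hi ih =>
    simp only [Finset.prod_insert hi]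
    exact (hf.comp fun v : α → A => v i).mul ih

theorem memLp (hf : UniformMoments P f) (a : A) {p : ℝ≥0∞} (hp : p ≠ ∞) : MemLp (f a) p P :=
  let ⟨_, hC, hfC⟩ := hf.2 p hp
  ⟨hf.1 a, (hfC a).trans_lt hC.lt_top⟩

theorem integrable (hf : UniformMoments P f) (a : A) : Integrable (f a) P :=
  memLp_one_iff_integrable.1 (hf.memLp a ENNReal.one_ne_top)

theorem exists_abs_integral_le (hf : UniformMoments P f) :
    ∃ K : ℝ, 0 ≤ K ∧ ∀ a, |∫ ω, f a ω ∂P| ≤ K := by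
  obtain ⟨C, hC, hfC⟩ := hf.2 1 ENNReal.one_ne_top
  refine ⟨C.toReal, C.toReal_nonneg, fun a => ?_⟩
  have h := (enorm_integral_le_lintegral_enorm (f a)).trans
    (eLpNorm_one_eq_lintegral_enorm.symm.trans_le (hfC a))
  rw [Real.enorm_eq_ofReal_abs] at h
  exact ENNReal.ofReal_le_iff_le_toReal hC |>.1 h

theorem sub_integral [IsFiniteMeasure P] (hf : UniformMoments P f) :
    UniformMoments P fun a ω => f a ω - ∫ ω', f a ω' ∂P := by
  obtain ⟨K, -, hK⟩ := hf.exists_abs_integral_le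
  simp only [sub_eq_add_neg]
  exact hf.add (of_bound (fun _ => by fun_prop) fun a => ae_of_all _ fun _ =>
    (abs_neg _).trans_le (hK a))

end UniformMoments

theorem InputA3.uniformMoments [IsProbabilityMeasure P] {x : A → Ω → ℝ} (hx : InputA3 P x) :
    UniformMoments P x := by
  have hmeas := fun a => (hx.1.measurable a).aestronglyMeasurable (μ := P)
  refine ⟨hmeas, fun p hp => ?_⟩
  obtain ⟨m, hm⟩ := ENNReal.exists_nat_gt hp
  have hm0 : (m : ℝ≥0∞) ≠ 0 := (zero_le.trans_lt hm).ne'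
  obtain ⟨C, hC⟩ := hx.2 m
  refine ⟨ENNReal.ofReal (C ^ (m : ℝ)⁻¹), ENNReal.ofReal_ne_top, fun a => ?_⟩
  have hmem : MemLp (x a) m P := by
    rw [← integrable_norm_rpow_iff (hmeas a) hm0 (ENNReal.natCast_ne_top m)]
    simpa using (hC a).1
  refine (eLpNorm_le_eLpNorm_of_exponent_le hm.le (hmeas a)).trans ?_
  rw [hmem.eLpNorm_eq_integral_rpow_norm hm0 (ENNReal.natCast_ne_top m)]
  simp only [ENNReal.toReal_natCast, Real.rpow_natCast, Real.norm_eq_abs]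
  gcongr
  exact (hC a).2

theorem InputA1.inputA3 [IsProbabilityMeasure P] {x : A → Ω → ℝ} (hx : InputA1 P x) :
    InputA3 P x := by
  obtain ⟨hs, C, hC⟩ := hx
  refine ⟨hs, fun m => ⟨C ^ m, fun a => ?_⟩⟩
  have hle : ∀ᵐ ω ∂P, |x a ω| ^ m ≤ C ^ m := by
    filter_upwards [hC a] with ω hω using pow_le_pow_left₀ (abs_nonneg _) hω m
  have hint : Integrable (fun ω => |x a ω| ^ m) P :=
    Integrable.of_bound ((hs.measurable a).abs.pow_const m).aestronglyMeasurable (C ^ m)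
      (by filter_upwards [hle] with ω hω using by simpa using hω)
  exact ⟨hint, by simpa using integral_mono_ae hint (integrable_const _) hle⟩

end UniformMoments

/-! ### Products of independent variables -/

section Independence

variable {Ω ι κ α β : Type*} [MeasurableSpace Ω] {P : Measure Ω} {x : ι → Ω → ℝ}

/-- The σ-algebra generated by the variables with index in `S`. -/
abbrev sigmaOf {Ω : Type*} (x : ι → Ω → ℝ) (S : Set ι) : MeasurableSpace Ω :=
  ⨆ i ∈ S, MeasurableSpace.comap (x i) inferInstance

theorem measurable_sigmaOf {Ω : Type*} {x : ι → Ω → ℝ} {S : Set ι} {i : ι} (hi : i ∈ S) :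
    Measurable[sigmaOf x S] (x i) :=
  (comap_measurable (x i)).mono
    (le_iSup₂_of_le (f := fun i (_ : i ∈ S) => MeasurableSpace.comap (x i) inferInstance)
      i hi le_rfl) le_rfl

theorem measurable_sigmaOf_prod {Ω : Type*} {x : ι → Ω → ℝ} {S : Set ι} {v : β → ι}
    (s : Finset β) (hv : ∀ i ∈ s, v i ∈ S) :
    Measurable[sigmaOf x S] fun ω => ∏ i ∈ s, x (v i) ω :=
  @Finset.measurable_fun_prod _ _ _ _ _ _ (sigmaOf x S) _ s fun i hi =>
    measurable_sigmaOf (hv i hi)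

theorem integral_mul_of_disjoint (hx : ∀ i, Measurable (x i)) (hi : iIndepFun x P)
    {S T : Set ι} (hST : Disjoint S T) {F G : Ω → ℝ} (hF : Measurable[sigmaOf x S] F)
    (hG : Measurable[sigmaOf x T] G) :
    ∫ ω, F ω * G ω ∂P = (∫ ω, F ω ∂P) * ∫ ω, G ω ∂P := by
  have hle : ∀ i, MeasurableSpace.comap (x i) inferInstance ≤ ‹MeasurableSpace Ω› :=
    fun i => (hx i).comap_le
  have hsub (S : Set ι) : sigmaOf x S ≤ ‹MeasurableSpace Ω› := iSup₂_le fun i _ => hle i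
  have hind : Indep (sigmaOf x S) (sigmaOf x T) P := indep_iSup_of_disjoint hle hi.iIndep hST
  have hFG : IndepFun F G P := by
    rw [IndepFun_iff_Indep]
    exact indep_of_indep_of_le_left (indep_of_indep_of_le_right hind hG.comap_le) hF.comap_le
  exact hFG.integral_fun_mul_eq_mul_integral
    (hF.mono (hsub S) le_rfl).aestronglyMeasurable (hG.mono (hsub T) le_rfl).aestronglyMeasurable

theorem StandardInput.integral_mul_eq_zero (hx : StandardInput P x) (i : ι) {F : Ω → ℝ}
    (hF : Measurable[sigmaOf x {i}ᶜ] F) : ∫ ω, x i ω * F ω ∂P = 0 := by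
  rw [integral_mul_of_disjoint hx.measurable hx.indep (S := {i}) (T := {i}ᶜ) disjoint_compl_right
    (measurable_sigmaOf (Set.mem_singleton i)) hF, hx.mean_zero, zero_mul]

theorem StandardInput.integral_sq [IsProbabilityMeasure P] (hx : StandardInput P x) (i : ι) :
    ∫ ω, x i ω ^ 2 ∂P = 1 := by
  rw [← hx.variance_one i, variance_of_integral_eq_zero (hx.measurable i).aemeasurable
    (hx.mean_zero i)]

variable [Fintype β]

/-- The product of the variables with indices `v i`, `i : β`. -/
def prodVar (x : ι → Ω → ℝ) (v : β → ι) (ω : Ω) : ℝ := ∏ i, x (v i) ω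

theorem StandardInput.integral_prodVar_eq_zero (hx : StandardInput P x) {v : β → ι}
    (hv : ¬ Matched v) : ∫ ω, prodVar x v ω ∂P = 0 := by
  classical
  simp only [Matched, not_forall, not_exists, not_and] at hv
  obtain ⟨i, hi⟩ := hv
  simp only [prodVar, ← Finset.mul_prod_erase _ _ (Finset.mem_univ i)]
  exact hx.integral_mul_eq_zero _
    (measurable_sigmaOf_prod _ fun j hj => hi j (Finset.ne_of_mem_erase hj))

theorem StandardInput.integral_prodVar_eq_one [IsProbabilityMeasure P] (hx : StandardInput P x)
    {v : β → ι} (hv : PairMatched v) : ∫ ω, prodVar x v ω ∂P = 1 := by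
  classical
  have hsq : ∀ ω, prodVar x v ω = ∏ u : Finset.univ.image v, x u ω ^ 2 := by
    intro ω
    rw [prodVar, Finset.prod_comp (fun u => x u ω) v, ← Finset.prod_coe_sort]
    refine Finset.prod_congr rfl fun u _ => ?_
    obtain ⟨i, -, hi⟩ := Finset.mem_image.1 u.2
    rw [← hv i, ← Set.ncard_coe_finset, Finset.coe_filter_univ, ← hi]
  have hind : iIndepFun (fun (u : Finset.univ.image v) ω => x u ω ^ 2) P :=
    (hx.indep.precomp (g := ((↑) : Finset.univ.image v → ι)) Subtype.val_injective).comp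
      (fun _ t => t ^ 2) fun _ => by fun_prop
  simp only [hsq]
  rw [hind.integral_fun_prod_eq_prod_integral fun u =>
    ((hx.measurable u).pow_const 2).aestronglyMeasurable]
  exact Finset.prod_eq_one fun u _ => hx.integral_sq u

section Centered

variable (P x) in
/-- The centered product of the variables with indices `v i`, `i : β`. -/
noncomputable def centeredProd (v : β → ι) (ω : Ω) : ℝ :=
  prodVar x v ω - ∫ ω', prodVar x v ω' ∂P

theorem measurable_sigmaOf_prod_centeredProd {S : Set ι} {v : α × β → ι} (s : Finset α)
    (hv : ∀ j ∈ s, ∀ i, v (j, i) ∈ S) :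
    Measurable[sigmaOf x S] fun ω => ∏ j ∈ s, centeredProd P x (fun i => v (j, i)) ω :=
  @Finset.measurable_fun_prod _ _ _ _ _ _ (sigmaOf x S) _ s fun j hj =>
    (measurable_sigmaOf_prod _ fun i _ => hv j hj i).sub_const _

variable [Fintype α] {v : α × β → ι}

theorem StandardInput.integral_prod_centeredProd_of_not_matched (hx : StandardInput P x)
    (hv : ¬ Matched v) : ∫ ω, ∏ j, centeredProd P x (fun i => v (j, i)) ω ∂P = 0 := by
  classical
  simp only [Matched, not_forall, not_exists, not_and, Prod.forall] at hv
  obtain ⟨j, i, hji⟩ := hv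
  have hrow : ∀ i' ≠ i, v (j, i') ≠ v (j, i) := fun i' hi' =>
    hji j i' fun h => hi' (Prod.mk.inj h).2
  have hzero : ∫ ω, prodVar x (fun i => v (j, i)) ω ∂P = 0 :=
    hx.integral_prodVar_eq_zero fun hm => let ⟨i', hi', h⟩ := hm i; hrow i' hi' h
  have hcentered (ω : Ω) : centeredProd P x (fun i => v (j, i)) ω =
      x (v (j, i)) ω * ∏ i' ∈ Finset.univ.erase i, x (v (j, i')) ω := by
    rw [centeredProd, hzero, sub_zero, prodVar,
      Finset.mul_prod_erase _ (fun i => x (v (j, i)) ω) (Finset.mem_univ i)]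
  simp only [← Finset.mul_prod_erase _ _ (Finset.mem_univ j), hcentered, mul_assoc]
  refine hx.integral_mul_eq_zero _ (Measurable.mul (m := sigmaOf x _)
    (measurable_sigmaOf_prod _ fun i' hi' => hrow i' (Finset.ne_of_mem_erase hi'))
    (measurable_sigmaOf_prod_centeredProd _ fun j' hj' i' => hji j' i' fun h => ?_))
  exact Finset.ne_of_mem_erase hj' (congrArg Prod.fst h)

theorem StandardInput.integral_prod_centeredProd_of_not_crossMatched [IsProbabilityMeasure P]
    (hx : StandardInput P x) (hint : ∀ j, Integrable (prodVar x fun i => v (j, i)) P)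
    (hv : ¬ CrossMatched v) : ∫ ω, ∏ j, centeredProd P x (fun i => v (j, i)) ω ∂P = 0 := by
  classical
  simp only [CrossMatched, not_forall, not_exists, not_and] at hv
  obtain ⟨j, hj⟩ := hv
  have hzero : ∫ ω, centeredProd P x (fun i => v (j, i)) ω ∂P = 0 := by
    simp only [centeredProd]
    rw [integral_sub (hint j) (integrable_const _), integral_const, probReal_univ, one_smul,
      sub_self]
  have hrow : ∀ j' ∈ Finset.univ.erase j, ∀ i', v (j', i') ∈ (Set.range fun i => v (j, i))ᶜ := by
    rintro j' hj' i' ⟨i, hi⟩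
    exact hj j' (Finset.ne_of_mem_erase hj') i i' hi.symm
  have hmeas : Measurable[sigmaOf x (Set.range fun i => v (j, i))]
      (centeredProd P x fun i => v (j, i)) :=
    (measurable_sigmaOf_prod _ fun i _ => Set.mem_range_self i).sub_const _
  simp only [← Finset.mul_prod_erase _ _ (Finset.mem_univ j)]
  rw [integral_mul_of_disjoint hx.measurable hx.indep disjoint_compl_right hmeas
    (measurable_sigmaOf_prod_centeredProd _ hrow), hzero, zero_mul]

end Centered

end Independence

/-! ### Empirical spectral distributions of symmetric matrices -/

section Paths

variable {m : Type*} [Fintype m] [DecidableEq m] {R : Type*} [CommSemiring R]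

theorem matrix_pow_apply_eq_sum_paths (A : Matrix m m R) (h : ℕ) (i j : m) :
    (A ^ h) i j = ∑ φ : Fin (h + 1) → m with φ 0 = i ∧ φ (Fin.last h) = j,
      ∏ k : Fin h, A (φ k.castSucc) (φ k.succ) := by
  simp only [Finset.sum_filter]
  induction h generalizing i with
  | zero =>
    rw [pow_zero, ← (Equiv.funUnique (Fin 1) m).symm.sum_comp, Finset.sum_eq_single i]
    · simp [Matrix.one_apply]
    · exact fun a _ ha => if_neg fun h' => ha h'.1
    · simp
  | succ h ih =>
    rw [pow_succ', Matrix.mul_apply, ← (Fin.consEquiv fun _ : Fin (h + 2) => m).sum_comp,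
      Fintype.sum_prod_type, Finset.sum_comm]
    simp only [ih, Finset.mul_sum]
    rw [Finset.sum_comm]
    refine Finset.sum_congr rfl fun φ _ => ?_
    rw [Finset.sum_eq_single (φ 0), Finset.sum_eq_single i]
    · simp only [Fin.consEquiv, Equiv.coe_fn_mk, Fin.cons_zero, true_and, ← Fin.succ_last,
        Fin.cons_succ, Fin.prod_univ_succ, Fin.castSucc_zero, Fin.castSucc_succ, mul_ite, mul_zero]
    · exact fun a _ ha => if_neg fun h' => ha h'.1
    · simp
    · exact fun k _ hk => by rw [if_neg fun h' => hk h'.1.symm, mul_zero]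
    · simp

instance {h n : ℕ} : DecidablePred (IsCircuit (h := h) (n := n)) := fun _ =>
  inferInstanceAs (Decidable (_ = _))

theorem matrix_trace_pow_eq_sum_circuits {n : ℕ} (A : Matrix (Fin n) (Fin n) R) (h : ℕ) :
    (A ^ h).trace = ∑ φ : Fin (h + 1) → Fin n with IsCircuit φ,
      ∏ k : Fin h, A (φ k.castSucc) (φ k.succ) := by
  simp only [Matrix.trace, Matrix.diag_apply, matrix_pow_apply_eq_sum_paths, Finset.sum_filter]
  rw [Finset.sum_comm]
  refine Finset.sum_congr rfl fun φ _ => ?_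
  rw [Finset.sum_eq_single (φ 0)]
  · simp only [true_and, IsCircuit, eq_comm]
  · exact fun k _ hk => if_neg fun h' => hk h'.1.symm
  · simp

end Paths

section Spectral

theorem sum_sq_eq_trace {m : Type*} [Fintype m] (M : Matrix m m ℝ) :
    ∑ i, ∑ j, M i j ^ 2 = (M * star M).trace := by
  simp [Matrix.trace, Matrix.mul_apply, pow_two]

variable {m : Type*} [Fintype m] [DecidableEq m] {A B : Matrix m m ℝ}

theorem trace_pow_eq_sum_eigenvalues (hA : A.IsHermitian) (h : ℕ) :
    (A ^ h).trace = ∑ i, hA.eigenvalues i ^ h := by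
  conv_lhs => rw [hA.spectral_theorem, ← map_pow, Matrix.diagonal_pow,
    Unitary.conjStarAlgAut_apply, Matrix.trace_mul_comm, ← mul_assoc,
    Unitary.coe_star_mul_self, one_mul, Matrix.trace_diagonal]
  simp

theorem sum_sq_star_mul_mul (U V : Matrix.unitaryGroup m ℝ) (M : Matrix m m ℝ) :
    ∑ i, ∑ j, (star (U : Matrix m m ℝ) * M * V) i j ^ 2 = ∑ i, ∑ j, M i j ^ 2 := by
  rw [sum_sq_eq_trace, sum_sq_eq_trace]
  calc (star (U : Matrix m m ℝ) * M * V * star (star (U : Matrix m m ℝ) * M * V)).trace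
      = (star (U : Matrix m m ℝ) * (M * (V * star (V : Matrix m m ℝ)) * star M * U)).trace := by
        simp only [star_mul, star_star, mul_assoc]
    _ = (M * star M).trace := by
        rw [Matrix.trace_mul_comm, Unitary.mul_star_self_of_mem V.2, mul_one, mul_assoc,
          Unitary.mul_star_self_of_mem U.2, mul_one]

theorem sq_mem_doublyStochastic (Q : Matrix.unitaryGroup m ℝ) :
    (Matrix.of fun k l => (Q : Matrix m m ℝ) k l ^ 2) ∈ doublyStochastic ℝ m := by
  refine mem_doublyStochastic_iff_sum.2 ⟨fun k l => sq_nonneg _, fun k => ?_, fun l => ?_⟩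
  · simpa [Matrix.mul_apply, pow_two] using
      congrFun (congrFun (Unitary.coe_mul_star_self Q) k) k
  · simpa [Matrix.mul_apply, pow_two] using
      congrFun (congrFun (Unitary.coe_star_mul_self Q) l) l

theorem exists_doublyStochastic_sum_eq_sum_sq_sub (hA : A.IsHermitian) (hB : B.IsHermitian) :
    ∃ W ∈ doublyStochastic ℝ m, ∑ k, ∑ l, W k l * (hA.eigenvalues k - hB.eigenvalues l) ^ 2 =
      ∑ i, ∑ j, (A i j - B i j) ^ 2 := by
  set U := hA.eigenvectorUnitary
  set V := hB.eigenvectorUnitary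
  have hconj : star (U : Matrix m m ℝ) * (A - B) * V =
      Matrix.diagonal hA.eigenvalues * (star U * V : Matrix.unitaryGroup m ℝ) -
        (star U * V : Matrix.unitaryGroup m ℝ) * Matrix.diagonal hB.eigenvalues := by
    have hUA : star (U : Matrix m m ℝ) * A =
        Matrix.diagonal hA.eigenvalues * star (U : Matrix m m ℝ) := by
      conv_lhs => rw [hA.spectral_theorem, Unitary.conjStarAlgAut_apply, mul_assoc, ← mul_assoc,
        Unitary.coe_star_mul_self, one_mul]
      rfl
    have hBV : B * V = V * Matrix.diagonal hB.eigenvalues := by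
      conv_lhs => rw [hB.spectral_theorem, Unitary.conjStarAlgAut_apply, mul_assoc,
        Unitary.coe_star_mul_self, mul_one]
      rfl
    simp only [Matrix.mul_sub, Matrix.sub_mul, Submonoid.coe_mul, Unitary.coe_star, hUA, mul_assoc,
      hBV]
  refine ⟨_, sq_mem_doublyStochastic (star U * V), ?_⟩
  calc _ = ∑ k, ∑ l, (star (U : Matrix m m ℝ) * (A - B) * V) k l ^ 2 := by
        simp only [hconj, Matrix.sub_apply, Matrix.diagonal_mul, Matrix.mul_diagonal,
          Matrix.of_apply]
        exact Finset.sum_congr rfl fun k _ => Finset.sum_congr rfl fun l _ => by ring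
    _ = _ := sum_sq_star_mul_mul U V (A - B)

theorem card_le_card_add_of_doublyStochastic {W : Matrix m m ℝ} (hW : W ∈ doublyStochastic ℝ m)
    (a b : m → ℝ) (t : ℝ) {δ : ℝ} (hδ : 0 < δ) :
    (({k | a k ≤ t} : Finset m).card : ℝ) ≤ ({l | b l ≤ t + δ} : Finset m).card +
      (∑ k, ∑ l, W k l * (a k - b l) ^ 2) / δ ^ 2 := by
  have hpointwise (k l : m) : (if a k ≤ t then (1 : ℝ) else 0) ≤
      (if b l ≤ t + δ then 1 else 0) + (a k - b l) ^ 2 / δ ^ 2 := by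
    have h0 : 0 ≤ (a k - b l) ^ 2 / δ ^ 2 := by positivity
    split_ifs with hak hbl
    · linarith
    · rw [zero_add, le_div_iff₀ (by positivity), one_mul]
      nlinarith
    all_goals linarith
  simp only [Finset.natCast_card_filter]
  calc ∑ k, (if a k ≤ t then (1 : ℝ) else 0)
      = ∑ k, ∑ l, W k l * (if a k ≤ t then (1 : ℝ) else 0) := by
        simp only [← Finset.sum_mul, sum_row_of_mem_doublyStochastic hW, one_mul]
    _ ≤ ∑ k, ∑ l, W k l * ((if b l ≤ t + δ then 1 else 0) + (a k - b l) ^ 2 / δ ^ 2) := by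
        gcongr with k _ l _
        exacts [nonneg_of_mem_doublyStochastic hW, hpointwise k l]
    _ = ∑ l, (if b l ≤ t + δ then (1 : ℝ) else 0) +
          (∑ k, ∑ l, W k l * (a k - b l) ^ 2) / δ ^ 2 := by
        simp only [mul_add, Finset.sum_add_distrib, Finset.sum_div, mul_div_assoc]
        rw [Finset.sum_comm]
        simp only [← Finset.sum_mul, sum_col_of_mem_doublyStochastic hW, one_mul]

end Spectral

section ESD

variable {n : ℕ} {A B : Matrix (Fin n) (Fin n) ℝ}

theorem esd_eq (hA : A.IsHermitian) :
    esd A = (n : ENNReal)⁻¹ • ∑ i, Measure.dirac (hA.eigenvalues i) := by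
  rw [esd, hA.roots_charpoly_eq_eigenvalues, Multiset.map_map]
  rfl

theorem isProbabilityMeasure_esd (hn : n ≠ 0) (hA : A.IsHermitian) :
    IsProbabilityMeasure (esd A) := by
  refine ⟨?_⟩
  rw [esd_eq hA, Measure.smul_apply, Measure.finsetSum_apply]
  simp only [measure_univ, Finset.sum_const, Finset.card_univ, Fintype.card_fin, nsmul_eq_mul,
    mul_one, smul_eq_mul]
  exact ENNReal.inv_mul_cancel (by exact_mod_cast hn) (ENNReal.natCast_ne_top n)

theorem integrable_esd (hn : n ≠ 0) (hA : A.IsHermitian) (f : ℝ → ℝ) :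
    Integrable f (esd A) := by
  rw [esd_eq hA]
  refine Integrable.smul_measure ?_ (by simpa using hn)
  rw [integrable_finsetSum_measure]
  exact fun i _ => integrable_dirac (by simp)

theorem integral_esd (hA : A.IsHermitian) (f : ℝ → ℝ) :
    ∫ t, f t ∂(esd A) = (n : ℝ)⁻¹ * ∑ i, f (hA.eigenvalues i) := by
  rw [esd_eq hA, integral_smul_measure, integral_finsetSum_measure]
  · simp
  · exact fun i _ => integrable_dirac (by simp)

theorem esdMoment_eq (hA : A.IsHermitian) (h : ℕ) :
    esdMoment h A = (n : ℝ)⁻¹ * (A ^ h).trace := by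
  rw [esdMoment, integral_esd hA, trace_pow_eq_sum_eigenvalues hA]

theorem esdCDF_eq (hA : A.IsHermitian) (t : ℝ) :
    esdCDF A t = (n : ℝ)⁻¹ * ({i | hA.eigenvalues i ≤ t} : Finset (Fin n)).card := by
  rw [esdCDF, ← integral_indicator_one measurableSet_Iic, integral_esd hA,
    Finset.natCast_card_filter]
  simp only [Set.indicator_apply, Set.mem_Iic, Pi.one_apply]

/-- The squared Frobenius distance divided by the size of the matrices. -/
noncomputable def frobeniusDistSq (A B : Matrix (Fin n) (Fin n) ℝ) : ℝ :=
  (n : ℝ)⁻¹ * ∑ i, ∑ j, (A i j - B i j) ^ 2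

theorem frobeniusDistSq_comm (A B : Matrix (Fin n) (Fin n) ℝ) :
    frobeniusDistSq A B = frobeniusDistSq B A := by
  simp only [frobeniusDistSq, sub_sq_comm (A _ _)]

theorem frobeniusDistSq_nonneg (A B : Matrix (Fin n) (Fin n) ℝ) : 0 ≤ frobeniusDistSq A B := by
  unfold frobeniusDistSq
  positivity

theorem esdCDF_le (hA : A.IsHermitian) (hB : B.IsHermitian) (t : ℝ) {δ : ℝ} (hδ : 0 < δ) :
    esdCDF A t ≤ esdCDF B (t + δ) + frobeniusDistSq A B / δ ^ 2 := by
  obtain ⟨W, hW, hsum⟩ := exists_doublyStochastic_sum_eq_sum_sq_sub hA hB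
  rw [esdCDF_eq hA, esdCDF_eq hB, frobeniusDistSq, mul_div_assoc, ← mul_add, ← hsum]
  gcongr
  exact card_le_card_add_of_doublyStochastic hW _ _ t hδ

end ESD

section Product

variable {Ω ι κ : Type*} {LX : Link ι} {LY : Link κ}

theorem isHermitian_scaledProduct (hX : LX.IsSymm) (hY : LY.IsSymm) (x : ι → Ω → ℝ)
    (y : κ → Ω → ℝ) (n : ℕ) (ω : Ω) : (scaledProduct LX LY x y n ω).IsHermitian := by
  ext i j
  simp [scaledProduct, patterned, hX n i j, hY n i j]

theorem esdMoment_scaledProduct (hX : LX.IsSymm) (hY : LY.IsSymm) (x : ι → Ω → ℝ)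
    (y : κ → Ω → ℝ) (h n : ℕ) (ω : Ω) :
    esdMoment h (scaledProduct LX LY x y n ω) = (√n ^ (h + 2))⁻¹ *
      ∑ φ : Fin (h + 1) → Fin n with IsCircuit φ,
        prodVar x (LX.edgeValue φ) ω * prodVar y (LY.edgeValue φ) ω := by
  rw [esdMoment_eq (isHermitian_scaledProduct hX hY x y n ω), matrix_trace_pow_eq_sum_circuits,
    pow_add, mul_inv, Real.sq_sqrt (Nat.cast_nonneg n), mul_comm _ (n : ℝ)⁻¹, mul_assoc]
  congr 1
  rw [Finset.mul_sum]
  simp only [scaledProduct, patterned, Matrix.smul_apply, Matrix.hadamard_apply, Matrix.of_apply,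
    smul_eq_mul, Finset.prod_mul_distrib, Finset.prod_const, Finset.card_univ, Fintype.card_fin,
    prodVar, Link.edgeValue, inv_pow]

end Product

/-! ### Moments of the empirical spectral distribution -/

theorem PairMatched.even {β Λ : Type*} [Fintype β] {v : β → Λ} (hv : PairMatched v) :
    Even (Fintype.card β) := by
  classical
  rw [← Finset.card_univ, Finset.card_eq_sum_card_image v Finset.univ]
  refine Finset.even_sum _ fun l hl => ?_
  obtain ⟨i, -, rfl⟩ := Finset.mem_image.1 hl
  rw [← Set.ncard_coe_finset, Finset.coe_filter_univ, hv i]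
  exact even_two

theorem natCast_le_sqrt_mul_sqrt_pow {c K n r : ℕ} (hc : c ^ 2 ≤ K * n ^ r) :
    (c : ℝ) ≤ √K * √n ^ r := by
  refine (pow_le_pow_iff_left₀ (by positivity) (by positivity) two_ne_zero).1 ?_
  rw [mul_pow, ← pow_mul, mul_comm r 2, pow_mul, Real.sq_sqrt (Nat.cast_nonneg _),
    Real.sq_sqrt (Nat.cast_nonneg _)]
  exact_mod_cast hc

theorem abs_sum_le_card_mul {T : Type*} {s t : Finset T} {f : T → ℝ} {K : ℝ}
    (hst : ∀ a ∈ s, f a ≠ 0 → a ∈ t) (hK : ∀ a, |f a| ≤ K) : |∑ a ∈ s, f a| ≤ t.card * K := by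
  classical
  rw [← Finset.sum_filter_ne_zero]
  calc |∑ a ∈ s with f a ≠ 0, f a|
      ≤ ∑ a ∈ s with f a ≠ 0, |f a| := Finset.abs_sum_le_sum_abs _ _
    _ ≤ ∑ a ∈ t, |f a| := Finset.sum_le_sum_of_subset_of_nonneg
        (fun a ha => hst a (Finset.mem_filter.1 ha).1 (Finset.mem_filter.1 ha).2)
        fun a _ _ => abs_nonneg _
    _ ≤ t.card * K := by
        rw [← nsmul_eq_mul]
        exact Finset.sum_le_card_nsmul _ _ _ fun a _ => hK a

section Moments

variable {Ω ι κ β : Type*} [MeasurableSpace Ω] {P : Measure Ω} {LX : Link ι} {LY : Link κ}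
  {x : ι → Ω → ℝ} {y : κ → Ω → ℝ}

theorem IsWordLimit.tendsto_ncard_div_sqrt {p : (h : ℕ) → Word h → Word h → ℝ}
    (hp : IsWordLimit LX LY p) (h : ℕ) :
    Tendsto (fun n : ℕ => (√n ^ (h + 2))⁻¹ * ((pairMatchedCircuits LX LY h n).ncard : ℝ)) atTop
      (𝓝 (limitMoment p h)) := by
  rcases Nat.even_or_odd h with he | ho
  · obtain ⟨k, rfl⟩ := he.two_dvd
    refine (hp.tendsto_ncard k).congr fun n => ?_
    rw [show 2 * k + 2 = 2 * (1 + k) by ring, pow_mul, Real.sq_sqrt (Nat.cast_nonneg n),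
      div_eq_inv_mul]
  · have hempty (n : ℕ) : pairMatchedCircuits LX LY h n = ∅ :=
      Set.eq_empty_of_forall_notMem fun φ hφ =>
        Nat.not_even_iff_odd.2 ho (by simpa using hφ.2.1.even)
    simp [hempty, limitMoment, ho]

theorem integral_mul_of_indepFun (hx : ∀ i, Measurable (x i)) (hy : ∀ j, Measurable (y j))
    (hxy : IndepFun (fun ω i => x i ω) (fun ω j => y j ω) P) {F : (ι → ℝ) → ℝ}
    {G : (κ → ℝ) → ℝ} (hF : Measurable F) (hG : Measurable G) :
    ∫ ω, F (fun i => x i ω) * G (fun j => y j ω) ∂P =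
      (∫ ω, F (fun i => x i ω) ∂P) * ∫ ω, G (fun j => y j ω) ∂P :=
  (hxy.comp hF hG).integral_fun_mul_eq_mul_integral
    (hF.comp (measurable_pi_lambda _ hx)).aestronglyMeasurable
    (hG.comp (measurable_pi_lambda _ hy)).aestronglyMeasurable

variable [IsProbabilityMeasure P]

theorem InputA3.uniformMoments_prodVar [Fintype β] (hx : InputA3 P x) :
    UniformMoments P fun v : β → ι => prodVar x v :=
  hx.uniformMoments.prod Finset.univ

theorem InputA3.uniformMoments_prodVar_mul [Fintype β] (hx : InputA3 P x) (hy : InputA3 P y) :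
    UniformMoments P fun (q : (β → ι) × (β → κ)) ω => prodVar x q.1 ω * prodVar y q.2 ω :=
  (hx.uniformMoments_prodVar.comp Prod.fst).mul (hy.uniformMoments_prodVar.comp Prod.snd)

theorem sum_integral_prodVar_mul_eq_ncard (hx : StandardInput P x) (hy : StandardInput P y)
    (h n : ℕ) [DecidablePred fun φ : Fin (h + 1) → Fin n => IsCircuit φ ∧
      PairMatched (LX.edgeValue φ) ∧ PairMatched (LY.edgeValue φ)] :
    ∑ φ : Fin (h + 1) → Fin n with IsCircuit φ ∧
      PairMatched (LX.edgeValue φ) ∧ PairMatched (LY.edgeValue φ),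
      (∫ ω, prodVar x (LX.edgeValue φ) ω ∂P) * (∫ ω, prodVar y (LY.edgeValue φ) ω ∂P) =
    (pairMatchedCircuits LX LY h n).ncard := by
  have hset : pairMatchedCircuits LX LY h n = ({φ | IsCircuit φ ∧ PairMatched (LX.edgeValue φ) ∧
      PairMatched (LY.edgeValue φ)} : Finset (Fin (h + 1) → Fin n)) :=
    (Finset.coe_filter_univ _).symm
  rw [hset, Set.ncard_coe_finset, ← nsmul_one, ← Finset.sum_const]
  refine Finset.sum_congr rfl fun φ hφ => ?_
  obtain ⟨-, hX, hY⟩ := (Finset.mem_filter_univ φ).1 hφ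
  rw [hx.integral_prodVar_eq_one hX, hy.integral_prodVar_eq_one hY, one_mul]

theorem exists_abs_sum_sub_ncard_le {D D' : ℕ} (hLX : RowBound LX D) (hLY : RowBound LY D')
    (hx : InputA3 P x) (hy : InputA3 P y) (h : ℕ) : ∃ K : ℝ, ∀ n : ℕ,
      |∑ φ : Fin (h + 1) → Fin n with IsCircuit φ,
        (∫ ω, prodVar x (LX.edgeValue φ) ω ∂P) * (∫ ω, prodVar y (LY.edgeValue φ) ω ∂P) -
        (pairMatchedCircuits LX LY h n).ncard| ≤ K * √n ^ (h + 1) := by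
  classical
  obtain ⟨Kx, hKx0, hKx⟩ := (hx.uniformMoments_prodVar (β := Fin h)).exists_abs_integral_le
  obtain ⟨Ky, hKy0, hKy⟩ := (hy.uniformMoments_prodVar (β := Fin h)).exists_abs_integral_le
  obtain ⟨Nx, hNx⟩ := exists_sq_card_matched_le hLX h
  obtain ⟨Ny, hNy⟩ := exists_sq_card_matched_le hLY h
  refine ⟨(√Nx + √Ny) * (Kx * Ky), fun n => ?_⟩
  let badX : Finset (Fin (h + 1) → Fin n) :=
    {φ | Matched (LX.edgeValue φ) ∧ ¬ PairMatched (LX.edgeValue φ)}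
  let badY : Finset (Fin (h + 1) → Fin n) :=
    {φ | Matched (LY.edgeValue φ) ∧ ¬ PairMatched (LY.edgeValue φ)}
  have hcard : ((badX ∪ badY).card : ℝ) ≤ (√Nx + √Ny) * √n ^ (h + 1) := by
    have hX := natCast_le_sqrt_mul_sqrt_pow (hNx n badX fun φ => (Finset.mem_filter_univ φ).1)
    have hY := natCast_le_sqrt_mul_sqrt_pow (hNy n badY fun φ => (Finset.mem_filter_univ φ).1)
    rw [add_mul]
    exact (Nat.cast_le.2 (Finset.card_union_le _ _)).trans (by push_cast; linarith)
  rw [← Finset.sum_filter_add_sum_filter_not _ fun φ =>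
      PairMatched (LX.edgeValue φ) ∧ PairMatched (LY.edgeValue φ),
    Finset.filter_filter, Finset.filter_filter,
    sum_integral_prodVar_mul_eq_ncard hx.1 hy.1, add_sub_cancel_left]
  calc _ ≤ (badX ∪ badY).card * (Kx * Ky) :=
        abs_sum_le_card_mul (fun φ hφ hne => ?_) fun φ => ?_
    _ ≤ (√Nx + √Ny) * √n ^ (h + 1) * (Kx * Ky) := by gcongr
    _ = (√Nx + √Ny) * (Kx * Ky) * √n ^ (h + 1) := by ring
  · have hX := not_imp_comm.1 hx.1.integral_prodVar_eq_zero (left_ne_zero_of_mul hne)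
    have hY := not_imp_comm.1 hy.1.integral_prodVar_eq_zero (right_ne_zero_of_mul hne)
    have hnot := ((Finset.mem_filter_univ φ).1 hφ).2
    simp only [badX, badY, Finset.mem_union, Finset.mem_filter_univ]
    tauto
  · rw [abs_mul]
    exact mul_le_mul (hKx _) (hKy _) (abs_nonneg _) hKx0

theorem integral_esdMoment (hX : LX.IsSymm) (hY : LY.IsSymm) (hx : InputA3 P x)
    (hy : InputA3 P y) (hxy : IndepFun (fun ω i => x i ω) (fun ω j => y j ω) P) (h n : ℕ) :
    ∫ ω, esdMoment h (scaledProduct LX LY x y n ω) ∂P = (√n ^ (h + 2))⁻¹ *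
      ∑ φ : Fin (h + 1) → Fin n with IsCircuit φ,
        (∫ ω, prodVar x (LX.edgeValue φ) ω ∂P) * ∫ ω, prodVar y (LY.edgeValue φ) ω ∂P := by
  simp only [esdMoment_scaledProduct hX hY]
  rw [integral_const_mul, integral_finsetSum _ fun φ _ =>
    (hx.uniformMoments_prodVar_mul hy).integrable (LX.edgeValue φ, LY.edgeValue φ)]
  congr 1
  exact Finset.sum_congr rfl fun φ _ => integral_mul_of_indepFun hx.1.measurable hy.1.measurable
    hxy (F := fun z => ∏ i, z (LX.edgeValue φ i)) (G := fun z => ∏ i, z (LY.edgeValue φ i))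
    (by fun_prop) (by fun_prop)

theorem memLp_esdMoment (hX : LX.IsSymm) (hY : LY.IsSymm) (hx : InputA3 P x)
    (hy : InputA3 P y) (h n : ℕ) {q : ENNReal} (hq : q ≠ ⊤) :
    MemLp (fun ω => esdMoment h (scaledProduct LX LY x y n ω)) q P := by
  simp only [esdMoment_scaledProduct hX hY]
  exact (memLp_finsetSum _ fun φ _ =>
    (hx.uniformMoments_prodVar_mul hy).memLp (LX.edgeValue φ, LY.edgeValue φ) hq).const_mul _

theorem tendsto_inv_sqrt_natCast : Tendsto (fun n : ℕ => (√n)⁻¹) atTop (𝓝 0) :=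
  (Real.tendsto_sqrt_atTop.comp tendsto_natCast_atTop_atTop).inv_tendsto_atTop

theorem expectedMomentsTendsto (hX : LX.IsSymm) (hY : LY.IsSymm) (hXB : LX.PropertyB)
    (hYB : LY.PropertyB) {p : (h : ℕ) → Word h → Word h → ℝ} (hp : IsWordLimit LX LY p)
    (hx : InputA3 P x) (hy : InputA3 P y)
    (hxy : IndepFun (fun ω i => x i ω) (fun ω j => y j ω) P) :
    ExpectedMomentsTendsto P (scaledProduct LX LY x y) (limitMoment p) := by
  intro h
  refine ⟨fun n => memLp_one_iff_integrable.1
    (memLp_esdMoment hX hY hx hy h n ENNReal.one_ne_top), ?_⟩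
  obtain ⟨K, hK⟩ := exists_abs_sum_sub_ncard_le hXB.rowBound hYB.rowBound hx hy h
  have hdiff : Tendsto (fun n : ℕ => ∫ ω, esdMoment h (scaledProduct LX LY x y n ω) ∂P -
      (√n ^ (h + 2))⁻¹ * ((pairMatchedCircuits LX LY h n).ncard : ℝ)) atTop (𝓝 0) := by
    refine squeeze_zero_norm' (a := fun n : ℕ => K * (√n)⁻¹) ?_
      (by simpa using tendsto_inv_sqrt_natCast.const_mul K)
    filter_upwards [eventually_gt_atTop 0] with n hn
    have : 0 < √(n : ℝ) := Real.sqrt_pos.2 (by exact_mod_cast hn)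
    rw [integral_esdMoment hX hY hx hy hxy, ← mul_sub, Real.norm_eq_abs, abs_mul,
      abs_of_pos (by positivity)]
    calc _ ≤ (√n ^ (h + 2))⁻¹ * (K * √n ^ (h + 1)) := by gcongr; exact hK n
      _ = K * (√n)⁻¹ := by rw [pow_succ' _ (h + 1)]; field_simp
  simpa using hdiff.add (hp.tendsto_ncard_div_sqrt h)

end Moments

section FourthMoment

variable {Ω ι κ : Type*} [MeasurableSpace Ω] {P : Measure Ω} {LX : Link ι} {LY : Link κ}
  {x : ι → Ω → ℝ} {y : κ → Ω → ℝ}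

theorem integrable_sum_pow {T : Type*} (S : Finset T) {f : T → Ω → ℝ} {r : ℕ}
    (hint : ∀ V : Fin r → T, Integrable (fun ω => ∏ j, f (V j) ω) P) :
    Integrable (fun ω => (∑ φ ∈ S, f φ ω) ^ r) P := by
  simp only [Finset.sum_pow']
  exact integrable_finsetSum _ fun V _ => hint V

theorem integral_sum_pow_le {T : Type*} (S : Finset T) {f : T → Ω → ℝ} {r : ℕ}
    {good : Finset (Fin r → T)} {K : ℝ}
    (hint : ∀ V : Fin r → T, Integrable (fun ω => ∏ j, f (V j) ω) P)
    (hgood : ∀ V : Fin r → T, (∀ j, V j ∈ S) → ∫ ω, ∏ j, f (V j) ω ∂P ≠ 0 → V ∈ good)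
    (hK : ∀ V : Fin r → T, |∫ ω, ∏ j, f (V j) ω ∂P| ≤ K) :
    ∫ ω, (∑ φ ∈ S, f φ ω) ^ r ∂P ≤ good.card * K := by
  simp only [Finset.sum_pow']
  rw [integral_finsetSum _ fun V _ => hint V]
  exact (le_abs_self _).trans
    (abs_sum_le_card_mul (fun V hV => hgood V (Fintype.mem_piFinset.1 hV)) hK)

variable [IsProbabilityMeasure P]

theorem exists_integral_sum_centeredProd_mul_pow_four_le {L : Link ι} {D : ℕ}
    (hL : RowBound L D) (hx : InputA3 P x) (h : ℕ) {M : ℝ} (hM : 0 ≤ M) : ∃ K : ℝ, ∀ (n : ℕ)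
      (z : (Fin (h + 1) → Fin n) → Ω → ℝ),
      (∀ V : Fin 4 → Fin (h + 1) → Fin n,
        Integrable (fun ω => ∏ j, centeredProd P x (L.edgeValue (V j)) ω * z (V j) ω) P) →
      (∀ V : Fin 4 → Fin (h + 1) → Fin n,
        ∫ ω, ∏ j, centeredProd P x (L.edgeValue (V j)) ω * z (V j) ω ∂P =
          (∫ ω, ∏ j, centeredProd P x (L.edgeValue (V j)) ω ∂P) * ∫ ω, ∏ j, z (V j) ω ∂P) →
      (∀ V : Fin 4 → Fin (h + 1) → Fin n, |∫ ω, ∏ j, z (V j) ω ∂P| ≤ M) →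
      ∫ ω, (∑ φ with IsCircuit φ, centeredProd P x (L.edgeValue φ) ω * z φ ω) ^ 4 ∂P ≤
        K * (n : ℝ) ^ (2 * (h + 1)) := by
  classical
  have hprod := hx.uniformMoments_prodVar (β := Fin h)
  obtain ⟨K, hK0, hK⟩ :=
    (hprod.sub_integral.prod (Finset.univ : Finset (Fin 4))).exists_abs_integral_le
  obtain ⟨N, hN⟩ := exists_sq_card_crossMatched_le (α := Fin 4) hL h
  refine ⟨√N * (K * M), fun n z hint hfactor hz => ?_⟩
  let good : Finset (Fin 4 → Fin (h + 1) → Fin n) := {V | (∀ j, IsCircuit (V j)) ∧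
    Matched (L.familyValue V) ∧ CrossMatched (L.familyValue V)}
  have hcard : (good.card : ℝ) ≤ √N * n ^ (2 * (h + 1)) := by
    refine (natCast_le_sqrt_mul_sqrt_pow
      (hN n good fun V => (Finset.mem_filter_univ V).1)).trans_eq ?_
    rw [Fintype.card_fin, show 4 * (h + 1) = 2 * (2 * (h + 1)) by ring, pow_mul √(n : ℝ),
      Real.sq_sqrt (Nat.cast_nonneg n)]
  have hgood (V : Fin 4 → Fin (h + 1) → Fin n) (hV : ∀ j, IsCircuit (V j))
      (hne : ∫ ω, ∏ j, centeredProd P x (L.edgeValue (V j)) ω * z (V j) ω ∂P ≠ 0) :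
      V ∈ good := by
    have hne' := left_ne_zero_of_mul (hfactor V ▸ hne)
    refine (Finset.mem_filter_univ V).2 ⟨hV, ?_, ?_⟩ <;> by_contra hnot
    · exact hne' (hx.1.integral_prod_centeredProd_of_not_matched hnot)
    · exact hne' (hx.1.integral_prod_centeredProd_of_not_crossMatched
        (fun j => hprod.integrable _) hnot)
  have hbound (V : Fin 4 → Fin (h + 1) → Fin n) :
      |∫ ω, ∏ j, centeredProd P x (L.edgeValue (V j)) ω * z (V j) ω ∂P| ≤ K * M := by
    rw [hfactor, abs_mul]
    exact mul_le_mul (hK fun j => L.edgeValue (V j)) (hz V) (abs_nonneg _) hK0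
  calc _ ≤ good.card * (K * M) := integral_sum_pow_le _ hint
        (fun V hV => hgood V fun j => (Finset.mem_filter_univ _).1 (hV j)) hbound
    _ ≤ √N * n ^ (2 * (h + 1)) * (K * M) := by gcongr
    _ = √N * (K * M) * n ^ (2 * (h + 1)) := by ring

theorem exists_integral_sum_centeredProd_mul_prodVar_pow_four_le {D : ℕ} (hLX : RowBound LX D)
    (hx : InputA3 P x) (hy : InputA3 P y)
    (hxy : IndepFun (fun ω i => x i ω) (fun ω j => y j ω) P) (h : ℕ) : ∃ K : ℝ, ∀ n : ℕ,
      Integrable (fun ω => (∑ φ : Fin (h + 1) → Fin n with IsCircuit φ,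
        centeredProd P x (LX.edgeValue φ) ω * prodVar y (LY.edgeValue φ) ω) ^ 4) P ∧
      ∫ ω, (∑ φ : Fin (h + 1) → Fin n with IsCircuit φ,
        centeredProd P x (LX.edgeValue φ) ω * prodVar y (LY.edgeValue φ) ω) ^ 4 ∂P ≤
        K * (n : ℝ) ^ (2 * (h + 1)) := by
  have hX4 := hx.uniformMoments_prodVar (β := Fin h) |>.sub_integral.prod
    (Finset.univ : Finset (Fin 4))
  have hY4 := hy.uniformMoments_prodVar (β := Fin h) |>.prod (Finset.univ : Finset (Fin 4))
  obtain ⟨M, hM0, hM⟩ := hY4.exists_abs_integral_le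
  obtain ⟨K, hK⟩ := exists_integral_sum_centeredProd_mul_pow_four_le hLX hx h hM0
  have hint (n : ℕ) (V : Fin 4 → Fin (h + 1) → Fin n) : Integrable (fun ω =>
      ∏ j, centeredProd P x (LX.edgeValue (V j)) ω * prodVar y (LY.edgeValue (V j)) ω) P := by
    simp only [Finset.prod_mul_distrib]
    exact ((hX4.comp Prod.fst).mul (hY4.comp Prod.snd)).integrable
      (fun j => LX.edgeValue (V j), fun j => LY.edgeValue (V j))
  refine ⟨K, fun n => ⟨integrable_sum_pow _ (hint n), hK n _ (hint n) (fun V => ?_)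
    fun V => hM fun j => LY.edgeValue (V j)⟩⟩
  simp only [Finset.prod_mul_distrib]
  exact integral_mul_of_indepFun hx.1.measurable hy.1.measurable hxy
    (F := fun z => ∏ j, (∏ i, z (LX.edgeValue (V j) i) - ∫ ω, prodVar x (LX.edgeValue (V j)) ω ∂P))
    (G := fun z => ∏ j, ∏ i, z (LY.edgeValue (V j) i)) (by fun_prop) (by fun_prop)

theorem exists_integral_sum_centeredProd_mul_const_pow_four_le {D : ℕ} (hLX : RowBound LX D)
    (hx : InputA3 P x) (h : ℕ) {C : ℝ} (hC : 0 ≤ C) : ∃ K : ℝ, ∀ (n : ℕ)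
      (c : (Fin (h + 1) → Fin n) → ℝ), (∀ φ, |c φ| ≤ C) →
      Integrable (fun ω => (∑ φ : Fin (h + 1) → Fin n with IsCircuit φ,
        centeredProd P x (LX.edgeValue φ) ω * c φ) ^ 4) P ∧
      ∫ ω, (∑ φ : Fin (h + 1) → Fin n with IsCircuit φ,
        centeredProd P x (LX.edgeValue φ) ω * c φ) ^ 4 ∂P ≤ K * (n : ℝ) ^ (2 * (h + 1)) := by
  have hX4 := hx.uniformMoments_prodVar (β := Fin h) |>.sub_integral.prod
    (Finset.univ : Finset (Fin 4))
  obtain ⟨K, hK⟩ := exists_integral_sum_centeredProd_mul_pow_four_le hLX hx h (pow_nonneg hC 4)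
  refine ⟨K, fun n c hc => ?_⟩
  have hint (V : Fin 4 → Fin (h + 1) → Fin n) :
      Integrable (fun ω => ∏ j, centeredProd P x (LX.edgeValue (V j)) ω * c (V j)) P := by
    simp only [Finset.prod_mul_distrib]
    exact (hX4.integrable fun j => LX.edgeValue (V j)).mul_const _
  refine ⟨integrable_sum_pow _ hint, hK n (fun φ _ => c φ) hint (fun V => ?_) fun V => ?_⟩
  · simp only [Finset.prod_mul_distrib, integral_mul_const, integral_const, probReal_univ,
      one_smul]
  · simp only [integral_const, probReal_univ, one_smul, Finset.abs_prod]
    exact (Finset.prod_le_prod (fun _ _ => abs_nonneg _) fun j _ => hc (V j)).trans_eq (by simp)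

theorem esdMoment_sub_integral_eq (hX : LX.IsSymm) (hY : LY.IsSymm) (hx : InputA3 P x)
    (hy : InputA3 P y) (hxy : IndepFun (fun ω i => x i ω) (fun ω j => y j ω) P) (h n : ℕ)
    (ω : Ω) :
    esdMoment h (scaledProduct LX LY x y n ω) -
      ∫ ω', esdMoment h (scaledProduct LX LY x y n ω') ∂P =
    (√n ^ (h + 2))⁻¹ *
      ((∑ φ : Fin (h + 1) → Fin n with IsCircuit φ,
        centeredProd P x (LX.edgeValue φ) ω * prodVar y (LY.edgeValue φ) ω) +
      ∑ φ : Fin (h + 1) → Fin n with IsCircuit φ,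
        centeredProd P y (LY.edgeValue φ) ω * ∫ ω', prodVar x (LX.edgeValue φ) ω' ∂P) := by
  rw [integral_esdMoment hX hY hx hy hxy, esdMoment_scaledProduct hX hY, ← mul_sub,
    ← Finset.sum_sub_distrib, ← Finset.sum_add_distrib]
  congr 1
  refine Finset.sum_congr rfl fun φ _ => ?_
  simp only [centeredProd]
  simp only [prodVar]
  ring

theorem exists_integral_esdMoment_sub_pow_four_le (hX : LX.IsSymm) (hY : LY.IsSymm)
    (hXB : LX.PropertyB) (hYB : LY.PropertyB) (hx : InputA3 P x) (hy : InputA3 P y)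
    (hxy : IndepFun (fun ω i => x i ω) (fun ω j => y j ω) P) (h : ℕ) : ∃ K : ℝ, ∀ n : ℕ, 0 < n →
      ∫ ω, (esdMoment h (scaledProduct LX LY x y n ω) -
        ∫ ω', esdMoment h (scaledProduct LX LY x y n ω') ∂P) ^ 4 ∂P ≤ K * ((n : ℝ) ^ 2)⁻¹ := by
  obtain ⟨C, hC0, hC⟩ := (hx.uniformMoments_prodVar (β := Fin h)).exists_abs_integral_le
  obtain ⟨K₁, hK₁⟩ := exists_integral_sum_centeredProd_mul_prodVar_pow_four_le
    (LY := LY) hXB.rowBound hx hy hxy h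
  obtain ⟨K₂, hK₂⟩ := exists_integral_sum_centeredProd_mul_const_pow_four_le hYB.rowBound hy h hC0
  refine ⟨2 ^ 3 * (K₁ + K₂), fun n hn => ?_⟩
  have hn' : (0 : ℝ) < n := by exact_mod_cast hn
  obtain ⟨hint₁, hle₁⟩ := hK₁ n
  obtain ⟨hint₂, hle₂⟩ := hK₂ n (fun φ => ∫ ω, prodVar x (LX.edgeValue φ) ω ∂P) fun φ => hC _
  have hscale : ((√n ^ (h + 2))⁻¹) ^ 4 = ((n : ℝ) ^ (2 * (h + 1)))⁻¹ * ((n : ℝ) ^ 2)⁻¹ := by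
    rw [← mul_inv, ← pow_add, inv_pow, ← pow_mul,
      show (h + 2) * 4 = 2 * (2 * (h + 1) + 2) by ring, pow_mul, Real.sq_sqrt hn'.le]
  simp only [esdMoment_sub_integral_eq hX hY hx hy hxy, mul_pow, integral_const_mul, hscale]
  calc _ ≤ ((n : ℝ) ^ (2 * (h + 1)))⁻¹ * ((n : ℝ) ^ 2)⁻¹ *
        (2 ^ 3 * (K₁ * (n : ℝ) ^ (2 * (h + 1)) + K₂ * (n : ℝ) ^ (2 * (h + 1)))) := by
        gcongr
        refine (integral_mono_of_nonneg (ae_of_all _ fun ω => by positivity)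
          ((hint₁.add hint₂).const_mul (2 ^ 3))
          (ae_of_all _ fun ω => Even.add_pow_le (by decide))).trans ?_
        simp only [Pi.add_apply]
        rw [integral_const_mul, integral_add hint₁ hint₂]
        gcongr
    _ = 2 ^ 3 * (K₁ + K₂) * ((n : ℝ) ^ 2)⁻¹ := by field_simp

theorem fourthMomentSummable (hX : LX.IsSymm) (hY : LY.IsSymm) (hXB : LX.PropertyB)
    (hYB : LY.PropertyB) (hx : InputA3 P x) (hy : InputA3 P y)
    (hxy : IndepFun (fun ω i => x i ω) (fun ω j => y j ω) P) :
    FourthMomentSummable P (scaledProduct LX LY x y) := by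
  intro h
  refine ⟨fun n => memLp_esdMoment hX hY hx hy h n (by norm_num), ?_⟩
  obtain ⟨K, hK⟩ := exists_integral_esdMoment_sub_pow_four_le hX hY hXB hYB hx hy hxy h
  have hsum : Summable fun n : ℕ => K * ((n : ℝ) ^ 2)⁻¹ :=
    (Real.summable_nat_pow_inv.2 one_lt_two).mul_left K
  rw [← summable_nat_add_iff 1]
  exact .of_nonneg_of_le (fun n => integral_nonneg fun ω => by positivity)
    (fun n => hK (n + 1) n.succ_pos) ((summable_nat_add_iff 1).2 hsum)

end FourthMoment

section AlmostSure

variable {Ω : Type*} [MeasurableSpace Ω] {P : Measure Ω}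

theorem ae_summable_of_summable_integral {f : ℕ → Ω → ℝ} (hint : ∀ n, Integrable (f n) P)
    (hf : ∀ n, 0 ≤ f n) (hsum : Summable fun n => ∫ ω, f n ω ∂P) :
    ∀ᵐ ω ∂P, Summable fun n => f n ω := by
  have hnorm (n : ℕ) : ∫⁻ ω, ENNReal.ofReal (f n ω) ∂P = ENNReal.ofReal (∫ ω, f n ω ∂P) :=
    (ofReal_integral_eq_lintegral_ofReal (hint n) (ae_of_all _ (hf n))).symm
  have hmeas (n : ℕ) : AEMeasurable (fun ω => ENNReal.ofReal (f n ω)) P :=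
    (hint n).aestronglyMeasurable.aemeasurable.ennreal_ofReal
  have hfin : ∫⁻ ω, ∑' n, ENNReal.ofReal (f n ω) ∂P ≠ ⊤ := by
    simpa only [lintegral_tsum hmeas, hnorm] using hsum.tsum_ofReal_ne_top
  filter_upwards [ae_lt_top' (AEMeasurable.tsum hmeas) hfin] with ω hω
  exact (ENNReal.summable_toReal hω.ne).congr fun n => ENNReal.toReal_ofReal (hf n ω)

theorem FourthMomentSummable.ae_tendsto_sub_integral [IsProbabilityMeasure P]
    {A : (n : ℕ) → Ω → Matrix (Fin n) (Fin n) ℝ} (hA : FourthMomentSummable P A) (h : ℕ) :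
    ∀ᵐ ω ∂P, Tendsto (fun n => esdMoment h (A n ω) - ∫ ω', esdMoment h (A n ω') ∂P) atTop
      (𝓝 0) := by
  obtain ⟨hLp, hsum⟩ := hA h
  have hint (n : ℕ) : Integrable
      (fun ω => (esdMoment h (A n ω) - ∫ ω', esdMoment h (A n ω') ∂P) ^ 4) P := by
    have := ((hLp n).sub (memLp_const (∫ ω', esdMoment h (A n ω') ∂P))).integrable_norm_pow
      (p := 4) (by norm_num)
    simpa only [Pi.sub_apply, Real.norm_eq_abs, Even.pow_abs (show Even 4 by decide)] using this
  filter_upwards [ae_summable_of_summable_integral hint (fun n ω => by positivity) hsum] with ω hω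
  refine (tendsto_zero_iff_abs_tendsto_zero _).2 ?_
  have hroot := hω.tendsto_atTop_zero.sqrt.sqrt
  simp only [Real.sqrt_zero] at hroot
  refine hroot.congr fun n => ?_
  rw [show 4 = 2 * 2 from rfl, pow_mul, Real.sqrt_sq (sq_nonneg _), Real.sqrt_sq_eq_abs,
    Function.comp_apply]

theorem ae_tendsto_esdMoment [IsProbabilityMeasure P]
    {A : (n : ℕ) → Ω → Matrix (Fin n) (Fin n) ℝ} {β : ℕ → ℝ}
    (hE : ExpectedMomentsTendsto P A β) (hF : FourthMomentSummable P A) :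
    ∀ᵐ ω ∂P, ∀ h : ℕ, Tendsto (fun n => esdMoment h (A n ω)) atTop (𝓝 (β h)) := by
  refine ae_all_iff.2 fun h => ?_
  filter_upwards [hF.ae_tendsto_sub_integral h] with ω hω
  simpa using hω.add (hE h).2

end AlmostSure

/-! ### The method of moments -/

section WeakLimits

variable {E : Type*} [TopologicalSpace E]

/-- The continuous function `f` cut off at the levels `-M` and `M`, as a bounded function. -/
noncomputable def clip (f : C(E, ℝ)) (M : NNReal) : BoundedContinuousFunction E ℝ :=
  BoundedContinuousFunction.ofNormedAddCommGroup (fun t => max (-M) (min (f t) M))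
    (by fun_prop) M fun t => by
      rw [Real.norm_eq_abs, abs_le]
      exact ⟨le_max_left _ _, max_le (neg_le_self M.2) (min_le_right _ _)⟩

theorem mul_abs_sub_clip_le (f : C(E, ℝ)) (M : NNReal) (t : E) :
    M * |f t - clip f M t| ≤ f t ^ 2 := by
  have : (0 : ℝ) ≤ M := M.2
  change M * |f t - max (-M : ℝ) (min (f t) M)| ≤ f t ^ 2
  rcases le_total (f t) M with hle | hge
  · rw [min_eq_left hle]
    rcases le_total (-M : ℝ) (f t) with hge' | hle'
    · rw [max_eq_right hge', sub_self, abs_zero, mul_zero]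
      exact sq_nonneg (f t)
    · rw [max_eq_left hle', abs_of_nonpos (by linarith)]
      nlinarith
  · rw [min_eq_right hge, max_eq_right (by linarith), abs_of_nonneg (by linarith)]
    nlinarith

variable [MeasurableSpace E] [BorelSpace E]

theorem mul_abs_integral_sub_clip_le {ν : Measure E} [IsProbabilityMeasure ν] {f : C(E, ℝ)}
    (hf : Integrable f ν) (hf2 : Integrable (fun t => f t ^ 2) ν) (M : NNReal) :
    M * |∫ t, f t ∂ν - ∫ t, clip f M t ∂ν| ≤ ∫ t, f t ^ 2 ∂ν := by
  have hclip : Integrable (clip f M) ν := (clip f M).integrable ν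
  calc M * |∫ t, f t ∂ν - ∫ t, clip f M t ∂ν|
      ≤ ∫ t, M * |f t - clip f M t| ∂ν := by
        rw [← integral_sub hf hclip, integral_const_mul]
        gcongr
        exact abs_integral_le_integral_abs
    _ ≤ ∫ t, f t ^ 2 ∂ν :=
        integral_mono ((hf.sub hclip).abs.const_mul _) hf2 (mul_abs_sub_clip_le f M)

variable [HasOuterApproxClosed E] {ν : ℕ → ProbabilityMeasure E} {μ : ProbabilityMeasure E}

theorem integrable_of_tendsto_of_nonneg (hν : Tendsto ν atTop (𝓝 μ)) {f : E → ℝ}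
    (hf : Continuous f) (hf0 : 0 ≤ f) (hint : ∀ n, Integrable f (ν n : Measure E)) {b : ℝ}
    (hlim : Tendsto (fun n => ∫ t, f t ∂(ν n : Measure E)) atTop (𝓝 b)) :
    Integrable f (μ : Measure E) ∧ ∫ t, f t ∂(μ : Measure E) ≤ b := by
  have hb : 0 ≤ b := ge_of_tendsto' hlim fun n => integral_nonneg hf0
  have hle : ∫⁻ t, ENNReal.ofReal (f t) ∂(μ : Measure E) ≤ ENNReal.ofReal b := by
    refine (lintegral_le_liminf_lintegral_of_forall_isOpen_measure_le_liminf_measure hf hf0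
      fun G hG => ProbabilityMeasure.le_liminf_measure_open_of_tendsto hν hG).trans_eq
      (Tendsto.liminf_eq ?_)
    simp_rw [← ofReal_integral_eq_lintegral_ofReal (hint _) (ae_of_all _ hf0)]
    exact ENNReal.tendsto_ofReal hlim
  have hfi : Integrable f (μ : Measure E) :=
    ⟨hf.measurable.aestronglyMeasurable,
      (hasFiniteIntegral_iff_ofReal (ae_of_all _ hf0)).2 (hle.trans_lt ENNReal.ofReal_lt_top)⟩
  rw [← ofReal_integral_eq_lintegral_ofReal hfi (ae_of_all _ hf0),
    ENNReal.ofReal_le_ofReal_iff hb] at hle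
  exact ⟨hfi, hle⟩

theorem integral_eq_of_tendsto_of_tendsto_sq (hν : Tendsto ν atTop (𝓝 μ)) {f : C(E, ℝ)}
    (hint : ∀ n, Integrable f (ν n : Measure E))
    (hint2 : ∀ n, Integrable (fun t => f t ^ 2) (ν n : Measure E)) {b c : ℝ}
    (hlim : Tendsto (fun n => ∫ t, f t ∂(ν n : Measure E)) atTop (𝓝 b))
    (hlim2 : Tendsto (fun n => ∫ t, f t ^ 2 ∂(ν n : Measure E)) atTop (𝓝 c)) :
    Integrable f (μ : Measure E) ∧ ∫ t, f t ∂(μ : Measure E) = b := by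
  obtain ⟨hfi2, hle⟩ := integrable_of_tendsto_of_nonneg hν (by fun_prop) (fun t => sq_nonneg (f t))
    hint2 hlim2
  have hfi : Integrable f (μ : Measure E) :=
    ((memLp_two_iff_integrable_sq f.continuous.measurable.aestronglyMeasurable).2
      hfi2).integrable one_le_two
  have hclip (M : NNReal) :=
    (ProbabilityMeasure.tendsto_iff_forall_integral_tendsto.1 hν) (clip f M)
  have hbound (M : NNReal) : M * |∫ t, f t ∂(μ : Measure E) - b| ≤ 2 * c := by
    have hμM := (mul_abs_integral_sub_clip_le hfi hfi2 M).trans hle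
    have hbM : M * |b - ∫ t, clip f M t ∂(μ : Measure E)| ≤ c :=
      le_of_tendsto_of_tendsto' ((hlim.sub (hclip M)).abs.const_mul _) hlim2 fun n =>
        mul_abs_integral_sub_clip_le (hint n) (hint2 n) M
    have htri := abs_sub_le (∫ t, f t ∂(μ : Measure E)) (∫ t, clip f M t ∂(μ : Measure E)) b
    rw [abs_sub_comm (∫ t, clip f M t ∂(μ : Measure E)) b] at htri
    nlinarith [mul_le_mul_of_nonneg_left htri M.2]
  refine ⟨hfi, ?_⟩
  by_contra hne
  obtain ⟨M, hM⟩ := exists_nat_gt (2 * c / |∫ t, f t ∂(μ : Measure E) - b|)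
  rw [div_lt_iff₀ (abs_pos.2 (sub_ne_zero.2 hne))] at hM
  exact absurd (hbound M) (not_le.2 (by exact_mod_cast hM))

end WeakLimits

section HasMoments

/-- `β` is the moment sequence of `μ`, all moments being finite. -/
def HasMoments (μ : Measure ℝ) (β : ℕ → ℝ) : Prop :=
  ∀ h : ℕ, Integrable (fun t : ℝ => t ^ h) μ ∧ ∫ t, t ^ h ∂μ = β h

theorem isTightMeasureSet_of_integral_sq_le {S : Set (Measure ℝ)} {K : ℝ}
    (hS : ∀ ν ∈ S, IsFiniteMeasure ν ∧ Integrable (fun t : ℝ => t ^ 2) ν ∧ ∫ t, t ^ 2 ∂ν ≤ K) :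
    IsTightMeasureSet S := by
  apply isTightMeasureSet_of_tendsto_measure_norm_gt
  have hdecay : Tendsto (fun r : ℝ => ENNReal.ofReal (K / r ^ 2)) atTop (𝓝 0) := by
    simpa using ENNReal.tendsto_ofReal
      (tendsto_const_nhds.div_atTop (tendsto_pow_atTop two_ne_zero) :
        Tendsto (fun r : ℝ => K / r ^ 2) atTop (𝓝 0))
  refine tendsto_of_tendsto_of_tendsto_of_le_of_le' tendsto_const_nhds hdecay
    (Eventually.of_forall fun _ => zero_le) ?_
  filter_upwards [eventually_gt_atTop 0] with r hr
  refine iSup₂_le fun ν hν => ?_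
  obtain ⟨hfin, hint, hK⟩ := hS ν hν
  have hsub : {x : ℝ | r < ‖x‖} ⊆ {x | r ^ 2 ≤ x ^ 2} := fun x hx =>
    sq_le_sq.2 ((abs_of_pos hr).trans_le (Set.mem_ofPred_eq ▸ hx).le)
  have hmarkov := (mul_meas_ge_le_integral_of_nonneg
    (ae_of_all ν fun t : ℝ => sq_nonneg t) hint (r ^ 2)).trans hK
  refine (measure_mono hsub).trans ?_
  rw [← ofReal_measureReal]
  exact ENNReal.ofReal_le_ofReal ((le_div_iff₀' (by positivity)).2 hmarkov)

variable {ν : ℕ → ProbabilityMeasure ℝ} {β : ℕ → ℝ}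

theorem hasMoments_of_tendsto {μ : ProbabilityMeasure ℝ} (hν : Tendsto ν atTop (𝓝 μ))
    (hint : ∀ h n : ℕ, Integrable (fun t : ℝ => t ^ h) (ν n : Measure ℝ))
    (hlim : ∀ h : ℕ, Tendsto (fun n => ∫ t, t ^ h ∂(ν n : Measure ℝ)) atTop (𝓝 (β h))) :
    HasMoments μ β := fun h =>
  integral_eq_of_tendsto_of_tendsto_sq hν (f := ⟨fun t => t ^ h, by fun_prop⟩) (hint h)
    (by simpa only [ContinuousMap.coe_mk, ← pow_mul] using hint (h * 2)) (hlim h)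
    (by simpa only [ContinuousMap.coe_mk, ← pow_mul] using hlim (h * 2))

theorem exists_subseq_tendsto_hasMoments
    (hint : ∀ h n : ℕ, Integrable (fun t : ℝ => t ^ h) (ν n : Measure ℝ))
    (hlim : ∀ h : ℕ, Tendsto (fun n => ∫ t, t ^ h ∂(ν n : Measure ℝ)) atTop (𝓝 (β h))) :
    ∃ (μ : ProbabilityMeasure ℝ) (φ : ℕ → ℕ),
      Tendsto (ν ∘ φ) atTop (𝓝 μ) ∧ HasMoments μ β := by
  obtain ⟨K, hK⟩ := (hlim 2).bddAbove_range
  have htight : IsTightMeasureSet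
      {((ρ : ProbabilityMeasure ℝ) : Measure ℝ) | ρ ∈ Set.range ν} := by
    apply isTightMeasureSet_of_integral_sq_le (K := K)
    rintro _ ⟨_, ⟨n, rfl⟩, rfl⟩
    exact ⟨inferInstance, hint 2 n, hK ⟨n, rfl⟩⟩
  obtain ⟨μ, -, φ, hφ, hμ⟩ := (isCompact_closure_of_isTightMeasureSet htight).tendsto_subseq
    fun n => subset_closure (Set.mem_range_self n)
  exact ⟨μ, φ, hμ, hasMoments_of_tendsto hμ (fun h n => hint h (φ n))
    fun h => (hlim h).comp hφ.tendsto_atTop⟩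

end HasMoments

section GaussianGrowth

/-- The even terms of `β` are at most the moments of a centred Gaussian law of variance `D`. -/
def GaussianGrowth (β : ℕ → ℝ) (D : ℝ) : Prop :=
  ∀ k : ℕ, β (2 * k) ≤ ((2 * k).factorial : ℝ) / (2 ^ k * (k.factorial : ℝ)) * D ^ k

theorem hasSum_pow_div_factorial (s : ℝ) :
    HasSum (fun k : ℕ => s ^ k / (k.factorial : ℝ)) (Real.exp s) := by
  simpa only [← Real.exp_eq_exp_ℝ] using NormedSpace.expSeries_div_hasSum_exp (𝔸 := ℝ) s

theorem integrable_of_hasSum {Ω : Type*} [MeasurableSpace Ω] {P : Measure Ω} {f : ℕ → Ω → ℝ}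
    {g : Ω → ℝ} (hint : ∀ n, Integrable (f n) P) (hf : ∀ n, 0 ≤ f n)
    (hsum : Summable fun n => ∫ ω, f n ω ∂P) (hg : AEStronglyMeasurable g P)
    (hfg : ∀ ω, HasSum (fun n => f n ω) (g ω)) : Integrable g P := by
  refine ⟨hg, (hasFiniteIntegral_iff_ofReal (ae_of_all _ fun ω =>
    (hfg ω).nonneg fun n => hf n ω)).2 ?_⟩
  calc ∫⁻ ω, ENNReal.ofReal (g ω) ∂P
      = ∫⁻ ω, ∑' n, ENNReal.ofReal (f n ω) ∂P := by
        refine lintegral_congr fun ω => ?_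
        rw [← (hfg ω).tsum_eq, ENNReal.ofReal_tsum_of_nonneg (fun n => hf n ω) (hfg ω).summable]
    _ = ∑' n, ENNReal.ofReal (∫ ω, f n ω ∂P) := by
        rw [lintegral_tsum fun n => (hint n).aestronglyMeasurable.aemeasurable.ennreal_ofReal]
        simp_rw [ofReal_integral_eq_lintegral_ofReal (hint _) (ae_of_all _ (hf _))]
    _ < ⊤ := hsum.tsum_ofReal_lt_top

variable {μ : Measure ℝ} {β : ℕ → ℝ} {D : ℝ}

theorem HasMoments.nonneg (hμ : HasMoments μ β) (k : ℕ) : 0 ≤ β (2 * k) := by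
  rw [← (hμ (2 * k)).2]
  exact integral_nonneg fun t => (even_two_mul k).pow_nonneg t

theorem GaussianGrowth.pow_mul_div_factorial_le (hg : GaussianGrowth β D) (t : ℝ) (k : ℕ) :
    t ^ (2 * k) * β (2 * k) / ((2 * k).factorial : ℝ) ≤
      (D * t ^ 2 / 2) ^ k / (k.factorial : ℝ) := by
  have ht : 0 ≤ t ^ (2 * k) := (even_two_mul k).pow_nonneg t
  calc t ^ (2 * k) * β (2 * k) / ((2 * k).factorial : ℝ)
      ≤ t ^ (2 * k) * (((2 * k).factorial : ℝ) / (2 ^ k * (k.factorial : ℝ)) * D ^ k) /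
          ((2 * k).factorial : ℝ) := by
        gcongr
        exact hg k
    _ = (D * t ^ 2 / 2) ^ k / (k.factorial : ℝ) := by
        rw [div_pow, mul_pow, pow_mul]
        field_simp

theorem HasMoments.integrable_cosh_mul (hμ : HasMoments μ β) (hg : GaussianGrowth β D) (s : ℝ) :
    Integrable (fun x : ℝ => Real.cosh (s * x)) μ := by
  have hmoment (k : ℕ) : ∫ x, (s * x) ^ (2 * k) / ((2 * k).factorial : ℝ) ∂μ =
      s ^ (2 * k) * β (2 * k) / ((2 * k).factorial : ℝ) := by
    simp_rw [mul_pow]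
    rw [integral_div, integral_const_mul, (hμ (2 * k)).2]
  have hpow (k : ℕ) (x : ℝ) : 0 ≤ x ^ (2 * k) := (even_two_mul k).pow_nonneg x
  refine integrable_of_hasSum (f := fun k x => (s * x) ^ (2 * k) / ((2 * k).factorial : ℝ))
    (fun k => ?_) (fun k x => div_nonneg (hpow k _) (Nat.cast_nonneg _)) ?_ (by fun_prop)
    fun x => Real.hasSum_cosh (s * x)
  · simp_rw [mul_pow]
    exact ((hμ (2 * k)).1.const_mul _).div_const _
  · simp_rw [hmoment]
    exact Summable.of_nonneg_of_le
      (fun k => div_nonneg (mul_nonneg (hpow k s) (hμ.nonneg k)) (Nat.cast_nonneg _))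
      (hg.pow_mul_div_factorial_le s) (hasSum_pow_div_factorial _).summable

theorem HasMoments.integrable_exp_abs_mul (hμ : HasMoments μ β) (hg : GaussianGrowth β D)
    (s : ℝ) : Integrable (fun x : ℝ => Real.exp |s * x|) μ := by
  refine ((hμ.integrable_cosh_mul hg s).const_mul 2).mono' (by fun_prop) (ae_of_all _ fun x => ?_)
  rw [Real.norm_eq_abs, Real.abs_exp, ← Real.cosh_abs, Real.cosh_eq]
  linarith [Real.exp_pos (-|s * x|)]

theorem HasMoments.hasSum_complexMGF (hμ : HasMoments μ β) (hg : GaussianGrowth β D) (z : ℂ) :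
    HasSum (fun k : ℕ => z ^ k * (β k : ℂ) / (k.factorial : ℂ)) (complexMGF id μ z) := by
  have hterm (k : ℕ) : ∫ x : ℝ, (z * x) ^ k / (k.factorial : ℂ) ∂μ =
      z ^ k * (β k : ℂ) / (k.factorial : ℂ) := by
    simp_rw [mul_pow]
    rw [integral_div, integral_const_mul, ← (hμ k).2, ← integral_complex_ofReal]
    simp_rw [Complex.ofReal_pow]
  simp_rw [← hterm]
  refine hasSum_integral_of_dominated_convergence
    (fun k (x : ℝ) => |‖z‖ * x| ^ k / (k.factorial : ℝ)) (fun k => by fun_prop)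
    (fun k => ae_of_all _ fun x => le_of_eq ?_)
    (ae_of_all _ fun x => (hasSum_pow_div_factorial _).summable) ?_ (ae_of_all _ fun x => ?_)
  · rw [norm_div, norm_pow, norm_mul, Complex.norm_real, Complex.norm_natCast, abs_mul, abs_norm,
      Real.norm_eq_abs]
  · simp_rw [(hasSum_pow_div_factorial _).tsum_eq]
    exact hμ.integrable_exp_abs_mul hg ‖z‖
  · simpa only [id, ← Complex.exp_eq_exp_ℂ] using
      NormedSpace.expSeries_div_hasSum_exp (𝔸 := ℂ) (z * x)

theorem HasMoments.unique [IsFiniteMeasure μ] {μ' : Measure ℝ} [IsFiniteMeasure μ']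
    (hμ : HasMoments μ β) (hμ' : HasMoments μ' β) (hg : GaussianGrowth β D) : μ = μ' :=
  Measure.ext_of_complexMGF_id_eq <| funext fun z =>
    (hμ.hasSum_complexMGF hg z).unique (hμ'.hasSum_complexMGF hg z)

theorem HasMoments.hasSubgaussianMGF {D : NNReal} (hμ : HasMoments μ β)
    (hg : GaussianGrowth β D) (hodd : ∀ h, Odd h → β h = 0) : HasSubgaussianMGF id D μ := by
  refine ⟨fun t => (hμ.integrable_exp_abs_mul hg t).mono' (by fun_prop)
    (ae_of_all _ fun x => ?_), fun t => ?_⟩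
  · rw [Real.norm_eq_abs, Real.abs_exp]
    exact Real.exp_le_exp.2 (le_abs_self _)
  have hmgf : HasSum (fun k : ℕ => t ^ k * β k / (k.factorial : ℝ)) (mgf id μ t) := by
    rw [← Complex.hasSum_ofReal, ← complexMGF_ofReal]
    simpa using hμ.hasSum_complexMGF hg (t : ℂ)
  have heven : HasSum (fun k : ℕ => t ^ (2 * k) * β (2 * k) / ((2 * k).factorial : ℝ))
      (mgf id μ t) := by
    refine ((mul_right_injective₀ (two_ne_zero' ℕ)).hasSum_iff
      (f := fun k : ℕ => t ^ k * β k / (k.factorial : ℝ)) fun k hk => ?_).2 hmgf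
    have hk : ¬ Even k := fun ⟨j, hj⟩ => hk ⟨j, (two_mul j).trans hj.symm⟩
    rw [hodd k (Nat.not_even_iff_odd.1 hk), mul_zero, zero_div]
  exact hasSum_le (hg.pow_mul_div_factorial_le t) heven (hasSum_pow_div_factorial _)

end GaussianGrowth

section MomentConvergence

variable {ν : ℕ → ProbabilityMeasure ℝ} {μ : ProbabilityMeasure ℝ} {β : ℕ → ℝ} {D : ℝ}

theorem HasMoments.tendsto_of_tendsto_moments (hμ : HasMoments μ β) (hg : GaussianGrowth β D)
    (hint : ∀ h n : ℕ, Integrable (fun t : ℝ => t ^ h) (ν n : Measure ℝ))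
    (hlim : ∀ h : ℕ, Tendsto (fun n => ∫ t, t ^ h ∂(ν n : Measure ℝ)) atTop (𝓝 (β h))) :
    Tendsto ν atTop (𝓝 μ) := by
  refine tendsto_of_subseq_tendsto fun φ hφ => ?_
  obtain ⟨μ', ψ, hψ, hμ'⟩ := exists_subseq_tendsto_hasMoments (fun h n => hint h (φ n))
    fun h => (hlim h).comp hφ
  obtain rfl : μ = μ' := Subtype.ext (hμ.unique (μ' := (μ' : Measure ℝ)) hμ' hg)
  exact ⟨ψ, hψ⟩

theorem tendsto_cdf_of_tendsto (hν : Tendsto ν atTop (𝓝 μ)) {t : ℝ}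
    (ht : ContinuousAt (cdf (μ : Measure ℝ)) t) :
    Tendsto (fun n => (ν n : Measure ℝ).real (Set.Iic t)) atTop (𝓝 (cdf (μ : Measure ℝ) t)) := by
  have hnull : (μ : Measure ℝ) (frontier (Set.Iic t)) = 0 := by
    conv_lhs => rw [frontier_Iic, ← measure_cdf (μ : Measure ℝ)]
    rw [StieltjesFunction.measure_singleton, ht.continuousWithinAt.leftLim_eq, sub_self,
      ENNReal.ofReal_zero]
  rw [cdf_eq_real]
  exact (ENNReal.tendsto_toReal (measure_ne_top _ _)).comp
    (ProbabilityMeasure.tendsto_measure_of_null_frontier_of_tendsto' hν hnull)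

theorem HasMoments.tendsto_cdf (hμ : HasMoments μ β) (hg : GaussianGrowth β D)
    (hint : ∀ h n : ℕ, Integrable (fun t : ℝ => t ^ h) (ν n : Measure ℝ))
    (hlim : ∀ h : ℕ, Tendsto (fun n => ∫ t, t ^ h ∂(ν n : Measure ℝ)) atTop (𝓝 (β h)))
    {t : ℝ} (ht : ContinuousAt (cdf (μ : Measure ℝ)) t) :
    Tendsto (fun n => (ν n : Measure ℝ).real (Set.Iic t)) atTop (𝓝 (cdf (μ : Measure ℝ) t)) :=
  tendsto_cdf_of_tendsto (hμ.tendsto_of_tendsto_moments hg hint hlim) ht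

/-- Compactness turns the sequential statement into one with finitely many moments, which can be
applied on an event of large probability. -/
theorem HasMoments.exists_abs_cdf_sub_lt (hμ : HasMoments μ β) (hg : GaussianGrowth β D) {t : ℝ}
    (ht : ContinuousAt (cdf (μ : Measure ℝ)) t) {ε : ℝ} (hε : 0 < ε) :
    ∃ (H : ℕ) (η : ℝ), 0 < η ∧ ∀ ν : ProbabilityMeasure ℝ,
      (∀ h, Integrable (fun s : ℝ => s ^ h) (ν : Measure ℝ)) →
      (∀ h < H, |∫ s, s ^ h ∂(ν : Measure ℝ) - β h| < η) →
      |(ν : Measure ℝ).real (Set.Iic t) - cdf (μ : Measure ℝ) t| < ε := by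
  by_contra! hcon
  choose ν hint hmom hfar using fun n : ℕ => hcon n (1 / ((n : ℝ) + 1)) (by positivity)
  have hlim (h : ℕ) : Tendsto (fun n => ∫ s, s ^ h ∂(ν n : Measure ℝ)) atTop (𝓝 (β h)) := by
    refine tendsto_iff_norm_sub_tendsto_zero.2 (squeeze_zero'
      (Eventually.of_forall fun _ => norm_nonneg _) ?_ tendsto_one_div_add_atTop_nhds_zero_nat)
    filter_upwards [eventually_gt_atTop h] with n hn using (hmom n h hn).le
  have hcdf := tendsto_iff_norm_sub_tendsto_zero.1
    (hμ.tendsto_cdf hg (fun h n => hint n h) hlim ht)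
  exact absurd (ge_of_tendsto' hcdf hfar) (not_le.2 hε)

end MomentConvergence

/-! ### The limit law -/

section EmpiricalSpectralDistribution

/-- The empirical spectral distribution of a nonempty symmetric matrix, as an element of the space
of probability measures. -/
noncomputable def esdProb {n : ℕ} (hn : n ≠ 0) {A : Matrix (Fin n) (Fin n) ℝ}
    (hA : A.IsHermitian) : ProbabilityMeasure ℝ :=
  ⟨esd A, isProbabilityMeasure_esd hn hA⟩

variable {A : (n : ℕ) → Matrix (Fin n) (Fin n) ℝ} {β : ℕ → ℝ}

theorem HasMoments.tendsto_esdCDF {μ : ProbabilityMeasure ℝ} {D : ℝ}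
    (hμ : HasMoments (μ : Measure ℝ) β) (hg : GaussianGrowth β D) (hA : ∀ n, (A n).IsHermitian)
    (hlim : ∀ h : ℕ, Tendsto (fun n => esdMoment h (A n)) atTop (𝓝 (β h))) {t : ℝ}
    (ht : ContinuousAt (cdf (μ : Measure ℝ)) t) :
    Tendsto (fun n => esdCDF (A n) t) atTop (𝓝 (cdf (μ : Measure ℝ) t)) :=
  (tendsto_add_atTop_iff_nat 1).1 <|
    hμ.tendsto_cdf hg (ν := fun n => esdProb n.succ_ne_zero (hA (n + 1)))
      (fun _ n => integrable_esd n.succ_ne_zero (hA (n + 1)) _)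
      (fun h => (tendsto_add_atTop_iff_nat 1).2 (hlim h)) ht

theorem exists_hasMoments_of_tendsto_esdMoment (hA : ∀ n, (A n).IsHermitian)
    (hlim : ∀ h : ℕ, Tendsto (fun n => esdMoment h (A n)) atTop (𝓝 (β h))) :
    ∃ μ : ProbabilityMeasure ℝ, HasMoments (μ : Measure ℝ) β :=
  let ⟨μ, _, _, hμ⟩ := exists_subseq_tendsto_hasMoments
    (ν := fun n => esdProb n.succ_ne_zero (hA (n + 1)))
    (fun _ n => integrable_esd n.succ_ne_zero (hA (n + 1)) _)
    fun h => (tendsto_add_atTop_iff_nat 1).2 (hlim h)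
  ⟨μ, hμ⟩

end EmpiricalSpectralDistribution

section LimitLaw

variable {ι κ : Type*}

theorem inputA3_of_measurePreserving_infinitePi {Ω : Type*} [MeasurableSpace Ω] {P : Measure Ω}
    {ν : Measure ℝ} [IsProbabilityMeasure ν] (hν : ∀ m : ℕ, MemLp id m ν)
    (hmean : ∫ t, t ∂ν = 0) (hvar : Var[id; ν] = 1) {x : ι → Ω → ℝ}
    (hx : MeasurePreserving (fun ω i => x i ω) P (Measure.infinitePi fun _ : ι => ν)) :
    InputA3 P x := by
  have : IsProbabilityMeasure P := hx.hasLaw.isProbabilityMeasure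
  have hxi (i : ι) : MeasurePreserving (x i) P ν :=
    (measurePreserving_eval_infinitePi (fun _ => ν) i).comp hx
  have hmem (i : ι) (m : ℕ) : MemLp (x i) m P := (hν m).comp_measurePreserving (hxi i)
  refine ⟨⟨fun i => (hxi i).measurable, ?_, fun i => mod_cast hmem i 2,
    fun i => (hxi i).hasLaw.integral_eq.trans hmean,
    fun i => (hxi i).hasLaw.variance_eq.trans hvar⟩, fun m => ⟨∫ t, |t| ^ m ∂ν, fun i => ⟨?_, ?_⟩⟩⟩
  · rw [iIndepFun_iff_map_fun_eq_infinitePi_map fun i => (hxi i).measurable, hx.map_eq]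
    simp only [(hxi _).map_eq]
  · exact (hmem i m).integrable_norm_pow'
  · exact ((hxi i).hasLaw.integral_comp (f := fun t => |t| ^ m)
      (by fun_prop : Measurable _).aestronglyMeasurable).le

theorem inputA3_gaussian {Ω : Type*} [MeasurableSpace Ω] {P : Measure Ω} {x : ι → Ω → ℝ}
    (hx : MeasurePreserving (fun ω i => x i ω) P
      (Measure.infinitePi fun _ : ι => gaussianReal 0 1)) : InputA3 P x :=
  inputA3_of_measurePreserving_infinitePi (fun m => mod_cast memLp_id_gaussianReal m)
    integral_id_gaussianReal (by simp [variance_id_gaussianReal]) hx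

variable {LX : Link ι} {LY : Link κ} {p : (h : ℕ) → Word h → Word h → ℝ}

theorem exists_hasMoments_limitMoment (hX : LX.IsSymm) (hY : LY.IsSymm) (hXB : LX.PropertyB)
    (hYB : LY.PropertyB) (hp : IsWordLimit LX LY p) :
    ∃ μ : ProbabilityMeasure ℝ, HasMoments (μ : Measure ℝ) (limitMoment p) := by
  let P : Measure (ι → ℝ) := Measure.infinitePi fun _ => gaussianReal 0 1
  let Q : Measure (κ → ℝ) := Measure.infinitePi fun _ => gaussianReal 0 1
  have hx : InputA3 (P.prod Q) fun i ω => ω.1 i := inputA3_gaussian measurePreserving_fst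
  have hy : InputA3 (P.prod Q) fun j ω => ω.2 j := inputA3_gaussian measurePreserving_snd
  have hxy := indepFun_prod (μ := P) (ν := Q) measurable_id measurable_id
  obtain ⟨ω, hω⟩ := (ae_tendsto_esdMoment (expectedMomentsTendsto hX hY hXB hYB hp hx hy hxy)
    (fourthMomentSummable hX hY hXB hYB hx hy hxy)).exists
  exact exists_hasMoments_of_tendsto_esdMoment
    (fun n => isHermitian_scaledProduct hX hY _ _ n ω) hω

theorem gaussianGrowth_limitMoment (hXB : LX.PropertyB) (hYB : LY.PropertyB)
    (hp : IsWordLimit LX LY p) :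
    GaussianGrowth (limitMoment p) ((min LX.Delta LY.Delta).toNat : ℝ) :=
  hp.limitMoment_le (rowBound_toNat_min_Delta hXB hYB)

end LimitLaw

section Carleman

theorem HasMoments.even_pos {μ : Measure ℝ} {β : ℕ → ℝ} (hμ : HasMoments μ β) (h2 : β 2 ≠ 0)
    (k : ℕ) : 0 < β (2 * k) := by
  have hnn : 0 ≤ᵐ[μ] fun t : ℝ => t ^ (2 * k) :=
    ae_of_all _ fun t => (even_two_mul k).pow_nonneg t
  refine (hμ.nonneg k).lt_of_ne fun h0 => h2 ?_
  rw [← (hμ (2 * k)).2, eq_comm, integral_eq_zero_iff_of_nonneg_ae hnn (hμ _).1] at h0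
  have hsq : (fun t : ℝ => t ^ 2) =ᵐ[μ] 0 := h0.mono fun t ht => by
    simp [eq_zero_of_pow_eq_zero (show t ^ (2 * k) = 0 from ht)]
  rw [← (hμ 2).2, integral_congr_ae hsq, Pi.zero_def, integral_zero]

theorem factorial_two_mul_div_le (k : ℕ) :
    ((2 * k).factorial : ℝ) / (2 ^ k * (k.factorial : ℝ)) ≤ (k : ℝ) ^ k := by
  rw [div_le_iff₀ (by positivity)]
  calc ((2 * k).factorial : ℝ) ≤ (2 * k) ^ k * k.factorial := mod_cast Nat.factorial_two_mul_le k
    _ = k ^ k * (2 ^ k * k.factorial) := by rw [mul_pow]; ring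

theorem GaussianGrowth.rpow_le {β : ℕ → ℝ} {D : ℝ} (hg : GaussianGrowth β D) (hD : 0 ≤ D) {k : ℕ}
    (hk : k ≠ 0) (hpos : 0 < β (2 * k)) :
    D ^ (-(1 : ℝ) / 2) * (k : ℝ) ^ (-(1 : ℝ) / 2) ≤ β (2 * k) ^ (-(1 : ℝ) / (2 * k)) := by
  have hle : β (2 * k) ≤ (D * k) ^ k := calc
    β (2 * k) ≤ k ^ k * D ^ k := (hg k).trans (by gcongr; exact factorial_two_mul_div_le k)
    _ = (D * k) ^ k := by rw [mul_pow, mul_comm]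
  calc D ^ (-(1 : ℝ) / 2) * (k : ℝ) ^ (-(1 : ℝ) / 2)
      = ((D * k) ^ k) ^ (-(1 : ℝ) / (2 * k)) := by
        rw [← Real.mul_rpow hD k.cast_nonneg, ← Real.rpow_natCast, ← Real.rpow_mul (by positivity)]
        congr 1
        field_simp
    _ ≤ β (2 * k) ^ (-(1 : ℝ) / (2 * k)) := Real.rpow_le_rpow_of_nonpos hpos hle
        (div_nonpos_of_nonpos_of_nonneg (by norm_num) (by positivity))

theorem GaussianGrowth.carleman {β : ℕ → ℝ} {D : ℝ} (hg : GaussianGrowth β D) (hD : 0 < D)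
    (hpos : ∀ k, 0 < β (2 * k)) : Carleman β := by
  intro hs
  have hle (h : ℕ) : D ^ (-(1 : ℝ) / 2) * ((h + 1 : ℕ) : ℝ) ^ (-(1 : ℝ) / 2) ≤
      β (2 * (h + 1)) ^ (-(1 : ℝ) / (2 * ((h : ℝ) + 1))) :=
    mod_cast hg.rpow_le hD.le h.succ_ne_zero (hpos (h + 1))
  have hsum := Summable.of_nonneg_of_le (fun h => by positivity) hle hs
  rw [summable_mul_left_iff (by positivity),
    summable_nat_add_iff (f := fun k : ℕ => (k : ℝ) ^ (-(1 : ℝ) / 2)) 1,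
    Real.summable_nat_rpow] at hsum
  norm_num at hsum

end Carleman

/-! ### Truncation -/

section Truncation

open scoped ENNReal

variable {Ω ι κ : Type*} [MeasurableSpace Ω] {P : Measure Ω} {x : ι → Ω → ℝ} {y : κ → Ω → ℝ}

theorem UniformMoments.uniformIntegrable (hx : UniformMoments P x) {q : ℝ≥0∞} (hq0 : q ≠ 0)
    (hq : q ≠ ∞) : UniformIntegrable x q P := by
  obtain ⟨C, hC, hxC⟩ := hx.exists_eLpNorm_le (2 * q) (ENNReal.mul_ne_top ENNReal.ofNat_ne_top hq)
  refine ⟨hx.aestronglyMeasurable, fun ε hε => ?_, ?_⟩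
  · set r := 1 / q.toReal - 1 / (2 * q).toReal with hr
    have hr0 : 0 < r := by
      rw [hr, ENNReal.toReal_mul, ENNReal.toReal_ofNat, sub_pos]
      have := ENNReal.toReal_pos hq0 hq
      exact one_div_lt_one_div_of_lt this (by linarith)
    have hδ : 0 < ε / (C.toReal + 1) := by positivity
    refine ⟨(ε / (C.toReal + 1)) ^ r⁻¹, by positivity, fun i s hs hsδ => ?_⟩
    rw [eLpNorm_indicator_eq_eLpNorm_restrict hs]
    calc eLpNorm (x i) q (P.restrict s)
        ≤ eLpNorm (x i) (2 * q) (P.restrict s) * P.restrict s Set.univ ^ r :=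
          eLpNorm_le_eLpNorm_mul_rpow_measure_univ (le_mul_of_one_le_left' one_le_two)
            (hx.aestronglyMeasurable i).restrict
      _ ≤ C * ENNReal.ofReal ((ε / (C.toReal + 1)) ^ r⁻¹) ^ r := by
          rw [Measure.restrict_apply_univ]
          gcongr
          exact (eLpNorm_mono_measure _ Measure.restrict_le_self).trans (hxC i)
      _ = ENNReal.ofReal (C.toReal * (ε / (C.toReal + 1))) := by
          rw [ENNReal.ofReal_rpow_of_pos (by positivity), Real.rpow_inv_rpow hδ.le hr0.ne',
            ENNReal.ofReal_mul ENNReal.toReal_nonneg, ENNReal.ofReal_toReal hC]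
      _ ≤ ENNReal.ofReal ε := by
          refine ENNReal.ofReal_le_ofReal ?_
          rw [mul_div_assoc', div_le_iff₀ (by positivity)]
          nlinarith
  · obtain ⟨C, hC, hxC⟩ := hx.exists_eLpNorm_le q hq
    exact ⟨C.toNNReal, fun i => (hxC i).trans (ENNReal.coe_toNNReal hC).ge⟩

theorem eLpNorm_sub_truncation_le (X : Ω → ℝ) (C : NNReal) (q : ℝ≥0∞) :
    eLpNorm (X - truncation X C) q P ≤ eLpNorm ({ω | C ≤ ‖X ω‖₊}.indicator X) q P := by
  refine eLpNorm_mono fun ω => ?_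
  by_cases h : C ≤ ‖X ω‖₊
  · rw [Set.indicator_of_mem (by exact h), Pi.sub_apply, Real.norm_eq_abs, Real.norm_eq_abs]
    simp only [truncation, Function.comp_apply, Set.indicator_apply, id]
    split_ifs <;> simp
  · rw [Pi.sub_apply, truncation_eq_self (by simpa [← NNReal.coe_lt_coe] using h)]
    simp

theorem integral_sq_mul_sub_mul_le {X X' Y Y' : Ω → ℝ} (hX : MemLp X 2 P) (hX' : MemLp X' 2 P)
    (hY : MemLp Y 2 P) (hY' : MemLp Y' 2 P) (h : IndepFun (X - X') Y P)
    (h' : IndepFun X' (Y - Y') P) :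
    Integrable (fun ω => (X ω * Y ω - X' ω * Y' ω) ^ 2) P ∧
      ∫ ω, (X ω * Y ω - X' ω * Y' ω) ^ 2 ∂P ≤
        2 * ((∫ ω, (X ω - X' ω) ^ 2 ∂P) * ∫ ω, Y ω ^ 2 ∂P) +
          2 * ((∫ ω, X' ω ^ 2 ∂P) * ∫ ω, (Y ω - Y' ω) ^ 2 ∂P) := by
  have hsq : Measurable fun t : ℝ => t ^ 2 := measurable_id.pow_const 2
  have hi := (h.comp hsq hsq).integrable_mul (hX.sub hX').integrable_sq hY.integrable_sq
  have hi' := (h'.comp hsq hsq).integrable_mul hX'.integrable_sq (hY.sub hY').integrable_sq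
  have hle : ∀ ω, (X ω * Y ω - X' ω * Y' ω) ^ 2 ≤
      2 * ((X ω - X' ω) ^ 2 * Y ω ^ 2) + 2 * (X' ω ^ 2 * (Y ω - Y' ω) ^ 2) := fun ω => by
    nlinarith [sq_nonneg ((X ω - X' ω) * Y ω - X' ω * (Y ω - Y' ω))]
  have hint : Integrable (fun ω => (X ω * Y ω - X' ω * Y' ω) ^ 2) P := by
    refine ((hi.const_mul 2).add (hi'.const_mul 2)).mono'
      (((hX.1.mul hY.1).sub (hX'.1.mul hY'.1)).pow 2) (ae_of_all _ fun ω => ?_)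
    rw [Real.norm_eq_abs, abs_of_nonneg (sq_nonneg _)]
    exact hle ω
  refine ⟨hint, (integral_mono hint ((hi.const_mul 2).add (hi'.const_mul 2)) hle).trans_eq ?_⟩
  refine (integral_add (hi.const_mul 2) (hi'.const_mul 2)).trans ?_
  rw [integral_const_mul, integral_const_mul]
  congr 2
  · exact (h.comp hsq hsq).integral_fun_mul_eq_mul_integral
      ((hX.sub hX').1.pow 2) (hY.1.pow 2)
  · exact (h'.comp hsq hsq).integral_fun_mul_eq_mul_integral
      (hX'.1.pow 2) ((hY.sub hY').1.pow 2)

/-- The truncation of `X` at level `C`, centred and rescaled to variance `1`, as a function of the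
value of `X`. It is junk unless the truncation has positive variance. -/
noncomputable def stdTruncation (P : Measure Ω) (X : Ω → ℝ) (C s : ℝ) : ℝ :=
  (√(variance (truncation X C) P))⁻¹ * (truncation id C s - ∫ ω, truncation X C ω ∂P)

theorem measurable_stdTruncation (X : Ω → ℝ) (C : ℝ) : Measurable (stdTruncation P X C) :=
  (((measurable_id.indicator measurableSet_Ioc).comp measurable_id).sub_const _).const_mul _

variable [IsProbabilityMeasure P]

theorem InputA2.uniformIntegrable (hx : InputA2 P x) : UniformIntegrable x 2 P := by
  rcases isEmpty_or_nonempty ι with hι | ⟨⟨i⟩⟩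
  · exact ⟨isEmptyElim, fun _ _ => ⟨1, one_pos, isEmptyElim⟩, 0, isEmptyElim⟩
  · exact MemLp.uniformIntegrable_of_identDistrib one_le_two ENNReal.ofNat_ne_top (hx.1.memLp i)
      fun j => hx.2 j i

theorem InputA3.uniformIntegrable (hx : InputA3 P x) : UniformIntegrable x 2 P :=
  hx.uniformMoments.uniformIntegrable two_ne_zero ENNReal.ofNat_ne_top

theorem variance_le_sq_of_eLpNorm_le {X : Ω → ℝ} (hX : MemLp X 2 P) {δ : ℝ} (hδ : 0 ≤ δ)
    (h : eLpNorm X 2 P ≤ ENNReal.ofReal δ) : variance X P ≤ δ ^ 2 := by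
  refine (variance_le_expectation_sq hX.1).trans ?_
  rw [hX.eLpNorm_eq_integral_rpow_norm two_ne_zero ENNReal.ofNat_ne_top,
    ENNReal.ofReal_le_ofReal_iff hδ, ENNReal.toReal_ofNat, ← one_div, ← Real.sqrt_eq_rpow,
    Real.sqrt_le_left hδ] at h
  simpa using h

theorem exists_variance_sub_truncation_le (hx : UniformIntegrable x 2 P) {δ : ℝ} (hδ : 0 < δ) :
    ∃ C : ℝ, ∀ i, variance (x i - truncation (x i) C) P ≤ δ := by
  obtain ⟨C, hC⟩ := hx.spec two_ne_zero ENNReal.ofNat_ne_top (Real.sqrt_pos.2 hδ)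
  refine ⟨C, fun i => ?_⟩
  rw [← Real.sq_sqrt hδ.le]
  exact variance_le_sq_of_eLpNorm_le ((hx.memLp i).sub (hx.1 i).memLp_truncation)
    (Real.sqrt_nonneg δ) ((eLpNorm_sub_truncation_le _ C 2).trans (hC i))

theorem variance_sub_smul {X T : Ω → ℝ} (hX : MemLp X 2 P) (hT : MemLp T 2 P) (c : ℝ) :
    variance (X - c • T) P = variance X P - 2 * c * cov[X, T; P] + c ^ 2 * variance T P := by
  rw [variance_sub hX (hT.const_smul c), variance_smul, covariance_smul_right]
  ring

theorem quarter_le_variance {X T : Ω → ℝ} (hX : MemLp X 2 P) (hT : MemLp T 2 P)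
    (hX1 : variance X P = 1) (h : variance (X - T) P ≤ 1 / 4) : 1 / 4 ≤ variance T P := by
  have h1 := variance_sub_smul hX hT 1
  have h2 := variance_sub_smul hX hT 2
  rw [one_smul] at h1
  linarith [variance_nonneg (X - (2 : ℝ) • T) P]

theorem variance_sub_standardize_le {X T : Ω → ℝ} (hX : MemLp X 2 P) (hT : MemLp T 2 P)
    (hX1 : variance X P = 1) (h : variance (X - T) P ≤ 1 / 4) :
    variance (X - (√(variance T P))⁻¹ • T) P ≤ 2 * variance (X - T) P := by
  have h1 := variance_sub_smul hX hT 1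
  have hv := quarter_le_variance hX hT hX1 h
  rw [variance_sub_smul hX hT, hX1]
  rw [one_smul, hX1] at h1
  set σ := √(variance T P)
  have hσ2 : σ ^ 2 = variance T P := Real.sq_sqrt (by linarith)
  have hσ : 1 / 2 ≤ σ := Real.le_sqrt_of_sq_le (by linarith)
  have hquot : 1 - 2 * σ⁻¹ * cov[X, T; P] + σ⁻¹ ^ 2 * variance T P =
      (2 * σ - 2 * cov[X, T; P]) / σ := by
    rw [← hσ2]
    field_simp
    ring
  rw [hquot, div_le_iff₀ (by linarith)]
  nlinarith [sq_nonneg (σ - 1), variance_nonneg (X - T) P]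

theorem abs_stdTruncation_le {X : Ω → ℝ} {C : ℝ} (hv : 1 / 4 ≤ variance (truncation X C) P)
    (s : ℝ) : |stdTruncation P X C s| ≤ 2 * (|C| + |C|) := by
  have hσ : 1 / 2 ≤ √(variance (truncation X C) P) := Real.le_sqrt_of_sq_le (by linarith)
  rw [stdTruncation, abs_mul, abs_inv, abs_of_pos (by linarith)]
  gcongr
  · exact inv_le_of_inv_le₀ two_pos (by linarith)
  · refine (abs_sub _ _).trans (add_le_add (abs_truncation_le_bound _ _ _) ?_)
    have := norm_integral_le_of_norm_le_const (μ := P) (f := truncation X C) (C := |C|)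
      (ae_of_all _ fun ω => abs_truncation_le_bound X C ω)
    simpa using this

section Standardized

variable {X : Ω → ℝ} {C : ℝ}

theorem integral_stdTruncation (hX : Measurable X) :
    ∫ ω, stdTruncation P X C (X ω) ∂P = 0 := by
  have hT := hX.aestronglyMeasurable.integrable_truncation (μ := P) (A := C)
  change ∫ ω, _ * (truncation X C ω - _) ∂P = 0
  rw [integral_const_mul, integral_sub hT (integrable_const _)]
  simp

theorem variance_stdTruncation (hX : Measurable X) (hv : 0 < variance (truncation X C) P) :
    variance (fun ω => stdTruncation P X C (X ω)) P = 1 := by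
  change variance (fun ω => _ * (truncation X C ω - _)) P = 1
  rw [variance_const_mul, variance_sub_const hX.aestronglyMeasurable.truncation, inv_pow,
    Real.sq_sqrt hv.le, inv_mul_cancel₀ hv.ne']

theorem integral_sq_sub_stdTruncation_le (hX : Measurable X) (hX2 : MemLp X 2 P)
    (hX0 : ∫ ω, X ω ∂P = 0) (hX1 : variance X P = 1)
    (h : variance (X - truncation X C) P ≤ 1 / 4) :
    ∫ ω, (X ω - stdTruncation P X C (X ω)) ^ 2 ∂P ≤ 2 * variance (X - truncation X C) P := by
  have hT : MemLp (truncation X C) 2 P := hX.aestronglyMeasurable.memLp_truncation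
  set c := (√(variance (truncation X C) P))⁻¹
  have hsub : (fun ω => X ω - stdTruncation P X C (X ω)) =
      fun ω => (X - c • truncation X C) ω + c * ∫ ω', truncation X C ω' ∂P := by
    ext ω
    change X ω - c * (truncation X C ω - _) = X ω - c * truncation X C ω + _
    ring
  have hXT : MemLp (X - c • truncation X C) 2 P := hX2.sub (hT.const_smul c)
  have hsub0 : ∫ ω, (X ω - stdTruncation P X C (X ω)) ∂P = 0 := by
    rw [integral_sub (hX2.integrable one_le_two), hX0, integral_stdTruncation hX, sub_zero]
    exact ((hT.integrable one_le_two).sub (integrable_const _)).const_mul _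
  rw [← variance_of_integral_eq_zero (X := fun ω => X ω - stdTruncation P X C (X ω))
    (hX.sub ((measurable_stdTruncation X C).comp hX)).aemeasurable hsub0, hsub,
    variance_add_const hXT.1]
  exact variance_sub_standardize_le hX2 hT hX1 h

end Standardized

theorem exists_inputA1_approx (hx : StandardInput P x) (hui : UniformIntegrable x 2 P) {ε : ℝ}
    (hε : 0 < ε) : ∃ g : ι → ℝ → ℝ, (∀ i, Measurable (g i)) ∧
      InputA1 P (fun i ω => g i (x i ω)) ∧ ∀ i, ∫ ω, (x i ω - g i (x i ω)) ^ 2 ∂P ≤ ε := by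
  obtain ⟨C, hC⟩ := exists_variance_sub_truncation_le hui
    (show (0 : ℝ) < min (ε / 2) (1 / 4) by positivity)
  have hC4 := fun i => (hC i).trans (min_le_right _ _)
  have hv := fun i => quarter_le_variance (hx.memLp i)
    (hx.measurable i).aestronglyMeasurable.memLp_truncation (hx.variance_one i) (hC4 i)
  have hg := fun i => measurable_stdTruncation (P := P) (x i) C
  have hgx := fun i => (hg i).comp (hx.measurable i)
  have hbound := fun i ω => abs_stdTruncation_le (hv i) (x i ω)
  refine ⟨fun i => stdTruncation P (x i) C, hg,
    ⟨⟨hgx, hx.indep.comp _ hg, fun i => ?_, fun i => integral_stdTruncation (hx.measurable i),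
      fun i => variance_stdTruncation (hx.measurable i) (by linarith [hv i])⟩, _,
      fun i => ae_of_all _ (hbound i)⟩, fun i => ?_⟩
  · exact MemLp.of_bound (hgx i).aestronglyMeasurable _ (ae_of_all _ (hbound i))
  · refine (integral_sq_sub_stdTruncation_le (hx.measurable i) (hx.memLp i) (hx.mean_zero i)
      (hx.variance_one i) (hC4 i)).trans ?_
    linarith [(hC i).trans (min_le_left _ _)]

end Truncation

/-! ### Convergence in probability -/

section InProbability

variable {Ω : Type*} [MeasurableSpace Ω] {P : Measure Ω}
  {A : (n : ℕ) → Ω → Matrix (Fin n) (Fin n) ℝ}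

theorem HasMoments.lsdInProbability [IsFiniteMeasure P] {μ : ProbabilityMeasure ℝ} {β : ℕ → ℝ}
    {D : ℝ} (hμ : HasMoments μ β) (hg : GaussianGrowth β D) (hA : ∀ n ω, (A n ω).IsHermitian)
    (hlim : ∀ h, TendstoInMeasure P (fun n ω => esdMoment h (A n ω)) atTop fun _ => β h) :
    LSDInProbability P A μ := by
  intro t ht
  refine tendstoInMeasure_iff_measureReal_norm.2 fun ε hε => ?_
  obtain ⟨H, η, hη, hclose⟩ := hμ.exists_abs_cdf_sub_lt hg ht hε
  have hsum := tendsto_finsetSum (Finset.range H) fun h _ =>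
    tendstoInMeasure_iff_measureReal_norm.1 (hlim h) η hη
  rw [Finset.sum_const_zero] at hsum
  refine squeeze_zero' (Eventually.of_forall fun n => measureReal_nonneg) ?_ hsum
  filter_upwards [eventually_ne_atTop 0] with n hn
  refine (measureReal_mono (fun ω hω => ?_) (measure_ne_top _ _)).trans
    (measureReal_biUnion_finset_le _ _)
  by_contra hcon
  simp only [Set.mem_iUnion, Finset.mem_range, Set.mem_ofPred_eq, exists_prop, not_exists, not_and,
    not_le, Real.norm_eq_abs] at hcon
  exact (hclose (esdProb hn (hA n ω)) (fun h => integrable_esd hn (hA n ω) _) hcon).not_ge hω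

theorem exists_continuousAt_cdf (μ : Measure ℝ) {a b : ℝ} (hab : a < b) :
    ∃ s ∈ Set.Ioo a b, ContinuousAt (cdf μ) s := by
  obtain ⟨s, hs, hs'⟩ :=
    ((monotone_cdf μ).countable_not_continuousAt.dense_compl ℝ).exists_between hab
  exact ⟨s, hs', not_not.1 hs⟩

theorem exists_abs_esdCDF_sub_lt {μ : Measure ℝ} {t : ℝ} (ht : ContinuousAt (cdf μ) t) {ε : ℝ}
    (hε : 0 < ε) : ∃ s₁ s₂ c : ℝ, ContinuousAt (cdf μ) s₁ ∧ ContinuousAt (cdf μ) s₂ ∧ 0 < c ∧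
      ∀ {n : ℕ} {A B : Matrix (Fin n) (Fin n) ℝ}, A.IsHermitian → B.IsHermitian →
        |esdCDF B s₁ - cdf μ s₁| < ε / 4 → |esdCDF B s₂ - cdf μ s₂| < ε / 4 →
        frobeniusDistSq A B < c → |esdCDF A t - cdf μ t| < ε := by
  obtain ⟨δ, hδ, hnear⟩ := Metric.continuousAt_iff.1 ht (ε / 4) (by positivity)
  simp only [Real.dist_eq] at hnear
  obtain ⟨s₁, ⟨hs₁, hs₁'⟩, hc₁⟩ := exists_continuousAt_cdf μ (sub_lt_self t hδ)
  obtain ⟨s₂, ⟨hs₂, hs₂'⟩, hc₂⟩ := exists_continuousAt_cdf μ (lt_add_of_pos_right t hδ)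
  have h₁ := abs_lt.1 (hnear (x := s₁) (by rw [abs_lt]; constructor <;> linarith))
  have h₂ := abs_lt.1 (hnear (x := s₂) (by rw [abs_lt]; constructor <;> linarith))
  have hδ₁ : 0 < t - s₁ := by linarith
  have hδ₂ : 0 < s₂ - t := by linarith
  refine ⟨s₁, s₂, min (ε / 4 * (t - s₁) ^ 2) (ε / 4 * (s₂ - t) ^ 2), hc₁, hc₂, by positivity,
    fun {n A B} hA hB hB₁ hB₂ hAB => ?_⟩
  have hl := esdCDF_le hB hA s₁ hδ₁
  have hu := esdCDF_le hA hB t hδ₂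
  rw [add_sub_cancel, frobeniusDistSq_comm] at hl
  rw [add_sub_cancel] at hu
  have hd₁ := (div_lt_iff₀ (pow_pos hδ₁ 2)).2 (hAB.trans_le (min_le_left _ _))
  have hd₂ := (div_lt_iff₀ (pow_pos hδ₂ 2)).2 (hAB.trans_le (min_le_right _ _))
  rw [abs_lt] at hB₁ hB₂ ⊢
  constructor <;> linarith

theorem LSDInProbability.of_frobeniusDistSq [IsFiniteMeasure P] {μ : Measure ℝ}
    (hA : ∀ n ω, (A n ω).IsHermitian)
    (happrox : ∀ θ > 0, ∃ B : (n : ℕ) → Ω → Matrix (Fin n) (Fin n) ℝ,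
      (∀ n ω, (B n ω).IsHermitian) ∧ LSDInProbability P B μ ∧
      ∀ n, Integrable (fun ω => frobeniusDistSq (A n ω) (B n ω)) P ∧
        ∫ ω, frobeniusDistSq (A n ω) (B n ω) ∂P ≤ θ) :
    LSDInProbability P A μ := by
  intro t ht
  refine tendstoInMeasure_iff_measureReal_norm.2 fun ε hε => ?_
  obtain ⟨s₁, s₂, c, hs₁, hs₂, hc, hclose⟩ := exists_abs_esdCDF_sub_lt ht hε
  refine Metric.tendsto_atTop.2 fun θ hθ => ?_
  obtain ⟨B, hB, hBμ, hAB⟩ := happrox (c * (θ / 2)) (by positivity)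
  have hlim := (tendstoInMeasure_iff_measureReal_norm.1 (hBμ s₁ hs₁) (ε / 4) (by positivity)).add
    (tendstoInMeasure_iff_measureReal_norm.1 (hBμ s₂ hs₂) (ε / 4) (by positivity))
  rw [add_zero] at hlim
  obtain ⟨N, hN⟩ := (hlim.eventually_lt_const (half_pos hθ)).exists_forall_of_atTop
  refine ⟨N, fun n hn => ?_⟩
  rw [Real.dist_eq, sub_zero, abs_of_nonneg measureReal_nonneg]
  have markov : P.real {ω | c ≤ frobeniusDistSq (A n ω) (B n ω)} ≤ θ / 2 :=
    le_of_mul_le_mul_left ((mul_meas_ge_le_integral_of_nonneg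
      (ae_of_all _ fun ω => frobeniusDistSq_nonneg _ _) (hAB n).1 c).trans (hAB n).2) hc
  have hsub : {ω | ε ≤ ‖esdCDF (A n ω) t - cdf μ t‖} ⊆
      ({ω | ε / 4 ≤ ‖esdCDF (B n ω) s₁ - cdf μ s₁‖} ∪
        {ω | ε / 4 ≤ ‖esdCDF (B n ω) s₂ - cdf μ s₂‖}) ∪
      {ω | c ≤ frobeniusDistSq (A n ω) (B n ω)} := fun ω hω => by
    by_contra hcon
    simp only [Set.mem_union, Set.mem_ofPred_eq, not_or, not_le] at hcon
    exact (hclose (hA n ω) (hB n ω) hcon.1.1 hcon.1.2 hcon.2).not_ge hω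
  calc P.real {ω | ε ≤ ‖esdCDF (A n ω) t - cdf μ t‖}
      ≤ _ := (measureReal_mono hsub).trans (measureReal_union_le _ _)
    _ ≤ _ := add_le_add (measureReal_union_le _ _) markov
    _ < θ / 2 + θ / 2 := by gcongr; exact hN n hn
    _ = θ := add_halves θ

end InProbability

section Product

variable {Ω ι κ : Type*} {LX : Link ι} {LY : Link κ}

theorem frobeniusDistSq_scaledProduct (x x' : ι → Ω → ℝ) (y y' : κ → Ω → ℝ) (n : ℕ) (ω : Ω) :
    frobeniusDistSq (scaledProduct LX LY x y n ω) (scaledProduct LX LY x' y' n ω) =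
      (n : ℝ)⁻¹ * ((n : ℝ)⁻¹ * ∑ i, ∑ j, (x (LX n i j) ω * y (LY n i j) ω -
        x' (LX n i j) ω * y' (LY n i j) ω) ^ 2) := by
  simp only [frobeniusDistSq, scaledProduct, patterned, Matrix.smul_apply, Matrix.hadamard_apply,
    Matrix.of_apply, smul_eq_mul, ← mul_sub, mul_pow, inv_pow, Real.sq_sqrt (Nat.cast_nonneg n),
    ← Finset.mul_sum]

variable [MeasurableSpace Ω] {P : Measure Ω} {x x' : ι → Ω → ℝ} {y y' : κ → Ω → ℝ}

theorem integral_frobeniusDistSq_le {c : ℝ} (hc : 0 ≤ c) (h : ∀ i j,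
      Integrable (fun ω => (x i ω * y j ω - x' i ω * y' j ω) ^ 2) P ∧
        ∫ ω, (x i ω * y j ω - x' i ω * y' j ω) ^ 2 ∂P ≤ c) (n : ℕ) :
    Integrable (fun ω => frobeniusDistSq (scaledProduct LX LY x y n ω)
        (scaledProduct LX LY x' y' n ω)) P ∧
      ∫ ω, frobeniusDistSq (scaledProduct LX LY x y n ω)
        (scaledProduct LX LY x' y' n ω) ∂P ≤ c := by
  simp only [frobeniusDistSq_scaledProduct]
  have hrow := fun i => integrable_finsetSum Finset.univ fun j _ => (h (LX n i j) (LY n i j)).1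
  refine ⟨((integrable_finsetSum _ fun i _ => hrow i).const_mul _).const_mul _, ?_⟩
  rw [integral_const_mul, integral_const_mul, integral_finsetSum _ fun i _ => hrow i]
  simp_rw [integral_finsetSum _ fun j _ => (h (LX n _ j) (LY n _ j)).1]
  calc (n : ℝ)⁻¹ * ((n : ℝ)⁻¹ * ∑ i, ∑ j, ∫ ω, (x (LX n i j) ω * y (LY n i j) ω -
        x' (LX n i j) ω * y' (LY n i j) ω) ^ 2 ∂P)
      ≤ (n : ℝ)⁻¹ * ((n : ℝ)⁻¹ * ∑ _i : Fin n, ∑ _j : Fin n, c) := by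
        gcongr
        exact (h _ _).2
    _ = ((n : ℝ)⁻¹ * n) * (((n : ℝ)⁻¹ * n) * c) := by
        simp only [Finset.sum_const, Finset.card_univ, Fintype.card_fin, nsmul_eq_mul]
        ring
    _ ≤ 1 * (1 * c) := by
        gcongr <;> exact inv_mul_le_one
    _ = c := by ring

variable [IsProbabilityMeasure P]

theorem exists_inputA1_approx_product (hx : StandardInput P x) (hy : StandardInput P y)
    (hxui : UniformIntegrable x 2 P) (hyui : UniformIntegrable y 2 P)
    (hxy : IndepFun (fun ω i => x i ω) (fun ω j => y j ω) P) {ε : ℝ} (hε : 0 < ε) :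
    ∃ (x' : ι → Ω → ℝ) (y' : κ → Ω → ℝ), InputA1 P x' ∧ InputA1 P y' ∧
      IndepFun (fun ω i => x' i ω) (fun ω j => y' j ω) P ∧ ∀ i j,
        Integrable (fun ω => (x i ω * y j ω - x' i ω * y' j ω) ^ 2) P ∧
          ∫ ω, (x i ω * y j ω - x' i ω * y' j ω) ^ 2 ∂P ≤ ε := by
  obtain ⟨g, hg, hgx, hgε⟩ := exists_inputA1_approx hx hxui (show 0 < ε / 4 by positivity)
  obtain ⟨k, hk, hky, hkε⟩ := exists_inputA1_approx hy hyui (show 0 < ε / 4 by positivity)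
  have hg' : Measurable fun (z : ι → ℝ) i => g i (z i) :=
    measurable_pi_lambda _ fun i => (hg i).comp (measurable_pi_apply i)
  have hk' : Measurable fun (z : κ → ℝ) j => k j (z j) :=
    measurable_pi_lambda _ fun j => (hk j).comp (measurable_pi_apply j)
  refine ⟨_, _, hgx, hky, hxy.comp hg' hk', fun i j => ?_⟩
  have indep_left : IndepFun (x i - fun ω => g i (x i ω)) (y j) P :=
    hxy.comp ((measurable_pi_apply i).sub ((hg i).comp (measurable_pi_apply i)))
      (measurable_pi_apply j)
  have indep_right : IndepFun (fun ω => g i (x i ω)) (y j - fun ω => k j (y j ω)) P :=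
    hxy.comp ((hg i).comp (measurable_pi_apply i))
      ((measurable_pi_apply j).sub ((hk j).comp (measurable_pi_apply j)))
  have hprod := integral_sq_mul_sub_mul_le (hx.memLp i) (hgx.1.memLp i) (hy.memLp j)
    (hky.1.memLp j) indep_left indep_right
  rw [hy.integral_sq, hgx.1.integral_sq] at hprod
  exact ⟨hprod.1, hprod.2.trans (by linarith [hgε i, hkε j])⟩

variable {p : (h : ℕ) → Word h → Word h → ℝ} {μ : ProbabilityMeasure ℝ}

theorem InputA3.lsdAlmostSurely (hX : LX.IsSymm) (hY : LY.IsSymm) (hXB : LX.PropertyB)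
    (hYB : LY.PropertyB) (hp : IsWordLimit LX LY p) (hμ : HasMoments μ (limitMoment p))
    (hx : InputA3 P x) (hy : InputA3 P y)
    (hxy : IndepFun (fun ω i => x i ω) (fun ω j => y j ω) P) :
    LSDAlmostSurely P (scaledProduct LX LY x y) μ := by
  filter_upwards [ae_tendsto_esdMoment (expectedMomentsTendsto hX hY hXB hYB hp hx hy hxy)
    (fourthMomentSummable hX hY hXB hYB hx hy hxy)] with ω hω t ht
  exact hμ.tendsto_esdCDF (gaussianGrowth_limitMoment hXB hYB hp)
    (fun n => isHermitian_scaledProduct hX hY x y n ω) hω ht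

theorem InputA3.lsdInProbability (hX : LX.IsSymm) (hY : LY.IsSymm) (hXB : LX.PropertyB)
    (hYB : LY.PropertyB) (hp : IsWordLimit LX LY p) (hμ : HasMoments μ (limitMoment p))
    (hx : InputA3 P x) (hy : InputA3 P y)
    (hxy : IndepFun (fun ω i => x i ω) (fun ω j => y j ω) P) :
    LSDInProbability P (scaledProduct LX LY x y) μ := by
  refine hμ.lsdInProbability (gaussianGrowth_limitMoment hXB hYB hp)
    (fun n ω => isHermitian_scaledProduct hX hY x y n ω) fun h =>
    tendstoInMeasure_of_tendsto_ae
      (fun n => (memLp_esdMoment hX hY hx hy h n ENNReal.one_ne_top).aestronglyMeasurable) ?_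
  filter_upwards [ae_tendsto_esdMoment (expectedMomentsTendsto hX hY hXB hYB hp hx hy hxy)
    (fourthMomentSummable hX hY hXB hYB hx hy hxy)] with ω hω using hω h

theorem StandardInput.lsdInProbability (hX : LX.IsSymm) (hY : LY.IsSymm) (hXB : LX.PropertyB)
    (hYB : LY.PropertyB) (hp : IsWordLimit LX LY p) (hμ : HasMoments μ (limitMoment p))
    (hx : StandardInput P x) (hy : StandardInput P y) (hxui : UniformIntegrable x 2 P)
    (hyui : UniformIntegrable y 2 P) (hxy : IndepFun (fun ω i => x i ω) (fun ω j => y j ω) P) :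
    LSDInProbability P (scaledProduct LX LY x y) μ := by
  refine .of_frobeniusDistSq (fun n ω => isHermitian_scaledProduct hX hY x y n ω) fun θ hθ => ?_
  obtain ⟨x', y', hx', hy', hxy', hdist⟩ := exists_inputA1_approx_product hx hy hxui hyui hxy hθ
  exact ⟨scaledProduct LX LY x' y', fun n ω => isHermitian_scaledProduct hX hY x' y' n ω,
    hx'.inputA3.lsdInProbability hX hY hXB hYB hp hμ hy'.inputA3 hxy',
    integral_frobeniusDistSq_le hθ.le hdist⟩

end Product

end SchurHadamard

open SchurHadamard in
theorem mainTheorem1_general {ι : Type*} {κ : Type*} (LX : Link ι) (LY : Link κ)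
    (hXsymm : LX.IsSymm) (hYsymm : LY.IsSymm)
    (hXB : LX.PropertyB) (hYB : LY.PropertyB)
    (p : (h : ℕ) → Word h → Word h → ℝ) (hp : IsWordLimit LX LY p) :
    (∀ k : ℕ, limitMoment p (2 * k) ≤
      ((2 * k).factorial : ℝ) / (2 ^ k * (k.factorial : ℝ)) *
        ((min LX.Delta LY.Delta).toNat : ℝ) ^ k) ∧
    Carleman (limitMoment p) ∧
    ∃ μ : Measure ℝ, IsProbabilityMeasure μ ∧
      (∀ h : ℕ, Integrable (fun t : ℝ => t ^ h) μ ∧ ∫ t, t ^ h ∂μ = limitMoment p h) ∧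
      (∃ c : NNReal, HasSubgaussianMGF id c μ) ∧
      ∀ (Ω : Type*) [MeasurableSpace Ω] (P : Measure Ω) [IsProbabilityMeasure P]
        (x : ι → Ω → ℝ) (y : κ → Ω → ℝ),
        IndepFun (fun ω i => x i ω) (fun ω j => y j ω) P →
        (InputA3 P x → InputA3 P y →
          ExpectedMomentsTendsto P (scaledProduct LX LY x y) (limitMoment p) ∧
          FourthMomentSummable P (scaledProduct LX LY x y) ∧
          LSDAlmostSurely P (scaledProduct LX LY x y) μ) ∧
        (StandardInput P x → StandardInput P y →
          UniformIntegrable x 2 P → UniformIntegrable y 2 P →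
          LSDInProbability P (scaledProduct LX LY x y) μ) := by
  have hg := gaussianGrowth_limitMoment hXB hYB hp
  obtain ⟨μ, hμ⟩ := exists_hasMoments_limitMoment hXsymm hYsymm hXB hYB hp
  have hD : (0 : ℝ) < (min LX.Delta LY.Delta).toNat := by
    exact_mod_cast (rowBound_toNat_min_Delta hXB hYB).elim (·.one_le) (·.one_le)
  have htwo : limitMoment p 2 ≠ 0 := by
    rw [hp.limitMoment_two hXsymm hYsymm]
    exact one_ne_zero
  refine ⟨hg, hg.carleman hD (hμ.even_pos htwo), μ, inferInstance, hμ,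
    ⟨((min LX.Delta LY.Delta).toNat : NNReal), hμ.hasSubgaussianMGF (by simpa using hg)
      fun h hh => if_pos hh⟩, fun Ω _ P _ x y hxy => ⟨fun hx hy => ⟨?_, ?_, ?_⟩,
        fun hx hy hxui hyui => ?_⟩⟩
  · exact expectedMomentsTendsto hXsymm hYsymm hXB hYB hp hx hy hxy
  · exact fourthMomentSummable hXsymm hYsymm hXB hYB hx hy hxy
  · exact hx.lsdAlmostSurely hXsymm hYsymm hXB hYB hp hμ hy hxy
  · exact hx.lsdInProbability hXsymm hYsymm hXB hYB hp hμ hy hxui hyui hxy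

open SchurHadamard in
theorem mainTheorem1 {ι : Type*} {κ : Type*} (LX : Link ι) (LY : Link κ)
    (hXsymm : LX.IsSymm) (hYsymm : LY.IsSymm)
    (hXB : LX.PropertyB) (hYB : LY.PropertyB)
    (p : (h : ℕ) → Word h → Word h → ℝ) (hp : IsWordLimit LX LY p) :
    (∀ k : ℕ, limitMoment p (2 * k) ≤
      ((2 * k).factorial : ℝ) / (2 ^ k * (k.factorial : ℝ)) *
        ((min LX.Delta LY.Delta).toNat : ℝ) ^ k) ∧
    Carleman (limitMoment p) ∧
    ∃ μ : Measure ℝ, IsProbabilityMeasure μ ∧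
      (∀ h : ℕ, Integrable (fun t : ℝ => t ^ h) μ ∧ ∫ t, t ^ h ∂μ = limitMoment p h) ∧
      (∃ c : NNReal, HasSubgaussianMGF id c μ) ∧
      ∀ (Ω : Type*) [MeasurableSpace Ω] (P : Measure Ω) [IsProbabilityMeasure P]
        (x : ι → Ω → ℝ) (y : κ → Ω → ℝ),
        IndepFun (fun ω i => x i ω) (fun ω j => y j ω) P →
        (InputA1 P x → InputA1 P y →
          ExpectedMomentsTendsto P (scaledProduct LX LY x y) (limitMoment p) ∧
          FourthMomentSummable P (scaledProduct LX LY x y) ∧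
          LSDAlmostSurely P (scaledProduct LX LY x y) μ) ∧
        (LX.GrowthCond → LY.GrowthCond →
          (InputA3 P x → InputA3 P y → LSDAlmostSurely P (scaledProduct LX LY x y) μ) ∧
          (InputA2 P x ∨ InputA3 P x → InputA2 P y ∨ InputA3 P y →
            LSDInProbability P (scaledProduct LX LY x y) μ)) := by
  obtain ⟨hle, hC, μ, hμ, hmom, hsub, hlim⟩ :=
    mainTheorem1_general LX LY hXsymm hYsymm hXB hYB p hp
  exact ⟨hle, hC, μ, hμ, hmom, hsub, fun Ω _ P _ x y hxy =>
    ⟨fun hx hy => (hlim Ω P x y hxy).1 hx.inputA3 hy.inputA3, fun _ _ =>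
      ⟨fun hx hy => ((hlim Ω P x y hxy).1 hx hy).2.2, fun hx hy =>
        (hlim Ω P x y hxy).2 (hx.elim (·.1) (·.1)) (hy.elim (·.1) (·.1))
          (hx.elim (·.uniformIntegrable) (·.uniformIntegrable))
          (hy.elim (·.uniformIntegrable) (·.uniformIntegrable))⟩⟩⟩
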